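/- Setting. Let $E\subset\mathbb R$ and let $\mu$ be a Radon measure on $E$, where either $E$ is open and $\mu$ has no atoms, or $E$ is countable without accumulation points in $\mathbb R$ and $\mu$ is the counting measure. $\mathrm{Conf}(E)$ is the set of subsets $X\subset E$ without accumulation points in $\mathbb R$ (equivalently, with finitely many points in every bounded set), with the $\sigma$-algebra generated by the maps $X\mapsto\#(X\cap B)$, $B\subset E$ bounded Borel. Let $\mathbb P$ be a probability measure on $\mathrm{Conf}(E)$ that is determinantal with correlation kernel $K:E\times E\to\mathbb C$: for all $n$ and all bounded Borel compactly supported $f:E^n\to\mathbb C$, the expectation of the sum of $f(x_1,\dots,x_n)$ over pairwise distinct points of $X$ exists and equals $\int_{E^n} f(x_1,\dots,x_n)\det(K(x_i,x_j))_{i,j=1}^n\,d\mu(x_1)\cdots d\mu(x_n)$. Assume that $K$ is the (measurable) kernel of an orthogonal projection in $L^2(E,\mu)$ that is locally trace class, with $\mathrm{Tr}(\chi_BK\chi_B)=\int_BK(x,x)\,d\mu(x)<\infty$ for every bounded Borel set $B\subset E$. Let $R>0$ and let $f_k:E\to\mathbb C$ ($k\ge1$) be bounded measurable functions with $$\sup_{k\ge1}R^k\|f_k\|_{L^\infty(E,\mu)}<\infty,\qquad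 \int_E|f_1(x)|^2K(x,x)\,d\mu(x)<\infty,\qquad \int_E|f_k(x)|K(x,x)\,d\mu(x)<\infty\ \ (k\ge2).$$ For $|u|<R$ put $f_u(x)=\sum_{k\ge1}\frac{f_k(x)}{k}u^k$, which converges for $\mu$-almost every $x$. Assume that there is a $\mu$-measurable $h:E\to[0,\infty)$ with $\int_Eh(x)K(x,x)\,d\mu(x)<\infty$ such that for every compact $C\subset D(0,R)=\{|u|<R\}$ there are constants $M,A$ with $|f_u(x)-uf_1(x)|\le A\,h(x)$ for all $u\in C$ and $\mu$-almost every $x$ with $|x|\ge M$. Assume also that $$\int_E\Bigl|\exp\Bigl(\sum_{j=1}^{l}f_{w_j}(x)-\sum_{j=1}^{l'}f_{z_j}(x)\Bigr)-1\Bigr|^2K(x,x)\,d\mu(x)<\infty$$ for all $l,l'\in\mathbb N$ and all $w_1,\dots,w_l,z_1,\dots,z_{l'}\in D(0,R)$. Let $\Lambda$ be the algebra over $\mathbb C$ of symmetric functions (symmetric formal power series of bounded degree in countably many variables), with power sums $\mathbf p_k$, $k\ge1$. A specialization is an algebra homomorphism $\rho$ from $\Lambda$ to the Borel functions on $\mathrm{Conf}(E)$.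 It is an $R$-uniform $L^1$-specialization if 1. $\rho(F)\in L^1(\mathrm{Conf}(E),\mathbb P)$ for every $F\in\Lambda$; 2. for $\mathbb P$-almost every $X$, the series $S_X^\rho(u)=\sum_{k\ge1}\frac{\rho(\mathbf p_k)(X)}{k}u^k$ has radius of convergence at least $R$; 3. $\exp\bigl(\sum_{i=1}^n(S_X^\rho(w_i)-S_X^\rho(z_i))\bigr)\in L^1(\mathrm{Conf}(E),\mathbb P)$ for all $n\in\mathbb N$ and all $z_1,\dots,z_n,w_1,\dots,w_n\in D(0,R)$. Proposition. There exist specializations $\rho$ and $\tilde\rho$ such that, $\mathbb P$-almost surely, $$\rho(\mathbf p_k)=\sum_{x\in X}f_k(x)-\mathbb E_{\mathbb P}\sum_{x\in X}f_k(x)\quad(k\ge1),$$ $$\tilde\rho(\mathbf p_1)=\rho(\mathbf p_1),\qquad\tilde\rho(\mathbf p_k)=\sum_{x\in X}f_k(x)\quad(k\ge2),$$ and all such specializations are $R$-uniform $L^1$-specializations. Here, for $k\ge2$, the sums converge absolutely $\mathbb P$-almost surely and, where an expectation is taken, are integrable; for $k=1$ the difference is understood as the limit in $L^1(\mathrm{Conf}(E),\mathbb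 P)$, as $T\to\infty$, of $\sum_{x\in X,\,|x|\le T}f_1(x)-\mathbb E_{\mathbb P}\sum_{x\in X,\,|x|\le T}f_1(x)$. -/

import Mathlib

open MeasureTheory Filter Topology Set
open scoped ENNReal

noncomputable section

namespace GiambelliDPP

/-! ### Symmetric functions and specializations -/

/-- The algebra `Λ` over `ℂ` of symmetric functions in the variables `x₀, x₁, x₂, …`: formal power
series of bounded degree that are invariant under all permutations of the variables. -/
def symmFun : Subalgebra ℂ (MvPowerSeries ℕ ℂ) where
  carrier := {F | (∀ σ : Equiv.Perm ℕ, MvPowerSeries.renameEquiv ℂ σ F = F) ∧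
    ∃ d : ℕ, ∀ m : ℕ →₀ ℕ, d < m.degree → MvPowerSeries.coeff m F = 0}
  mul_mem' := by
    rintro F G ⟨hF, d, hd⟩ ⟨hG, e, he⟩
    refine ⟨fun σ => by rw [map_mul, hF, hG], d + e, fun m hm => ?_⟩
    classical
    rw [MvPowerSeries.coeff_mul]
    refine Finset.sum_eq_zero fun p hp => ?_
    rw [Finset.HasAntidiagonal.mem_antidiagonal] at hp
    have hdeg : p.1.degree + p.2.degree = m.degree := by rw [← hp, map_add]
    rcases lt_or_ge d p.1.degree with h | h
    · rw [hd _ h, zero_mul]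
    · rw [he p.2 (by omega), mul_zero]
  add_mem' := by
    rintro F G ⟨hF, d, hd⟩ ⟨hG, e, he⟩
    refine ⟨fun σ => by rw [map_add, hF, hG], d + e, fun m hm => ?_⟩
    rw [map_add, hd m (by omega), he m (by omega), add_zero]
  algebraMap_mem' := by
    intro c
    refine ⟨fun σ => AlgEquiv.commutes _ c, 0, fun m hm => ?_⟩
    classical
    rw [MvPowerSeries.algebraMap_apply, MvPowerSeries.coeff_C, if_neg]
    rintro rfl
    simp at hm

/-- The Newton power sum `∑ᵢ xᵢᵏ` as a power series (used for `k ≥ 1` only): the coefficient of a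
monomial is `1` if the monomial is `xᵢᵏ` for some `i`, and `0` otherwise. -/
def powerSumSeries (k : ℕ) : MvPowerSeries ℕ ℂ :=
  open Classical in fun m => if ∃ i : ℕ, m = Finsupp.single i k then 1 else 0

theorem coeff_powerSumSeries (k : ℕ) (m : ℕ →₀ ℕ) :
    MvPowerSeries.coeff m (powerSumSeries k) =
      open Classical in if ∃ i : ℕ, m = Finsupp.single i k then 1 else 0 := rfl

theorem powerSumSeries_mem (k : ℕ) : powerSumSeries k ∈ symmFun := by
  classical
  refine ⟨fun σ => ?_, k, fun m hm => ?_⟩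
  · ext m
    have hm : m = Finsupp.embDomain σ.toEmbedding (m.mapDomain σ.symm) := by
      rw [Finsupp.embDomain_eq_mapDomain, ← Finsupp.mapDomain_comp]
      simp
    have key : MvPowerSeries.coeff m (MvPowerSeries.renameEquiv ℂ σ (powerSumSeries k)) =
        MvPowerSeries.coeff (m.mapDomain σ.symm) (powerSumSeries k) := by
      conv_lhs => rw [hm]
      exact MvPowerSeries.coeff_embDomain_rename σ.toEmbedding _ _
    rw [key, coeff_powerSumSeries, coeff_powerSumSeries]
    congr 1
    refine propext ⟨?_, ?_⟩
    · rintro ⟨i, hi⟩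
      refine ⟨σ i, ?_⟩
      rw [hm, hi, Finsupp.embDomain_eq_mapDomain, Finsupp.mapDomain_single]
      rfl
    · rintro ⟨i, rfl⟩
      exact ⟨σ.symm i, Finsupp.mapDomain_single⟩
  · rw [coeff_powerSumSeries, if_neg]
    rintro ⟨i, rfl⟩
    simp at hm

/-- The Newton power sum `p_k` (`k ≥ 1`) as an element of `Λ`. -/
def powerSum (k : ℕ) : symmFun := ⟨powerSumSeries k, powerSumSeries_mem k⟩

/-- The algebra of complex-valued measurable functions on a measurable space. -/
def measFun (Ω : Type*) [MeasurableSpace Ω] : Subalgebra ℂ (Ω → ℂ) where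
  carrier := {F | Measurable F}
  mul_mem' := fun hF hG => Measurable.mul hF hG
  add_mem' := fun hF hG => Measurable.add hF hG
  algebraMap_mem' := fun _ => measurable_const

/-! ### Configurations and point processes -/

/-- The space `Conf(E)` of configurations on `E ⊆ ℝ`: subsets of `E` with finitely many points in
every bounded set, equivalently without accumulation points in `ℝ` (see `noAccPt_iff`). -/
def Conf (E : Set ℝ) : Type :=
  {X : Set E // ∀ B : Set E, Bornology.IsBounded B → (X ∩ B).Finite}

theorem noAccPt_iff {E : Set ℝ} (X : Set E) :
    (∀ x : ℝ, ¬ AccPt x (𝓟 ((↑) '' X : Set ℝ))) ↔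
      ∀ B : Set E, Bornology.IsBounded B → (X ∩ B).Finite := by
  constructor
  · intro h B hB
    by_contra hinf
    have hinf' : (((↑) : E → ℝ) '' (X ∩ B)).Infinite :=
      Set.Infinite.image Subtype.val_injective.injOn hinf
    have hb : Bornology.IsBounded (((↑) : E → ℝ) '' B) :=
      LipschitzWith.subtype_val E |>.isBounded_image hB
    obtain ⟨x, -, hx⟩ := hinf'.exists_accPt_of_subset_isCompact hb.isCompact_closure
      ((Set.image_mono inter_subset_right).trans subset_closure)
    exact h x (hx.mono (principal_mono.2 (Set.image_mono inter_subset_left)))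
  · intro h x hx
    have hfin : (((↑) : E → ℝ) '' X ∩ Metric.ball x 1).Finite := by
      have hB : Bornology.IsBounded (((↑) : E → ℝ) ⁻¹' Metric.ball x 1) := by
        rw [Metric.isBounded_iff]
        exact ⟨2, fun a ha b hb => by
          have h1 := Metric.mem_ball.1 ha
          have h2 := Metric.mem_ball'.1 hb
          have h3 := dist_triangle (a : ℝ) x b
          rw [Subtype.dist_eq]; linarith⟩
      refine ((h _ hB).image ((↑) : E → ℝ)).subset ?_
      rintro _ ⟨⟨y, hy, rfl⟩, hy'⟩
      exact ⟨y, ⟨hy, hy'⟩, rfl⟩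
    rw [accPt_iff_nhds] at hx
    have hcl : IsClosed ((((↑) : E → ℝ) '' X ∩ Metric.ball x 1) \ {x}) :=
      (hfin.subset sdiff_subset).isClosed
    obtain ⟨y, ⟨⟨hy1, hy2⟩, hyX⟩, hne⟩ := hx
      (Metric.ball x 1 ∩ ((((↑) : E → ℝ) '' X ∩ Metric.ball x 1) \ {x})ᶜ)
      (inter_mem (Metric.ball_mem_nhds x one_pos) (hcl.isOpen_compl.mem_nhds (by simp)))
    exact hy2 ⟨⟨hyX, hy1⟩, hne⟩

/-- The sigma-algebra generated by the counting maps `X ↦ #(X ∩ B)`, `B` bounded Borel. -/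
instance (E : Set ℝ) : MeasurableSpace (Conf E) :=
  ⨆ (B : Set E) (_ : Bornology.IsBounded B ∧ MeasurableSet B),
    MeasurableSpace.comap (fun X : Conf E => (X.1 ∩ B).ncard) ⊤

/-- A specialization: an algebra homomorphism from `Λ` to the Borel functions on `Conf(E)`. -/
abbrev SymmSpecialization (E : Set ℝ) : Type := symmFun →ₐ[ℂ] measFun (Conf E)

/-- The function `ρ(F)` on `Conf(E)`. -/
def SymmSpecialization.app {E : Set ℝ} (ρ : SymmSpecialization E) (F : symmFun) (X : Conf E) : ℂ :=
  (ρ F : Conf E → ℂ) X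

/-- Sum of `f` over the `n`-tuples of pairwise distinct points of the configuration `X`. -/
def distinctSum {E : Set ℝ} {n : ℕ} (f : (Fin n → E) → ℂ) (X : Conf E) : ℂ :=
  ∑' s : Fin n ↪ X.1, f fun i => (s i : E)

/-- `P` is a determinantal point process on `(E, μ)` with correlation kernel `K`. -/
def IsDeterminantal {E : Set ℝ} (μ : Measure E) (K : E → E → ℂ) (P : Measure (Conf E)) : Prop :=
  ∀ (n : ℕ) (f : (Fin n → E) → ℂ), Measurable f → (∃ C : ℝ, ∀ x, ‖f x‖ ≤ C) →
    HasCompactSupport f →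
    Integrable (distinctSum f) P ∧
    Integrable (fun x : Fin n → E => f x * (Matrix.of fun i j => K (x i) (x j)).det)
      (Measure.pi fun _ => μ) ∧
    ∫ X, distinctSum f X ∂P =
      ∫ x : Fin n → E, f x * (Matrix.of fun i j => K (x i) (x j)).det ∂(Measure.pi fun _ => μ)

/-! ### Projection kernels -/

/-- Multiplication by the indicator function `χ_B` on `L²(E, μ)`. -/
def cutoff {E : Set ℝ} {μ : Measure E} {B : Set E} (hB : MeasurableSet B) (φ : Lp ℂ 2 μ) :
    Lp ℂ 2 μ :=
  ((Lp.memLp φ).indicator hB).toLp (B.indicator φ)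

/-- `K` is the kernel of a locally trace class orthogonal projection `T` of `L²(E, μ)`.
The condition `K(x, ·) ∈ L²` says that `(Kφ)(x) = ∫ K(x,y) φ(y) dμ(y)` makes sense for all
`φ ∈ L²`. As `χ_B T χ_B` is positive, it is trace class iff its diagonal series in an orthonormal
basis converges, and its trace is the sum of that series in any such basis; the last condition is
`Tr(χ_B K χ_B) = ∫_B K(x,x) dμ(x) < ∞` for bounded Borel `B`, which normalizes `K` on the
diagonal. -/
structure IsProjectionKernel {E : Set ℝ} (μ : Measure E) (K : E → E → ℂ) : Prop where
  measurable : Measurable (Function.uncurry K)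
  memLp : ∀ᵐ x ∂μ, MemLp (K x) 2 μ
  exists_projection : ∃ T : Lp ℂ 2 μ →L[ℂ] Lp ℂ 2 μ, IsStarProjection T ∧
    (∀ φ : Lp ℂ 2 μ, T φ =ᵐ[μ] fun x => ∫ y, K x y * φ y ∂μ) ∧
    ∀ (B : Set E) (hB : MeasurableSet B), Bornology.IsBounded B →
      IntegrableOn (fun x => K x x) B μ ∧
      ∀ (ι : Type) (b : HilbertBasis ι ℂ (Lp ℂ 2 μ)),
        HasSum (fun i => inner ℂ (b i) (cutoff hB (T (cutoff hB (b i))))) (∫ x in B, K x x ∂μ)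

/-! ### Uniform `L¹`-specializations -/

/-- The coefficients `ρ(p_k)(X) / k`, `k ≥ 1`, of the series `S_X^ρ`. -/
def logCoeff {E : Set ℝ} (ρ : SymmSpecialization E) (X : Conf E) (k : ℕ) : ℂ :=
  if k = 0 then 0 else ρ.app (powerSum k) X / k

/-- The sum `S_X^ρ(u) = ∑_{k ≥ 1} (ρ(p_k)(X) / k) u^k`. -/
def logSeries {E : Set ℝ} (ρ : SymmSpecialization E) (X : Conf E) (u : ℂ) : ℂ :=
  ∑' k : ℕ, logCoeff ρ X k * u ^ k

/-- `ρ` is an `R`-uniform `L¹`-specialization for `P`. -/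
structure IsUniformL1Specialization {E : Set ℝ} (P : Measure (Conf E)) (R : ℝ)
    (ρ : SymmSpecialization E) : Prop where
  integrable : ∀ F : symmFun, Integrable (ρ.app F) P
  le_radius : ∀ᵐ X ∂P,
    ENNReal.ofReal R ≤ (FormalMultilinearSeries.ofScalars ℂ (logCoeff ρ X)).radius
  integrable_exp : ∀ (n : ℕ) (z w : Fin n → ℂ), (∀ i, ‖z i‖ < R) → (∀ i, ‖w i‖ < R) →
    Integrable (fun X => Complex.exp (∑ i, (logSeries ρ X (w i) - logSeries ρ X (z i)))) P

/-! ### Additive functionals -/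

/-- The sum `∑_{x ∈ X, |x| ≤ T} f(x)`, a finite sum. -/
def truncSum {E : Set ℝ} (f : E → ℂ) (T : ℝ) (X : Conf E) : ℂ :=
  ∑' x : X.1, if |((x : E) : ℝ)| ≤ T then f x else 0

/-- `Φ` is the regularized sum `∑_{x ∈ X} f(x) - 𝔼 ∑_{x ∈ X} f(x)`, that is, the limit in
`L¹(Conf(E), P)` of `∑_{|x| ≤ T} f(x) - 𝔼 ∑_{|x| ≤ T} f(x)` as `T → ∞`. -/
def IsRegularizedSum {E : Set ℝ} (P : Measure (Conf E)) (f : E → ℂ) (Φ : Conf E → ℂ) : Prop :=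
  (∀ T : ℝ, Integrable (truncSum f T) P) ∧
  Tendsto (fun T : ℝ =>
    eLpNorm (fun X => truncSum f T X - (∫ Y, truncSum f T Y ∂P) - Φ X) 1 P) atTop (𝓝 0)

/-- `Φ` is the sum `∑_{x ∈ X} f(x)`, absolutely convergent almost surely. -/
def IsSum {E : Set ℝ} (P : Measure (Conf E)) (f : E → ℂ) (Φ : Conf E → ℂ) : Prop :=
  ∀ᵐ X ∂P, HasSum (fun x : X.1 => f x) (Φ X)

/-- `Φ` is `∑_{x ∈ X} f(x) - 𝔼 ∑_{x ∈ X} f(x)`, where the sum converges absolutely almost surely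
and is integrable. -/
def IsCenteredSum {E : Set ℝ} (P : Measure (Conf E)) (f : E → ℂ) (Φ : Conf E → ℂ) : Prop :=
  ∃ S : Conf E → ℂ, Integrable S P ∧ IsSum P f S ∧ ∀ᵐ X ∂P, Φ X = S X - ∫ Y, S Y ∂P

/-- `ρ(p_k) = ∑ f_k - 𝔼 ∑ f_k` for all `k ≥ 1`; for `k = 1` the sum need not converge absolutely
and the difference is the regularized sum. -/
def IsCenteredSpecialization {E : Set ℝ} (P : Measure (Conf E)) (f : ℕ → E → ℂ)
    (ρ : SymmSpecialization E) : Prop :=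
  IsRegularizedSum P (f 1) (ρ.app (powerSum 1)) ∧
  ∀ k, 2 ≤ k → IsCenteredSum P (f k) (ρ.app (powerSum k))

/-- `ρ(p_1) = ∑ f_1 - 𝔼 ∑ f_1` (regularized) and `ρ(p_k) = ∑ f_k` for all `k ≥ 2`. -/
def IsPartlyCenteredSpecialization {E : Set ℝ} (P : Measure (Conf E)) (f : ℕ → E → ℂ)
    (ρ : SymmSpecialization E) : Prop :=
  IsRegularizedSum P (f 1) (ρ.app (powerSum 1)) ∧
  ∀ k, 2 ≤ k → IsSum P (f k) (ρ.app (powerSum k))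

/-- The function `f_u(x) = ∑_{k ≥ 1} (f_k(x) / k) u^k`. -/
def genFun {E : Set ℝ} (f : ℕ → E → ℂ) (u : ℂ) (x : E) : ℂ :=
  ∑' k : ℕ, f (k + 1) x / ((k : ℂ) + 1) * u ^ (k + 1)

end GiambelliDPP

end

noncomputable section

namespace GiambelliDPP

/-! ### The algebra of symmetric functions is freely generated by the power sums -/

/-! Everything rests on exponential moments. Let ν be the measure K(x,x) dμ(x). The process is
dominated by the Poisson process of intensity ν in the sense that E exp(∑ g) ≤ exp ∫ (e^g − 1) dν
(`IsDeterminantal.isSubPoisson`). For bounded compactly supported g put ψ = e^g − 1 ≥ −1. The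
expectation is then the Fredholm series of K with weight ψ. Expanding K(x,y) = ∑ φ_a(x) conj φ_a(y)
(`IsProjectionKernel.exists_expansion`) and keeping finitely many terms turns the series into det(1
+ A) with A = (∫ ψ φ_a conj φ_b). Bessel's inequality makes 1 + A positive semidefinite, and λ ≤
e^(λ−1) on its eigenvalues gives det(1 + A) ≤ e^(tr A). Hadamard's inequality supplies the
domination needed to remove the truncation (`IsKernelExpansion.re_fredholm_le`).

Subtracting the mean cancels the linear term: for real integrable g with |g| ≤ C, E exp(∑ g − ∫ g
dν) ≤ exp(e^C ∫ g² dν). So the centred truncated sums of f_1 are Cauchy in L² and their limit has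
all exponential moments, although f_1 is only square integrable (`exists_isRegularizedSum`,
`lintegral_exp_isRegularizedSum_lt_top`).

For k ≥ 2, Cauchy's estimates on a circle of radius s, r < s < R, turn the domination of f_u − u f_1
by h into a bounded ν-integrable G with ∑_{k ≥ 2} |f_k| r^k / k ≤ G (`exists_integrable_majorant`).
The part of S_X(u) beyond its linear term is thus bounded, for |u| ≤ r, by ∑_{x ∈ X} G(x) + ∫ G dν,
which again has all exponential moments.

These bounds give all three conditions: moments of every order pass to polynomials in the p_k by
Hölder, finiteness of the tails gives the radius of convergence, and the exponentials are integrable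
(`isUniformL1Specialization_of_hasExpMoments`). Existence is algebraic: the power sums generate Λ
freely, so their images can be prescribed (`exists_algHom_powerSum`). -/

/-- Newton's identity writes k e_k through power sums and e_j with j < k, and k is invertible in ℂ.
-/
theorem esymm_mem_adjoin_psum (n k : ℕ) :
    MvPolynomial.esymm (Fin n) ℂ k ∈
      Algebra.adjoin ℂ (Set.range fun i : Fin n => MvPolynomial.psum (Fin n) ℂ (i + 1)) := by
  induction k using Nat.strong_induction_on with
  | _ k ih =>
    set S := Algebra.adjoin ℂ (Set.range fun i : Fin n => MvPolynomial.psum (Fin n) ℂ (i + 1))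
    rcases Nat.eq_zero_or_pos k with rfl | hk
    · simp
    rcases lt_or_ge n k with hnk | hnk
    · rw [MvPolynomial.esymm, Finset.powersetCard_eq_empty.2 (by simpa using hnk)]
      simp
    · have key : (k : MvPolynomial (Fin n) ℂ) * MvPolynomial.esymm (Fin n) ℂ k ∈ S := by
        rw [MvPolynomial.mul_esymm_eq_sum]
        refine S.mul_mem (S.pow_mem (S.neg_mem S.one_mem) _) (S.sum_mem fun a ha => ?_)
        rw [Finset.mem_filter, Finset.HasAntidiagonal.mem_antidiagonal] at ha
        have ha1 := ha.1
        refine S.mul_mem (S.mul_mem (S.pow_mem (S.neg_mem S.one_mem) _) (ih _ ha.2)) ?_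
        refine Algebra.subset_adjoin ⟨⟨a.2 - 1, by omega⟩, ?_⟩
        simp only
        congr 1
        omega
      have h2 := S.smul_mem key ((k : ℂ)⁻¹)
      have hk0 : (k : ℂ) ≠ 0 := by exact_mod_cast hk.ne'
      have e : (k : MvPolynomial (Fin n) ℂ) = MvPolynomial.C (k : ℂ) := by simp
      rwa [e, MvPolynomial.C_mul', smul_smul, inv_mul_cancel₀ hk0, one_smul] at h2

/-- The homomorphism `X_i ↦ p_{i+1}` to the symmetric polynomials in `n` variables. -/
def psumAlgHom (n : ℕ) :
    MvPolynomial (Fin n) ℂ →ₐ[ℂ] MvPolynomial.symmetricSubalgebra (Fin n) ℂ :=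
  MvPolynomial.aeval fun i =>
    ⟨MvPolynomial.psum (Fin n) ℂ (i + 1), MvPolynomial.psum_isSymmetric _ _ _⟩

theorem psumAlgHom_coe (n : ℕ) (q : MvPolynomial (Fin n) ℂ) :
    (psumAlgHom n q : MvPolynomial (Fin n) ℂ) =
      MvPolynomial.aeval (fun i : Fin n => MvPolynomial.psum (Fin n) ℂ (i + 1)) q :=
  (Subalgebra.mvPolynomial_aeval_coe _ _ _).symm

theorem psumAlgHom_surjective (n : ℕ) : Function.Surjective (psumAlgHom n) := by
  rintro ⟨F, hF⟩
  obtain ⟨q, hq⟩ := MvPolynomial.esymmAlgHom_surjective (σ := Fin n) ℂ (n := n) (by simp) ⟨F, hF⟩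
  have hq' := MvPolynomial.esymmAlgHom_apply (σ := Fin n) (R := ℂ) q
  rw [hq] at hq'
  have hmem : F ∈
      Algebra.adjoin ℂ (Set.range fun i : Fin n => MvPolynomial.psum (Fin n) ℂ (i + 1)) := by
    change F = _ at hq'
    rw [hq']
    have h1 : MvPolynomial.aeval (fun i : Fin n => MvPolynomial.esymm (Fin n) ℂ (i + 1)) q ∈
        Algebra.adjoin ℂ (Set.range fun i : Fin n => MvPolynomial.esymm (Fin n) ℂ (i + 1)) := by
      rw [Algebra.adjoin_range_eq_range_aeval]
      exact ⟨q, rfl⟩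
    refine Algebra.adjoin_le ?_ h1
    rintro _ ⟨i, rfl⟩
    exact esymm_mem_adjoin_psum n _
  rw [Algebra.adjoin_range_eq_range_aeval] at hmem
  obtain ⟨r, hr⟩ := hmem
  exact ⟨r, Subtype.ext (by rw [psumAlgHom_coe]; exact hr)⟩

/-- The kernels of the powers of g increase, hence stabilise at some n. An element of ker g has the
form g^n b, so b lies in ker g^(n+1) = ker g^n and the element is 0. -/
theorem injective_of_surjective_of_isNoetherianRing {A : Type*} [CommRing A] [IsNoetherianRing A]
    (g : A →+* A) (hg : Function.Surjective g) : Function.Injective g := by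
  have hmono : Monotone fun n : ℕ => RingHom.ker (g ^ n) := by
    refine monotone_nat_of_le_succ fun n x hx => ?_
    rw [RingHom.mem_ker] at hx ⊢
    rw [pow_succ', RingHom.coe_mul, Function.comp_apply, hx, map_zero]
  obtain ⟨n, hn⟩ := monotone_stabilizes_iff_noetherian.2 ‹IsNoetherianRing A› ⟨_, hmono⟩
  rw [injective_iff_map_eq_zero]
  intro a ha
  have hs : Function.Surjective (g ^ n) := by
    rw [RingHom.coe_pow]; exact hg.iterate n
  obtain ⟨b, rfl⟩ := hs a
  have h1 : b ∈ RingHom.ker (g ^ (n + 1)) := by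
    rw [RingHom.mem_ker, pow_succ', RingHom.coe_mul, Function.comp_apply, ha]
  have h2 := hn (n + 1) (Nat.le_succ n)
  simp only [OrderHom.coe_mk] at h2
  rw [← h2] at h1
  exact h1

/-- By the fundamental theorem the symmetric polynomials are themselves a polynomial ring in n
variables, so the map is in effect a surjective endomorphism of a Noetherian ring. No Jacobian or
leading-term argument is needed. -/
theorem psumAlgHom_injective (n : ℕ) : Function.Injective (psumAlgHom n) := by
  set e := MvPolynomial.esymmAlgEquiv (Fin n) ℂ (n := n) (by simp)
  let g : MvPolynomial (Fin n) ℂ →ₐ[ℂ] MvPolynomial (Fin n) ℂ :=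
    (e.symm : _ →ₐ[ℂ] MvPolynomial (Fin n) ℂ).comp (psumAlgHom n)
  have hg : Function.Surjective g := e.symm.surjective.comp (psumAlgHom_surjective n)
  have h : Function.Injective g := injective_of_surjective_of_isNoetherianRing g.toRingHom hg
  exact Function.Injective.of_comp (f := e.symm) h

/-! ### Passing between finitely and infinitely many variables -/

/-- Restriction of a power series in infinitely many variables to the first `n` variables. -/
abbrev restrictVars (n : ℕ) : MvPowerSeries ℕ ℂ →ₐ[ℂ] MvPowerSeries (Fin n) ℂ :=
  MvPowerSeries.killCompl Fin.valEmbedding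

theorem coeff_psum (n k : ℕ) (m : Fin n →₀ ℕ) :
    MvPolynomial.coeff m (MvPolynomial.psum (Fin n) ℂ k) =
      ∑ i : Fin n, if Finsupp.single i k = m then 1 else 0 := by
  classical
  rw [MvPolynomial.psum, MvPolynomial.coeff_sum]
  exact Finset.sum_congr rfl fun i _ => MvPolynomial.coeff_X_pow i m k

/-- The case k = 0 must be excluded: there the series is the constant 1, while the polynomial power
sum is n. -/
theorem restrictVars_powerSumSeries (n k : ℕ) (hk : k ≠ 0) :
    restrictVars n (powerSumSeries k) = (MvPolynomial.psum (Fin n) ℂ k : MvPowerSeries _ _) := by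
  classical
  ext m
  rw [MvPowerSeries.coeff_killCompl, coeff_powerSumSeries, MvPolynomial.coeff_coe, coeff_psum]
  split_ifs with h
  · obtain ⟨i, hi⟩ := h
    have hi' : i ∈ (Finsupp.embDomain Fin.valEmbedding m).support := by
      rw [hi]; simp [hk]
    rw [Finsupp.support_embDomain, Finset.mem_map] at hi'
    obtain ⟨j, -, rfl⟩ := hi'
    rw [← Finsupp.embDomain_single] at hi
    have hm := Finsupp.embDomain_injective _ hi
    subst hm
    rw [Finset.sum_eq_single j (fun b _ hb => if_neg fun h => hb ?_) (by simp), if_pos rfl]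
    exact (Finsupp.single_left_inj hk).1 h
  · symm
    refine Finset.sum_eq_zero fun i _ => if_neg fun hi => h ⟨i, ?_⟩
    rw [← hi, Finsupp.embDomain_single]
    rfl

theorem coeff_renameEquiv_mapDomain (σ : Equiv.Perm ℕ) (F : MvPowerSeries ℕ ℂ) (m : ℕ →₀ ℕ) :
    MvPowerSeries.coeff (m.mapDomain σ) (MvPowerSeries.renameEquiv ℂ σ F) =
      MvPowerSeries.coeff m F := by
  have := MvPowerSeries.coeff_embDomain_rename σ.toEmbedding F m
  rw [Finsupp.embDomain_eq_mapDomain] at this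
  exact this

theorem symmFun.coeff_mapDomain {F : MvPowerSeries ℕ ℂ} (hF : F ∈ symmFun) (σ : Equiv.Perm ℕ)
    (m : ℕ →₀ ℕ) : MvPowerSeries.coeff (m.mapDomain σ) F = MvPowerSeries.coeff m F := by
  conv_lhs => rw [← hF.1 σ]
  exact coeff_renameEquiv_mapDomain σ F m

/-- A bijection from the support onto a subset of {0, …, n − 1} of the same size extends to a
permutation of ℕ. -/
theorem exists_perm_mapDomain_eq_embDomain (m : ℕ →₀ ℕ) (n : ℕ) (h : m.support.card ≤ n) :
    ∃ (σ : Equiv.Perm ℕ) (m' : Fin n →₀ ℕ),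
      m.mapDomain σ = Finsupp.embDomain Fin.valEmbedding m' := by
  classical
  obtain ⟨t, ht, hc⟩ := Finset.exists_subset_card_eq
    (s := Finset.range n) (n := m.support.card) (by simpa using h)
  obtain ⟨σ, hσ⟩ : ∃ σ : Equiv.Perm ℕ, m.support.map σ.toEmbedding = t := by
    let e0 : m.support ≃ t := Finset.equivOfCardEq hc.symm
    refine ⟨e0.extendSubtype, ?_⟩
    refine Finset.eq_of_subset_of_card_le (fun y hy => ?_) (by rw [Finset.card_map, hc])
    obtain ⟨x, hx, rfl⟩ := Finset.mem_map.1 hy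
    exact e0.extendSubtype_mem x hx
  refine ⟨σ, ?_⟩
  have hr : m.mapDomain σ ∈ Set.range (Finsupp.embDomain (M := ℕ) (Fin.valEmbedding (n := n))) := by
    rw [Finsupp.mem_range_embDomain_iff]
    intro x hx
    have hx' : x ∈ t := by
      rw [← hσ]
      have := Finsupp.mapDomain_support (f := σ) (s := m) hx
      obtain ⟨y, hy, rfl⟩ := Finset.mem_image.1 this
      exact Finset.mem_map_of_mem σ.toEmbedding hy
    exact ⟨⟨x, Finset.mem_range.1 (ht hx')⟩, rfl⟩
  obtain ⟨m', hm'⟩ := hr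
  exact ⟨m', hm'.symm⟩

theorem card_support_le_degree (m : ℕ →₀ ℕ) : m.support.card ≤ m.degree := by
  rw [Finsupp.degree_apply, Finset.card_eq_sum_ones]
  exact Finset.sum_le_sum fun i hi => Nat.one_le_iff_ne_zero.2 (Finsupp.mem_support_iff.1 hi)

/-- A monomial of degree at most n involves at most n variables, so by symmetry its coefficient can
be read off in the first n variables. -/
theorem symmFun.coeff_eq_of_restrictVars_eq {F G : MvPowerSeries ℕ ℂ} (hF : F ∈ symmFun)
    (hG : G ∈ symmFun) {n : ℕ} (h : restrictVars n F = restrictVars n G) (m : ℕ →₀ ℕ)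
    (hm : m.degree ≤ n) : MvPowerSeries.coeff m F = MvPowerSeries.coeff m G := by
  obtain ⟨σ, m', hm'⟩ := exists_perm_mapDomain_eq_embDomain m n
    ((card_support_le_degree m).trans hm)
  rw [← symmFun.coeff_mapDomain hF σ, ← symmFun.coeff_mapDomain hG σ, hm',
    ← MvPowerSeries.coeff_killCompl, ← MvPowerSeries.coeff_killCompl, h]

theorem symmFun.exists_restrictVars_eq {F : MvPowerSeries ℕ ℂ} (hF : F ∈ symmFun) (n : ℕ) :
    ∃ q : MvPolynomial (Fin n) ℂ, q.IsSymmetric ∧ restrictVars n F = q := by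
  classical
  obtain ⟨d, hd⟩ := hF.2
  have hzero : ∀ m : Fin n →₀ ℕ, d < m.degree →
      MvPowerSeries.coeff m (restrictVars n F) = 0 := fun m hm => by
    rw [MvPowerSeries.coeff_killCompl]
    refine hd _ ?_
    rw [Finsupp.embDomain_eq_mapDomain]
    simpa [Finsupp.degree_mapDomain] using hm
  let q : MvPolynomial (Fin n) ℂ := ∑ m ∈ (Finsupp.finite_of_degree_le (σ := Fin n) d).toFinset,
    MvPolynomial.monomial m (MvPowerSeries.coeff m (restrictVars n F))
  have hq : ∀ m, MvPolynomial.coeff m q = MvPowerSeries.coeff m (restrictVars n F) := by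
    intro m
    simp only [q, MvPolynomial.coeff_sum, MvPolynomial.coeff_monomial, Finset.sum_ite_eq']
    split_ifs with h
    · rfl
    · refine (hzero m ?_).symm
      simpa using h
  refine ⟨q, fun σ => ?_, by ext m; rw [MvPolynomial.coeff_coe, hq]⟩
  ext m
  obtain ⟨m', rfl⟩ : ∃ m', m = Finsupp.mapDomain σ m' :=
    ⟨m.mapDomain σ.symm, by rw [← Finsupp.mapDomain_comp]; simp⟩
  -- Symmetry in n variables follows from symmetry of F under the permutation of ℕ that extends σ by
  -- the identity.
  rw [MvPolynomial.coeff_rename_mapDomain _ σ.injective, hq, hq, MvPowerSeries.coeff_killCompl,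
    MvPowerSeries.coeff_killCompl,
    ← symmFun.coeff_mapDomain hF (σ.viaEmbedding Fin.valEmbedding)]
  congr 1
  rw [Finsupp.embDomain_eq_mapDomain, Finsupp.embDomain_eq_mapDomain, ← Finsupp.mapDomain_comp,
    ← Finsupp.mapDomain_comp]
  refine congrArg (fun g => MvPowerSeries.coeff (Finsupp.mapDomain g m')) (funext fun i => ?_)
  exact Equiv.Perm.viaEmbedding_apply σ Fin.valEmbedding i

/-- The algebra is spanned by products of power sums, which are homogeneous. Discarding the terms of
degree above d therefore keeps or kills each spanning element as a whole. -/
theorem exists_truncation_mem_adjoin {G : MvPowerSeries ℕ ℂ}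
    (hG : G ∈ Algebra.adjoin ℂ (Set.range fun k : ℕ => powerSumSeries (k + 1))) (d : ℕ) :
    ∃ G' ∈ Algebra.adjoin ℂ (Set.range fun k : ℕ => powerSumSeries (k + 1)),
      ∀ m : ℕ →₀ ℕ, MvPowerSeries.coeff m G' =
        if m.degree ≤ d then MvPowerSeries.coeff m G else 0 := by
  classical
  set A := Algebra.adjoin ℂ (Set.range fun k : ℕ => powerSumSeries (k + 1)) with hA
  have hG' := hG
  rw [← Subalgebra.mem_toSubmodule, hA, Algebra.adjoin_eq_span] at hG'
  clear hG
  induction hG' using Submodule.span_induction with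
  | mem H hH =>
    have hmem : H ∈ A := by
      rw [hA, ← Subalgebra.mem_toSubmodule, Algebra.adjoin_eq_span]
      exact Submodule.subset_span hH
    have hhom : ∃ k : ℕ, ∀ m : ℕ →₀ ℕ, m.degree ≠ k → MvPowerSeries.coeff m H = 0 := by
      clear hmem
      induction hH using Submonoid.closure_induction with
      | mem H hH =>
        obtain ⟨k, rfl⟩ := hH
        refine ⟨k + 1, fun m hm => ?_⟩
        simp only
        rw [coeff_powerSumSeries, if_neg]
        rintro ⟨i, rfl⟩
        simp at hm
      | one =>
        refine ⟨0, fun m hm => ?_⟩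
        rw [MvPowerSeries.coeff_one, if_neg]
        rintro rfl
        simp at hm
      | mul H₁ H₂ _ _ h₁ h₂ =>
        obtain ⟨k₁, h₁⟩ := h₁
        obtain ⟨k₂, h₂⟩ := h₂
        refine ⟨k₁ + k₂, fun m hm => ?_⟩
        rw [MvPowerSeries.coeff_mul]
        refine Finset.sum_eq_zero fun p hp => ?_
        rw [Finset.HasAntidiagonal.mem_antidiagonal] at hp
        have hdeg : p.1.degree + p.2.degree = m.degree := by rw [← hp, map_add]
        by_cases h : p.1.degree = k₁
        · rw [h₂ p.2 (by omega), mul_zero]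
        · rw [h₁ _ h, zero_mul]
    obtain ⟨k, hk⟩ := hhom
    by_cases hkd : k ≤ d
    · refine ⟨H, hmem, fun m => ?_⟩
      split_ifs with h
      · rfl
      · exact hk m (by omega)
    · refine ⟨0, A.zero_mem, fun m => ?_⟩
      rw [map_zero]
      split_ifs with h
      · exact (hk m (by omega)).symm
      · rfl
  | zero => exact ⟨0, A.zero_mem, fun m => by simp⟩
  | add G₁ G₂ _ _ h₁ h₂ =>
    obtain ⟨H₁, hm₁, h₁⟩ := h₁
    obtain ⟨H₂, hm₂, h₂⟩ := h₂
    refine ⟨H₁ + H₂, A.add_mem hm₁ hm₂, fun m => ?_⟩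
    rw [map_add, h₁, h₂, map_add]
    split_ifs <;> simp
  | smul c G₁ _ h₁ =>
    obtain ⟨H₁, hm₁, h₁⟩ := h₁
    refine ⟨c • H₁, A.smul_mem hm₁ c, fun m => ?_⟩
    rw [map_smul, h₁, map_smul]
    split_ifs <;> simp

theorem adjoin_powerSumSeries_le :
    Algebra.adjoin ℂ (Set.range fun k : ℕ => powerSumSeries (k + 1)) ≤ symmFun :=
  Algebra.adjoin_le (by rintro _ ⟨k, rfl⟩; exact powerSumSeries_mem _)

theorem restrictVars_aeval_powerSumSeries (n : ℕ) (q : MvPolynomial (Fin n) ℂ) :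
    restrictVars n (MvPolynomial.aeval (fun i : Fin n => powerSumSeries (i + 1)) q) =
      (psumAlgHom n q : MvPolynomial (Fin n) ℂ) := by
  rw [psumAlgHom_coe]
  have h : (restrictVars n).comp (MvPolynomial.aeval fun i : Fin n => powerSumSeries (i + 1)) =
      (MvPolynomial.coeToMvPowerSeries.algHom ℂ).comp
        (MvPolynomial.aeval fun i : Fin n => MvPolynomial.psum (Fin n) ℂ (i + 1)) := by
    ext i : 1
    simp [restrictVars_powerSumSeries]
  have := AlgHom.congr_fun h q
  simpa using this

/-- If F has degree at most d, its restriction to d variables is a polynomial in p_1, …, p_d. The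
same polynomial in the power sum series agrees with F up to degree d; the terms it may have in
higher degrees are removed by truncation. -/
theorem symmFun_le_adjoin_powerSumSeries :
    symmFun ≤ Algebra.adjoin ℂ (Set.range fun k : ℕ => powerSumSeries (k + 1)) := by
  intro F hF
  obtain ⟨d, hd⟩ := hF.2
  obtain ⟨q, hq, hFq⟩ := symmFun.exists_restrictVars_eq hF d
  obtain ⟨r, hr⟩ := psumAlgHom_surjective d ⟨q, hq⟩
  have hG : MvPolynomial.aeval (fun i : Fin d => powerSumSeries (i + 1)) r ∈
      Algebra.adjoin ℂ (Set.range fun k : ℕ => powerSumSeries (k + 1)) := by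
    have h1 : MvPolynomial.aeval (fun i : Fin d => powerSumSeries (i + 1)) r ∈
        Algebra.adjoin ℂ (Set.range fun i : Fin d => powerSumSeries (i + 1)) := by
      rw [Algebra.adjoin_range_eq_range_aeval]
      exact ⟨r, rfl⟩
    refine Algebra.adjoin_mono ?_ h1
    rintro _ ⟨i, rfl⟩
    exact ⟨i, rfl⟩
  obtain ⟨G', hG', hc⟩ := exists_truncation_mem_adjoin hG d
  suffices F = G' by rwa [this]
  ext m
  rw [hc]
  split_ifs with h
  · refine symmFun.coeff_eq_of_restrictVars_eq hF (adjoin_powerSumSeries_le hG) (n := d) ?_ m h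
    rw [restrictVars_aeval_powerSumSeries, hr, hFq]
  · exact hd m (by omega)

theorem adjoin_powerSum_eq_top :
    Algebra.adjoin ℂ (Set.range fun k : ℕ => powerSum (k + 1)) = ⊤ := by
  refine Algebra.eq_top_iff.2 fun F => ?_
  have hF := symmFun_le_adjoin_powerSumSeries F.2
  have hr : (Set.range fun k : ℕ => powerSumSeries (k + 1)) =
      symmFun.val '' Set.range fun k : ℕ => powerSum (k + 1) := by
    rw [← Set.range_comp]; rfl
  rw [hr, ← AlgHom.map_adjoin] at hF
  obtain ⟨G, hG, hGF⟩ := hF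
  rwa [show F = G from Subtype.ext hGF.symm]

/-- A relation involves only p_1, …, p_n for some n, and restricting it to n variables contradicts
the injectivity of `psumAlgHom` unless it is trivial. -/
theorem algebraicIndependent_powerSum :
    AlgebraicIndependent ℂ fun k : ℕ => powerSum (k + 1) := by
  rw [algebraicIndependent_iff]
  intro q hq
  obtain ⟨n, hn⟩ : ∃ n : ℕ, q.vars ⊆ Finset.range n :=
    ⟨q.vars.sup id + 1, fun i hi => Finset.mem_range.2 (Nat.lt_succ_of_le
      (Finset.le_sup (f := id) hi))⟩
  obtain ⟨r, rfl⟩ := MvPolynomial.exists_rename_eq_of_vars_subset_range q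
    (Fin.val : Fin n → ℕ) Fin.val_injective
    (fun i hi => ⟨⟨i, Finset.mem_range.1 (hn hi)⟩, rfl⟩)
  rw [MvPolynomial.aeval_rename] at hq
  have h1 : MvPolynomial.aeval (fun i : Fin n => powerSumSeries (i + 1)) r = 0 := by
    have h2 := congrArg (Subtype.val : symmFun → _) hq
    rw [← Subalgebra.mvPolynomial_aeval_coe] at h2
    exact h2
  have h2 := restrictVars_aeval_powerSumSeries n r
  rw [h1, map_zero] at h2
  have h3 : (psumAlgHom n r : MvPolynomial (Fin n) ℂ) = 0 := by
    exact_mod_cast h2.symm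
  have h4 : r = 0 := psumAlgHom_injective n (by rw [map_zero]; exact Subtype.ext h3)
  rw [h4, map_zero]

/-- A homomorphism from the algebra of symmetric functions may be prescribed on power sums. -/
theorem exists_algHom_powerSum {A : Type*} [CommRing A] [Algebra ℂ A] (a : ℕ → A) :
    ∃ ρ : symmFun →ₐ[ℂ] A, ∀ k, 1 ≤ k → ρ (powerSum k) = a k := by
  let e := algebraicIndependent_powerSum.aevalEquiv
  let i : symmFun →ₐ[ℂ] Algebra.adjoin ℂ (Set.range fun k : ℕ => powerSum (k + 1)) :=
    (AlgHom.id ℂ symmFun).codRestrict _ fun F => by rw [adjoin_powerSum_eq_top]; trivial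
  refine ⟨(MvPolynomial.aeval fun k => a (k + 1)).comp
    ((e.symm : _ →ₐ[ℂ] MvPolynomial ℕ ℂ).comp i), fun k hk => ?_⟩
  obtain ⟨j, rfl⟩ : ∃ j, k = j + 1 := ⟨k - 1, by omega⟩
  have h : e.symm (i (powerSum (j + 1))) = MvPolynomial.X j := by
    rw [AlgEquiv.symm_apply_eq]
    refine Subtype.ext ?_
    simp [e, i]
  simp [h]

end GiambelliDPP

namespace GiambelliDPP

/-! ### Determinants -/

open scoped Nat ComplexOrder

theorem card_embedding_map_eq {Y : Type*} [Fintype Y] [DecidableEq Y] {n : ℕ} {S : Finset Y}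
    (hS : S.card = n) :
    (Finset.univ.filter fun g : Fin n ↪ Y => Finset.univ.map g = S).card = n ! := by
  have h1 : Fintype.card (Fin n ↪ S) = n ! := by
    rw [Fintype.card_embedding_eq]
    simp [hS, Nat.descFactorial_self]
  rw [← h1, ← Finset.card_univ]
  symm
  refine Finset.card_bij (fun g _ => g.trans (Function.Embedding.subtype _)) ?_ ?_ ?_
  · intro g _
    rw [Finset.mem_filter]
    refine ⟨Finset.mem_univ _, Finset.eq_of_subset_of_card_le (fun y hy => ?_) (by simp [hS])⟩
    obtain ⟨i, -, rfl⟩ := Finset.mem_map.1 hy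
    exact (g i).2
  · intro g _ g' _ h
    ext i
    exact DFunLike.congr_fun h i
  · intro g hg
    rw [Finset.mem_filter] at hg
    refine ⟨⟨fun i => ⟨g i, ?_⟩, fun i j hij => g.injective (congrArg Subtype.val hij)⟩,
      Finset.mem_univ _, by ext i; rfl⟩
    rw [← hg.2]
    exact Finset.mem_map_of_mem g (Finset.mem_univ i)

theorem sum_embedding_eq {Y : Type*} [Fintype Y] [DecidableEq Y] (n : ℕ) (F : Finset Y → ℂ) :
    ∑ g : Fin n ↪ Y, F (Finset.univ.map g) =
      n ! * ∑ S ∈ Finset.univ.powersetCard n, F S := by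
  rw [← Finset.sum_fiberwise_of_maps_to (s := Finset.univ) (t := Finset.univ.powersetCard n)
    (g := fun g : Fin n ↪ Y => Finset.univ.map g)
    (fun g _ => Finset.mem_powersetCard.2 ⟨Finset.subset_univ _, by simp⟩), Finset.mul_sum]
  refine Finset.sum_congr rfl fun S hS => ?_
  rw [← card_embedding_map_eq (Finset.mem_powersetCard.1 hS).2, ← nsmul_eq_mul,
    ← Finset.sum_const]
  refine Finset.sum_congr rfl fun g hg => ?_
  rw [(Finset.mem_filter.1 hg).2]

/-- Each n-element set is the image of n! injections, and there are none for n > |Y|. The finite sum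
is written as a series in n to match the Fredholm series term by term. -/
theorem hasSum_sum_embedding {Y : Type*} [Fintype Y] [DecidableEq Y] (F : Finset Y → ℂ) :
    HasSum (fun n : ℕ => ((n ! : ℕ) : ℂ)⁻¹ * ∑ g : Fin n ↪ Y, F (Finset.univ.map g))
      (∑ S : Finset Y, F S) := by
  have h1 : ∀ n : ℕ, ((n ! : ℕ) : ℂ)⁻¹ * ∑ g : Fin n ↪ Y, F (Finset.univ.map g) =
      ∑ S ∈ Finset.univ.powersetCard n, F S := fun n => by
    rw [sum_embedding_eq, inv_mul_cancel_left₀]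
    exact_mod_cast n.factorial_ne_zero
  simp_rw [h1]
  have h2 : ∑ S : Finset Y, F S =
      ∑ n ∈ Finset.range (Fintype.card Y + 1), ∑ S ∈ Finset.univ.powersetCard n, F S := by
    rw [← Finset.powerset_univ, Finset.sum_powerset]
    rfl
  rw [h2]
  refine hasSum_sum_of_ne_finset_zero fun n hn => ?_
  rw [Finset.powersetCard_eq_empty.2, Finset.sum_empty]
  simpa using hn

theorem hasSum_prod_embedding {Y : Type*} [Fintype Y] (ψ : Y → ℂ) :
    HasSum (fun n : ℕ => ((n ! : ℕ) : ℂ)⁻¹ * ∑ g : Fin n ↪ Y, ∏ i, ψ (g i))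
      (∏ y, (1 + ψ y)) := by
  classical
  have := hasSum_sum_embedding (Y := Y) fun S => ∏ y ∈ S, ψ y
  simp only [Finset.prod_map] at this
  rw [Finset.prod_one_add, Finset.powerset_univ]
  exact this

/-- Multilinearity in the rows: each row is taken from A or from the identity, and the identity rows
reduce the determinant to a principal minor. -/
theorem det_one_add_eq_sum {Y : Type*} [Fintype Y] [DecidableEq Y] (A : Matrix Y Y ℂ) :
    (1 + A).det = ∑ S : Finset Y, (A.submatrix (Subtype.val : S → Y) Subtype.val).det := by
  rw [add_comm]
  have h := (Matrix.detRowAlternating : (Y → ℂ) [⋀^Y]→ₗ[ℂ] ℂ).map_add_univ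
    (fun i => A i) (fun i => (1 : Matrix Y Y ℂ) i)
  refine Eq.trans h (Finset.sum_congr rfl fun S _ => ?_)
  exact Matrix.det_piecewise_one_eq_submatrix_det A S

/-- This is the Fredholm expansion in finite dimension. Non-injective g repeat a row and contribute
0; for injective g the minor depends only on the image. -/
theorem hasSum_det_submatrix {Y : Type*} [Fintype Y] [DecidableEq Y] (A : Matrix Y Y ℂ) :
    HasSum (fun n : ℕ => ((n ! : ℕ) : ℂ)⁻¹ * ∑ g : Fin n → Y, (A.submatrix g g).det)
      (1 + A).det := by
  rw [det_one_add_eq_sum]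
  convert hasSum_sum_embedding
    (fun S : Finset Y => (A.submatrix (Subtype.val : S → Y) Subtype.val).det) using 3 with n
  have h1 : ∀ g : Fin n → Y, ¬ Function.Injective g → (A.submatrix g g).det = 0 := by
    intro g hg
    simp only [Function.Injective, not_forall] at hg
    obtain ⟨i, j, hij, hne⟩ := hg
    exact Matrix.det_zero_of_row_eq hne (by ext k; simp [hij])
  rw [← Finset.sum_subset (Finset.subset_univ
    (Finset.univ.filter fun g : Fin n → Y => Function.Injective g))
    (fun g _ hg => h1 g (by simpa using hg))]
  symm
  refine Finset.sum_bij (fun g _ => (g : Fin n → Y)) (fun g _ => by simp [g.injective])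
    (fun g _ g' _ h => DFunLike.coe_injective h)
    (fun g hg => ⟨⟨g, by simpa using hg⟩, Finset.mem_univ _, rfl⟩) (fun g _ => ?_)
  let e : Fin n ≃ (Finset.univ.map g) := Equiv.ofBijective
    (fun i => ⟨g i, Finset.mem_map_of_mem g (Finset.mem_univ i)⟩)
    ⟨fun i j hij => g.injective (congrArg Subtype.val hij), fun ⟨y, hy⟩ => by
      obtain ⟨i, -, rfl⟩ := Finset.mem_map.1 hy
      exact ⟨i, rfl⟩⟩
  rw [← Matrix.det_submatrix_equiv_self e]
  rfl

/-! ### Determinant bounds for positive semidefinite matrices -/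

/-- Apply λ ≤ e^(λ−1) to each eigenvalue; nonnegativity allows the inequalities to be multiplied.
This is the source of the Poisson-type bound. -/
theorem re_det_le_exp_trace {Y : Type*} [Fintype Y] [DecidableEq Y] {H : Matrix Y Y ℂ}
    (hH : H.PosSemidef) : H.det.re ≤ Real.exp (H.trace.re - Fintype.card Y) := by
  have hh := hH.isHermitian
  rw [hh.det_eq_prod_eigenvalues, hh.trace_eq_sum_eigenvalues]
  have e1 : (∏ i, ((hh.eigenvalues i : ℝ) : ℂ)).re = ∏ i, hh.eigenvalues i := by
    rw [← Complex.ofReal_prod, Complex.ofReal_re]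
  have e2 : (∑ i, ((hh.eigenvalues i : ℝ) : ℂ)).re = ∑ i, hh.eigenvalues i := by
    rw [← Complex.ofReal_sum, Complex.ofReal_re]
  have e3 : (∑ i, hh.eigenvalues i) - Fintype.card Y = ∑ i, (hh.eigenvalues i - 1) := by
    simp
  erw [e1, e2, e3]
  rw [Real.exp_sum]
  refine Finset.prod_le_prod (fun i _ => hH.eigenvalues_nonneg i) fun i _ => ?_
  have := Real.add_one_le_exp (hh.eigenvalues i - 1)
  linarith

/-- **Hadamard's inequality** for positive semidefinite matrices. -/
theorem norm_det_le_prod_diag {n : ℕ} {H : Matrix (Fin n) (Fin n) ℂ} (hH : H.PosSemidef) :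
    ‖H.det‖ ≤ ∏ i, (H i i).re := by
  have hdiag : ∀ i, 0 ≤ (H i i).re := fun i => (Complex.nonneg_iff.1 (hH.diag_nonneg (i := i))).1
  have hnorm : ‖H.det‖ = H.det.re := by
    exact (Complex.re_eq_norm.2 hH.det_nonneg).symm
  -- Rescaling rows and columns by (H_ii + ε)^(−1/2) makes the trace at most n, so the determinant
  -- is at most 1 by the previous bound. The ε allows for vanishing diagonal entries.
  have key : ∀ ε : ℝ, 0 < ε → H.det.re ≤ ∏ i, ((H i i).re + ε) := by
    intro ε hε
    let d : Fin n → ℝ := fun i => (H i i).re + ε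
    have hd : ∀ i, 0 < d i := fun i => add_pos_of_nonneg_of_pos (hdiag i) hε
    let c : Fin n → ℂ := fun i => ((Real.sqrt (d i))⁻¹ : ℝ)
    let D : Matrix (Fin n) (Fin n) ℂ := Matrix.diagonal c
    have hD : D.conjTranspose = D := by
      simp only [D, Matrix.diagonal_conjTranspose]
      congr 1
      ext i
      simp [c]
    have hp : (D.conjTranspose * H * D).PosSemidef := hH.conjTranspose_mul_mul_same D
    rw [hD] at hp
    have hcc : ∀ i, c i * c i = ((d i)⁻¹ : ℝ) := fun i => by
      simp only [c]
      rw [← Complex.ofReal_mul, ← mul_inv, Real.mul_self_sqrt (hd i).le]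
    have hdet : (D * H * D).det = (∏ i, ((d i)⁻¹ : ℝ)) * H.det := by
      rw [Matrix.det_mul, Matrix.det_mul, Matrix.det_diagonal, mul_right_comm,
        ← Finset.prod_mul_distrib]
      simp_rw [hcc]
      push_cast
      rfl
    have htr : (D * H * D).trace.re ≤ n := by
      have : ∀ i, ((D * H * D) i i).re ≤ 1 := by
        intro i
        simp only [D, Matrix.mul_diagonal, Matrix.diagonal_mul]
        rw [mul_right_comm, hcc, Complex.re_ofReal_mul, inv_mul_le_iff₀ (hd i)]
        simp only [d]
        linarith
      simp only [Matrix.trace, Matrix.diag_apply, Complex.re_sum]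
      refine (Finset.sum_le_sum fun i _ => this i).trans ?_
      simp
    have hle := re_det_le_exp_trace hp
    have hle1 : (D * H * D).det.re ≤ 1 := by
      refine hle.trans (Real.exp_le_one_iff.2 ?_)
      simpa using htr
    rw [hdet, Complex.re_ofReal_mul, Finset.prod_inv_distrib,
      inv_mul_le_iff₀ (Finset.prod_pos fun i _ => hd i), mul_one] at hle1
    exact hle1
  rw [hnorm]
  have hcont : Tendsto (fun ε : ℝ => ∏ i, ((H i i).re + ε)) (𝓝[>] 0) (𝓝 (∏ i, ((H i i).re + 0))) :=
    Tendsto.mono_left (Continuous.tendsto (by fun_prop) 0) nhdsWithin_le_nhds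
  simp only [add_zero] at hcont
  exact ge_of_tendsto hcont (eventually_nhdsWithin_of_forall key)

end GiambelliDPP

namespace GiambelliDPP

/-! ### Expansion of a projection kernel -/

open scoped ComplexConjugate InnerProductSpace

theorem countable_of_orthonormal {H : Type*} [NormedAddCommGroup H] [InnerProductSpace ℂ H]
    [SecondCountableTopology H] {ι : Type*} {v : ι → H} (hv : Orthonormal ℂ v) : Countable ι := by
  have hd : ∀ i j, i ≠ j → (1 : ℝ) ≤ dist (v i) (v j) := by
    intro i j hij
    have h1 := norm_sub_mul_self (𝕜 := ℂ) (v i) (v j)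
    rw [hv.2 hij, hv.1, hv.1] at h1
    simp only [map_zero, mul_zero] at h1
    rw [dist_eq_norm]
    nlinarith [norm_nonneg (v i - v j)]
  have := Set.PairwiseDisjoint.countable_of_isOpen (a := Set.univ) (ι := ι)
    (s := fun i => Metric.ball (v i) (1 / 2)) ?_ (fun _ _ => Metric.isOpen_ball)
    (fun i _ => ⟨v i, Metric.mem_ball_self (by norm_num)⟩)
  · exact Set.countable_univ_iff.1 this
  · intro i _ j _ hij
    refine Metric.ball_disjoint_ball ?_
    have := hd i j hij
    linarith

section L2

variable {α : Type*} [MeasurableSpace α] {μ : Measure α}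

theorem norm_sq_eq_lintegral (φ : Lp ℂ 2 μ) :
    ENNReal.ofReal (‖φ‖ ^ 2) = ∫⁻ x, ‖φ x‖ₑ ^ 2 ∂μ := by
  rw [Lp.norm_def, ENNReal.ofReal_pow ENNReal.toReal_nonneg,
    ENNReal.ofReal_toReal (Lp.eLpNorm_ne_top φ)]
  have := eLpNorm_nnreal_pow_eq_lintegral (f := φ) (μ := μ) (p := 2) (by norm_num)
  simpa using this

/-- Convergence in L² only gives pointwise convergence along a sequence of partial sums; the assumed
pointwise summability identifies that limit with the full sum. -/
theorem hasSum_Lp_ae {ι : Type*} [Countable ι] {F : ι → Lp ℂ 2 μ} {G : Lp ℂ 2 μ}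
    (hF : HasSum F G) (hs : ∀ᵐ y ∂μ, Summable fun j => F j y) :
    ∀ᵐ y ∂μ, HasSum (fun j => F j y) (G y) := by
  have h1 : Tendsto (fun s : Finset ι => ∑ j ∈ s, F j) atTop (𝓝 G) := hF
  have h2 := tendstoInMeasure_of_tendsto_Lp h1
  obtain ⟨ns, hns, hae⟩ := h2.exists_seq_tendsto_ae'
  have h3 : ∀ᵐ y ∂μ, ∀ n, (∑ j ∈ ns n, F j : Lp ℂ 2 μ) y = ∑ j ∈ ns n, F j y := by
    rw [ae_all_iff]
    intro n
    filter_upwards [Lp.coeFn_finsetSum (ns n) F] with y hy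
    rw [hy, Finset.sum_apply]
  filter_upwards [hae, hs, h3] with y hy hsy h3y
  have h4 : Tendsto (fun s : Finset ι => ∑ j ∈ s, F j y) atTop (𝓝 (∑' j, F j y)) := hsy.hasSum
  have h5 : Tendsto (fun n => ∑ j ∈ ns n, F j y) atTop (𝓝 (∑' j, F j y)) := h4.comp hns
  simp_rw [h3y] at hy
  rwa [tendsto_nhds_unique hy h5]

end L2

variable {E : Set ℝ} {μ : Measure E}

theorem coeFn_cutoff {B : Set E} (hB : MeasurableSet B) (φ : Lp ℂ 2 μ) :
    cutoff hB φ =ᵐ[μ] B.indicator φ := MemLp.coeFn_toLp _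

theorem inner_cutoff_left {B : Set E} (hB : MeasurableSet B) (φ ψ : Lp ℂ 2 μ) :
    ⟪cutoff hB φ, ψ⟫_ℂ = ⟪φ, cutoff hB ψ⟫_ℂ := by
  rw [L2.inner_def, L2.inner_def]
  refine integral_congr_ae ?_
  filter_upwards [coeFn_cutoff hB φ, coeFn_cutoff hB ψ] with x h1 h2
  rw [h1, h2]
  by_cases hx : x ∈ B <;> simp [hx]

theorem norm_sq_cutoff {B : Set E} (hB : MeasurableSet B) (φ : Lp ℂ 2 μ) :
    ENNReal.ofReal (‖cutoff hB φ‖ ^ 2) = ∫⁻ x in B, ‖φ x‖ₑ ^ 2 ∂μ := by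
  rw [norm_sq_eq_lintegral, ← lintegral_indicator hB]
  refine lintegral_congr_ae ?_
  filter_upwards [coeFn_cutoff hB φ] with x h1
  rw [h1]
  by_cases hx : x ∈ B <;> simp [hx]

theorem tsum_norm_inner_sq {H : Type*} [NormedAddCommGroup H]
    [InnerProductSpace ℂ H] {ι : Type*} (b : HilbertBasis ι ℂ H) (x : H) :
    ∑' i, ENNReal.ofReal (‖⟪b i, x⟫_ℂ‖ ^ 2) = ENNReal.ofReal (‖x‖ ^ 2) := by
  have h := b.hasSum_inner_mul_inner x x
  have h2 : HasSum (fun i => ‖⟪b i, x⟫_ℂ‖ ^ 2) (‖x‖ ^ 2) := by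
    have h3 := (Complex.hasSum_iff _ _).1 h
    convert h3.1 using 1
    · ext i
      rw [← inner_conj_symm (b i) x, Complex.mul_conj, Complex.ofReal_re,
        Complex.normSq_eq_norm_sq, RCLike.norm_conj]
    · exact (norm_sq_eq_re_inner (𝕜 := ℂ) x)
  rw [← h2.tsum_eq, ENNReal.ofReal_tsum_of_nonneg (fun i => by positivity) h2.summable]

section projection

variable {H : Type*} [NormedAddCommGroup H] [InnerProductSpace ℂ H] [CompleteSpace H]

theorem inner_starProjection_left {T : H →L[ℂ] H} (hT : IsStarProjection T) (x y : H) :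
    ⟪T x, y⟫_ℂ = ⟪x, T y⟫_ℂ := by
  have h := hT.isSelfAdjoint.adjoint_eq
  conv_lhs => rw [← h]
  exact ContinuousLinearMap.adjoint_inner_left T y x

theorem starProjection_apply_apply {T : H →L[ℂ] H} (hT : IsStarProjection T) (x : H) :
    T (T x) = T x := by
  have h : T * T = T := hT.isIdempotentElem
  conv_rhs => rw [← h]
  rfl

end projection

/-- Since T = T*T, the i-th diagonal entry is ‖T χ_B b_i‖². Expanding in the basis by Parseval and
exchanging the nonnegative double sum gives ∑_j ‖χ_B T b_j‖². -/
theorem trace_cutoff_eq {T : Lp ℂ 2 μ →L[ℂ] Lp ℂ 2 μ} (hT : IsStarProjection T) {ι : Type}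
    [Countable ι] (b : HilbertBasis ι ℂ (Lp ℂ 2 μ)) {B : Set E} (hB : MeasurableSet B) {t : ℂ}
    (ht : HasSum (fun i => ⟪b i, cutoff hB (T (cutoff hB (b i)))⟫_ℂ) t) :
    0 ≤ t.re ∧ t.im = 0 ∧ ∫⁻ x in B, ∑' j, ‖T (b j) x‖ₑ ^ 2 ∂μ = ENNReal.ofReal t.re := by
  have h1 : ∀ i, ⟪b i, cutoff hB (T (cutoff hB (b i)))⟫_ℂ =
      ((‖T (cutoff hB (b i))‖ ^ 2 : ℝ) : ℂ) := by
    intro i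
    rw [← inner_cutoff_left, ← starProjection_apply_apply hT, ← inner_starProjection_left hT,
      inner_self_eq_norm_sq_to_K, starProjection_apply_apply hT]
    simp
  simp_rw [h1] at ht
  have h2 := (Complex.hasSum_iff _ _).1 ht
  simp only [Complex.ofReal_re, Complex.ofReal_im] at h2
  refine ⟨h2.1.nonneg fun i => by positivity, h2.2.unique hasSum_zero, ?_⟩
  rw [← h2.1.tsum_eq, ENNReal.ofReal_tsum_of_nonneg (fun i => by positivity) h2.1.summable]
  have h3 : ∀ i j, ENNReal.ofReal (‖⟪b j, T (cutoff hB (b i))⟫_ℂ‖ ^ 2) =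
      ENNReal.ofReal (‖⟪b i, cutoff hB (T (b j))⟫_ℂ‖ ^ 2) := fun i j => by
    rw [← inner_starProjection_left hT, ← inner_cutoff_left, norm_inner_symm]
  calc ∫⁻ x in B, ∑' j, ‖T (b j) x‖ₑ ^ 2 ∂μ = ∑' j, ∫⁻ x in B, ‖T (b j) x‖ₑ ^ 2 ∂μ :=
        lintegral_tsum fun j => (Lp.stronglyMeasurable _).aestronglyMeasurable.enorm.pow_const 2
    _ = ∑' j, ∑' i, ENNReal.ofReal (‖⟪b i, cutoff hB (T (b j))⟫_ℂ‖ ^ 2) := by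
        simp_rw [tsum_norm_inner_sq, norm_sq_cutoff]
    _ = ∑' i, ∑' j, ENNReal.ofReal (‖⟪b j, T (cutoff hB (b i))⟫_ℂ‖ ^ 2) := by
        rw [ENNReal.tsum_comm]
        simp_rw [h3]
    _ = _ := by simp_rw [tsum_norm_inner_sq]


theorem isBounded_abs_le (n : ℝ) : Bornology.IsBounded {x : E | |(x : ℝ)| ≤ n} := by
  refine Metric.isBounded_iff.2 ⟨2 * n, fun x hx y hy => ?_⟩
  rw [Subtype.dist_eq, Real.dist_eq]
  have := abs_sub (x : ℝ) y
  simp only [Set.mem_ofPred_eq] at hx hy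
  linarith

theorem measurableSet_abs_le (n : ℝ) : MeasurableSet {x : E | |(x : ℝ)| ≤ n} :=
  measurableSet_le (by fun_prop) measurable_const

/-- An identity for almost all pairs says nothing on the diagonal when μ has no atoms. Here the
trace formula enters: both sides have the same integral over every bounded Borel set. -/
theorem IsProjectionKernel.ae_diag {K : E → E → ℂ} {T : Lp ℂ 2 μ →L[ℂ] Lp ℂ 2 μ}
    (hT : IsStarProjection T) {ι : Type} [Countable ι] (b : HilbertBasis ι ℂ (Lp ℂ 2 μ))
    (htr : ∀ (B : Set E) (hB : MeasurableSet B), Bornology.IsBounded B →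
      IntegrableOn (fun x => K x x) B μ ∧
      HasSum (fun i => ⟪b i, cutoff hB (T (cutoff hB (b i)))⟫_ℂ) (∫ x in B, K x x ∂μ)) :
    ∀ᵐ x ∂μ, HasSum (fun j => T (b j) x * conj (T (b j) x)) (K x x) := by
  set k : E → ℝ≥0∞ := fun x => ∑' j, ‖T (b j) x‖ₑ ^ 2
  have hkm : Measurable k := Measurable.tsum fun j =>
    (Lp.stronglyMeasurable _).measurable.enorm.pow_const 2
  have hint : ∀ (B : Set E) (hB : MeasurableSet B), Bornology.IsBounded B →
      0 ≤ (∫ x in B, K x x ∂μ).re ∧ (∫ x in B, K x x ∂μ).im = 0 ∧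
        ∫⁻ x in B, k x ∂μ = ENNReal.ofReal (∫ x in B, K x x ∂μ).re := fun B hB hb =>
    trace_cutoff_eq hT b hB (htr B hB hb).2
  have hfin : ∀ n : ℕ, ∀ᵐ x ∂μ.restrict {x : E | |(x : ℝ)| ≤ n}, k x < ∞ := by
    intro n
    refine ae_lt_top hkm ?_
    rw [(hint _ (measurableSet_abs_le n) (isBounded_abs_le n)).2.2]
    exact ENNReal.ofReal_ne_top
  have hcov : ∀ {p : E → Prop}, (∀ n : ℕ, ∀ᵐ x ∂μ.restrict {x : E | |(x : ℝ)| ≤ n}, p x) →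
      ∀ᵐ x ∂μ, p x := by
    intro p hp
    have h1 : ∀ᵐ x ∂μ, ∀ n : ℕ, x ∈ {x : E | |(x : ℝ)| ≤ n} → p x :=
      ae_all_iff.2 fun n => (ae_restrict_iff' (measurableSet_abs_le n)).1 (hp n)
    filter_upwards [h1] with x hx
    obtain ⟨n, hn⟩ := exists_nat_ge |(x : ℝ)|
    exact hx n hn
  have heq : ∀ᵐ x ∂μ, k x < ∞ ∧ (((k x).toReal : ℝ) : ℂ) = K x x := by
    refine hcov fun n => (hfin n).and ?_
    set Bn : Set E := {x : E | |(x : ℝ)| ≤ n}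
    have hkint : Integrable (fun x => (k x).toReal) (μ.restrict Bn) := by
      refine integrable_toReal_of_lintegral_ne_top hkm.aemeasurable ?_
      rw [(hint _ (measurableSet_abs_le n) (isBounded_abs_le n)).2.2]
      exact ENNReal.ofReal_ne_top
    refine Integrable.ae_eq_of_forall_setIntegral_eq (fun x => (((k x).toReal : ℝ) : ℂ))
      (fun x => K x x) hkint.ofReal (htr Bn (measurableSet_abs_le n) (isBounded_abs_le n)).1 ?_
    intro s hs _
    rw [Measure.restrict_restrict hs]
    have hs' : MeasurableSet (s ∩ Bn) := hs.inter (measurableSet_abs_le n)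
    obtain ⟨h1, h2, h3⟩ := hint _ hs' ((isBounded_abs_le (E := E) n).subset inter_subset_right)
    rw [show (fun x => (((k x).toReal : ℝ) : ℂ)) = fun x => ((fun x => (k x).toReal) x : ℂ) from rfl,
      integral_complex_ofReal, integral_toReal hkm.aemeasurable, h3, ENNReal.toReal_ofReal h1]
    · exact Complex.ext (by simp) (by simp [h2])
    · have h4 := hfin n
      exact ae_mono (Measure.restrict_mono inter_subset_right le_rfl) h4
  filter_upwards [heq] with x hx
  rw [← hx.2]
  have h1 : HasSum (fun j => (‖T (b j) x‖ₑ ^ 2).toReal) (k x).toReal := by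
    have := ENNReal.hasSum_toReal hx.1.ne
    rwa [← ENNReal.tsum_toReal_eq fun j => by simp] at this
  have h2 := Complex.hasSum_ofReal.2 h1
  convert h2 using 2 with j
  rw [Complex.mul_conj, Complex.normSq_eq_norm_sq]
  simp

/-- The functions are φ_j = T b_j for a Hilbert basis b. They need not be orthonormal, but ‖T‖ ≤ 1
gives Bessel's inequality, which is all that is used later. -/
theorem IsProjectionKernel.exists_expansion [IsLocallyFiniteMeasure μ] {K : E → E → ℂ}
    (hK : IsProjectionKernel μ K) :
    ∃ (ι : Type) (_ : Countable ι) (φ : ι → E → ℂ), (∀ j, Measurable (φ j)) ∧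
      (∀ j, MemLp (φ j) 2 μ) ∧
      (∀ (s : Finset ι) (c : ι → ℂ),
        ∫ x, ‖∑ j ∈ s, c j * φ j x‖ ^ 2 ∂μ ≤ ∑ j ∈ s, ‖c j‖ ^ 2) ∧
      (∀ᵐ x ∂μ, HasSum (fun j => φ j x * conj (φ j x)) (K x x)) ∧
      ∀ᵐ x ∂μ, ∀ᵐ y ∂μ, HasSum (fun j => φ j x * conj (φ j y)) (K x y) := by
  obtain ⟨T, hT, hTK, htr⟩ := hK.exists_projection
  have : Fact ((2 : ℝ≥0∞) ≠ ∞) := ⟨by simp⟩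
  obtain ⟨w, b, -⟩ := exists_hilbertBasis ℂ (Lp ℂ 2 μ)
  have hι : Countable w := countable_of_orthonormal b.orthonormal
  have hdiag : ∀ᵐ x ∂μ, HasSum (fun j => T (b j) x * conj (T (b j) x)) (K x x) :=
    IsProjectionKernel.ae_diag hT b fun B hB hb => ⟨(htr B hB hb).1, (htr B hB hb).2 _ b⟩
  refine ⟨w, hι, fun j => T (b j), fun j => (Lp.stronglyMeasurable _).measurable,
    fun j => Lp.memLp _, fun s c => ?_, hdiag, ?_⟩
  · have hnorm : ‖T (∑ j ∈ s, c j • b j)‖ ^ 2 ≤ ∑ j ∈ s, ‖c j‖ ^ 2 := by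
      have h1 : ‖T (∑ j ∈ s, c j • b j)‖ ≤ ‖∑ j ∈ s, c j • b j‖ := by
        have := T.le_opNorm (∑ j ∈ s, c j • b j)
        have h2 : ‖T‖ ≤ 1 := hT.norm_le
        nlinarith [norm_nonneg (∑ j ∈ s, c j • b j)]
      have h2 : ‖∑ j ∈ s, c j • b j‖ ^ 2 = ∑ j ∈ s, ‖c j‖ ^ 2 := by
        have h3 := b.orthonormal.inner_sum c c s
        rw [inner_self_eq_norm_sq_to_K] at h3
        have h4 : ((‖∑ j ∈ s, c j • b j‖ ^ 2 : ℝ) : ℂ) = ((∑ j ∈ s, ‖c j‖ ^ 2 : ℝ) : ℂ) := by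
          push_cast
          refine Eq.trans h3 (Finset.sum_congr rfl fun j _ => ?_)
          rw [← Complex.normSq_eq_conj_mul_self, Complex.normSq_eq_norm_sq]
          push_cast; rfl
        exact_mod_cast h4
      rw [← h2]
      gcongr
    have h1 : ∫⁻ x, ENNReal.ofReal (‖∑ j ∈ s, c j * T (b j) x‖ ^ 2) ∂μ =
        ENNReal.ofReal (‖T (∑ j ∈ s, c j • b j)‖ ^ 2) := by
      rw [norm_sq_eq_lintegral]
      refine lintegral_congr_ae ?_
      have h2 : ∀ᵐ x ∂μ, ∀ j : w, (c j • T (b j) : Lp ℂ 2 μ) x = c j * T (b j) x :=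
        ae_all_iff.2 fun j => by
          filter_upwards [Lp.coeFn_smul (c j) (T (b j))] with x hx
          rw [hx, Pi.smul_apply, smul_eq_mul]
      filter_upwards [Lp.coeFn_finsetSum s (fun j => c j • T (b j)), h2] with x hx hx2
      rw [map_sum]
      simp_rw [map_smul]
      rw [hx, Finset.sum_apply]
      simp_rw [hx2]
      rw [ENNReal.ofReal_pow (norm_nonneg _), ofReal_norm]
    rw [integral_eq_lintegral_of_nonneg_ae (ae_of_all _ fun x => by positivity)]
    · rw [h1, ENNReal.toReal_ofReal (by positivity)]
      exact hnorm
    · refine Measurable.aestronglyMeasurable ?_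
      have : ∀ j : w, Measurable (T (b j)) := fun j => (Lp.stronglyMeasurable _).measurable
      fun_prop
  · have hT1 : ∀ᵐ x ∂μ, ∀ j, T (b j) x = ∫ y, K x y * b j y ∂μ :=
      ae_all_iff.2 fun j => hTK (b j)
    have hT2 : ∀ᵐ x ∂μ, ∀ j, T (b j) x = ∫ y, K x y * T (b j) y ∂μ :=
      ae_all_iff.2 fun j => by
        have := hTK (T (b j))
        rwa [starProjection_apply_apply hT] at this
    filter_upwards [hT1, hT2, hK.memLp, hdiag] with x h1 h2 hKx hdx
    have hκm : MemLp (fun y => conj (K x y)) 2 μ := hKx.star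
    set κ : Lp ℂ 2 μ := hκm.toLp _
    have hκ : ∀ φ : Lp ℂ 2 μ, ⟪κ, φ⟫_ℂ = ∫ y, K x y * φ y ∂μ := by
      intro φ
      rw [L2.inner_def]
      refine integral_congr_ae ?_
      filter_upwards [hκm.coeFn_toLp] with y hy
      rw [hy]
      simp [mul_comm]
    -- The section κ = conj K(x, ·) lies in the range of T, because pairing it with b_j and with T
    -- b_j gives (T b_j)(x) and (T T b_j)(x). Applying T to its basis expansion then yields the
    -- expansion in the T b_j.
    have hTκ : T κ = κ := by
      refine b.repr.injective (lp.ext (funext fun j => ?_))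
      rw [b.repr_apply_apply, b.repr_apply_apply, ← inner_conj_symm, ← inner_conj_symm (b j) κ,
        inner_starProjection_left hT, hκ, hκ, ← h1, ← h2]
    have hexp : HasSum (fun j => conj (T (b j) x) • T (b j)) κ := by
      have h3 := (b.hasSum_repr κ).mapL T
      rw [hTκ] at h3
      convert h3 using 2 with j
      rw [map_smul, b.repr_apply_apply, ← inner_conj_symm, hκ, ← h1]
    have hae := hasSum_Lp_ae hexp ?_
    · have h4 : ∀ᵐ y ∂μ, ∀ j, (conj (T (b j) x) • T (b j) : Lp ℂ 2 μ) y =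
          conj (T (b j) x) * T (b j) y := ae_all_iff.2 fun j => by
        filter_upwards [Lp.coeFn_smul (conj (T (b j) x)) (T (b j))] with y hy
        rw [hy, Pi.smul_apply, smul_eq_mul]
      filter_upwards [hae, h4, hκm.coeFn_toLp] with y hy h4y h5
      rw [h5] at hy
      simp_rw [h4y] at hy
      have h6 := hy.mapL (Complex.conjCLE : ℂ →L[ℝ] ℂ)
      simpa using h6
    -- Pointwise summability for `hasSum_Lp_ae`: the off-diagonal series is dominated by the two
    -- diagonal series at x and y.
    · have hsq : ∀ {z : E}, HasSum (fun j => T (b j) z * conj (T (b j) z)) (K z z) →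
          Summable fun j => ‖T (b j) z‖ ^ 2 := fun {z} hz => by
        have := hz.summable.norm
        simpa [sq] using this
      have h4 : ∀ᵐ y ∂μ, ∀ j, (conj (T (b j) x) • T (b j) : Lp ℂ 2 μ) y =
          conj (T (b j) x) * T (b j) y := ae_all_iff.2 fun j => by
        filter_upwards [Lp.coeFn_smul (conj (T (b j) x)) (T (b j))] with y hy
        rw [hy, Pi.smul_apply, smul_eq_mul]
      filter_upwards [hdiag, h4] with y hdy h4y
      simp_rw [h4y]
      refine Summable.of_norm_bounded ((hsq hdx).add (hsq hdy)) fun j => ?_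
      rw [norm_mul, RCLike.norm_conj]
      nlinarith [sq_nonneg (‖T (b j) x‖ - ‖T (b j) y‖), sq_nonneg ‖T (b j) x‖,
        sq_nonneg ‖T (b j) y‖]

end GiambelliDPP

namespace GiambelliDPP

/-! ### The Fredholm series of a projection kernel -/

open scoped ComplexConjugate ComplexOrder

section

variable {α : Type*} {ι : Type} {φ : ι → α → ℂ} {K : α → α → ℂ}

/-- The truncated kernel. -/
def truncKernel (φ : ι → α → ℂ) (s : Finset ι) (x y : α) : ℂ := ∑ a ∈ s, φ a x * conj (φ a y)

theorem posSemidef_truncKernel (φ : ι → α → ℂ) (s : Finset ι) {n : ℕ} (x : Fin n → α) :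
    (Matrix.of fun i j => truncKernel φ s (x i) (x j)).PosSemidef := by
  have h : (Matrix.of fun i j => truncKernel φ s (x i) (x j)) =
      (Matrix.of fun (i : Fin n) (a : s) => φ a (x i)) *
        (Matrix.of fun (i : Fin n) (a : s) => φ a (x i)).conjTranspose := by
    ext i j
    rw [Matrix.mul_apply, Matrix.of_apply, truncKernel, ← Finset.sum_coe_sort s]
    rfl
  rw [h]
  exact Matrix.posSemidef_self_mul_conjTranspose _

theorem truncKernel_diag (φ : ι → α → ℂ) (s : Finset ι) (x : α) :
    truncKernel φ s x x = ((∑ a ∈ s, ‖φ a x‖ ^ 2 : ℝ) : ℂ) := by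
  rw [truncKernel, Complex.ofReal_sum]
  refine Finset.sum_congr rfl fun a _ => ?_
  rw [Complex.mul_conj, Complex.normSq_eq_norm_sq]

theorem truncKernel_diag_le (φ : ι → α → ℂ) (s : Finset ι) {x : α}
    (hx : HasSum (fun j => φ j x * conj (φ j x)) (K x x)) :
    0 ≤ (truncKernel φ s x x).re ∧ (truncKernel φ s x x).re ≤ ‖K x x‖ ∧
      K x x = (‖K x x‖ : ℝ) := by
  have h1 : ∀ a, φ a x * conj (φ a x) = ((‖φ a x‖ ^ 2 : ℝ) : ℂ) := fun a => by
    rw [Complex.mul_conj, Complex.normSq_eq_norm_sq]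
  simp_rw [h1] at hx
  have h2 := (Complex.hasSum_iff _ _).1 hx
  simp only [Complex.ofReal_re, Complex.ofReal_im] at h2
  have h3 : (K x x).im = 0 := h2.2.unique hasSum_zero
  have h4 : 0 ≤ (K x x).re := h2.1.nonneg fun a => by positivity
  have h5 : K x x = ((K x x).re : ℂ) := Complex.ext rfl (by simp [h3])
  have h6 : ‖K x x‖ = (K x x).re := by
    rw [h5, Complex.norm_real, Real.norm_of_nonneg h4, Complex.ofReal_re]
  rw [truncKernel_diag, Complex.ofReal_re, h6]
  exact ⟨Finset.sum_nonneg fun a _ => by positivity,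
    sum_le_hasSum s (fun a _ => by positivity) h2.1, h5⟩

/-- Hadamard's inequality for a Gram matrix. The bound is independent of s, so it serves as a
dominating function and passes to the full kernel. -/
theorem norm_det_truncKernel_le (s : Finset ι) {n : ℕ} {x : Fin n → α}
    (hx : ∀ i j, HasSum (fun a => φ a (x i) * conj (φ a (x j))) (K (x i) (x j))) :
    ‖(Matrix.of fun i j => truncKernel φ s (x i) (x j)).det‖ ≤ ∏ i, ‖K (x i) (x i)‖ := by
  refine (norm_det_le_prod_diag (posSemidef_truncKernel φ s x)).trans ?_
  exact Finset.prod_le_prod (fun i _ => (truncKernel_diag_le φ s (hx i i)).1)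
    fun i _ => (truncKernel_diag_le φ s (hx i i)).2.1

theorem tendsto_det_truncKernel {n : ℕ} {x : Fin n → α}
    (hx : ∀ i j, HasSum (fun a => φ a (x i) * conj (φ a (x j))) (K (x i) (x j))) :
    Tendsto (fun s : Finset ι => (Matrix.of fun i j => truncKernel φ s (x i) (x j)).det) atTop
      (𝓝 (Matrix.of fun i j => K (x i) (x j)).det) := by
  have h1 : Tendsto (fun s : Finset ι => Matrix.of fun i j => truncKernel φ s (x i) (x j)) atTop
      (𝓝 (Matrix.of fun i j => K (x i) (x j))) :=
    tendsto_pi_nhds.2 fun i => tendsto_pi_nhds.2 fun j => hx i j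
  exact ((Continuous.matrix_det continuous_id).tendsto _).comp h1

theorem norm_det_kernel_le {n : ℕ} {x : Fin n → α}
    (hx : ∀ i j, HasSum (fun a => φ a (x i) * conj (φ a (x j))) (K (x i) (x j))) :
    ‖(Matrix.of fun i j => K (x i) (x j)).det‖ ≤ ∏ i, ‖K (x i) (x i)‖ :=
  le_of_tendsto (tendsto_det_truncKernel hx).norm
    (Eventually.of_forall fun s => norm_det_truncKernel_le s hx)

end

theorem integrable_weight {α : Type*} [MeasurableSpace α] {μ : Measure α} {ψ : α → ℝ} (hψ : Measurable ψ) {C : ℝ} (hC : ∀ x, |ψ x| ≤ C)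
    {f g : α → ℂ} (hf : MemLp f 2 μ) (hg : MemLp g 2 μ) :
    Integrable (fun x => (ψ x : ℂ) * (f x * conj (g x))) μ := by
  have h1 : Integrable (fun x => f x * conj (g x)) μ := hf.integrable_mul hg.star
  refine h1.bdd_mul (c := C) (by fun_prop) (ae_of_all _ fun x => ?_)
  rw [Complex.norm_real]
  exact hC x

section

variable {α : Type*} [MeasurableSpace α] {μ : Measure α}

/-- Split off the i-th coordinate and use Fubini; measurability of the relation is what allows
iterated null sets to become a null set of the product. -/
theorem ae_pi_pair [SigmaFinite μ] {p : α → α → Prop} (hp : MeasurableSet {z : α × α | p z.1 z.2})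
    (h : ∀ᵐ x ∂μ, ∀ᵐ y ∂μ, p x y) {n : ℕ} {i j : Fin n} (hij : i ≠ j) :
    ∀ᵐ x : Fin n → α ∂Measure.pi fun _ => μ, p (x i) (x j) := by
  obtain _ | m := n
  · exact i.elim0
  obtain ⟨j', rfl⟩ := Fin.exists_succAbove_eq hij.symm
  have h1 : ∀ᵐ z : α × (Fin m → α) ∂μ.prod (Measure.pi fun _ => μ), p z.1 (z.2 j') := by
    rw [Measure.ae_prod_iff_ae_ae]
    · filter_upwards [h] with x hx
      exact (Measure.quasiMeasurePreserving_eval (fun _ : Fin m => μ) j').ae hx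
    · exact hp.preimage (f := fun z : α × (Fin m → α) => (z.1, z.2 j')) (by fun_prop)
  exact (measurePreserving_piFinSuccAbove (fun _ : Fin (m + 1) => μ) i).quasiMeasurePreserving.ae h1

/-- The functions `φ` expand the kernel `K` and satisfy Bessel's inequality. -/
structure IsKernelExpansion (μ : Measure α) (K : α → α → ℂ) {ι : Type} (φ : ι → α → ℂ) :
    Prop where
  measurable : ∀ j, Measurable (φ j)
  memLp : ∀ j, MemLp (φ j) 2 μ
  bessel : ∀ (s : Finset ι) (c : ι → ℂ),
    ∫ x, ‖∑ j ∈ s, c j * φ j x‖ ^ 2 ∂μ ≤ ∑ j ∈ s, ‖c j‖ ^ 2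
  diag : ∀ᵐ x ∂μ, HasSum (fun j => φ j x * conj (φ j x)) (K x x)
  offdiag : ∀ᵐ x ∂μ, ∀ᵐ y ∂μ, HasSum (fun j => φ j x * conj (φ j y)) (K x y)

variable {ι : Type} {φ : ι → α → ℂ} {K : α → α → ℂ}

theorem IsKernelExpansion.ae_pi [SigmaFinite μ] [Countable ι] (hφ : IsKernelExpansion μ K φ)
    (hK : Measurable (Function.uncurry K)) (n : ℕ) :
    ∀ᵐ x : Fin n → α ∂Measure.pi fun _ => μ, ∀ i j,
      HasSum (fun a => φ a (x i) * conj (φ a (x j))) (K (x i) (x j)) := by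
  have hm := hφ.measurable
  rw [ae_all_iff]; intro i
  rw [ae_all_iff]; intro j
  rcases eq_or_ne i j with rfl | hij
  · exact (Measure.quasiMeasurePreserving_eval (fun _ : Fin n => μ) i).ae hφ.diag
  · refine ae_pi_pair (p := fun x y => HasSum (fun a => φ a x * conj (φ a y)) (K x y))
      ?_ hφ.offdiag hij
    have := measurableSet_tendsto_fun (β := α × α) (l := (atTop : Filter (Finset ι)))
      (f := fun s (z : α × α) => ∑ a ∈ s, φ a z.1 * conj (φ a z.2)) (g := fun z : α × α => K z.1 z.2)
      (fun s => by
        have : Measurable (conj : ℂ → ℂ) := Complex.continuous_conj.measurable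
        fun_prop) hK
    exact this

/-- The matrix `∫ ψ φ_a conj(φ_b)`. -/
def weightMatrix (μ : Measure α) (φ : ι → α → ℂ) (ψ : α → ℝ) (s : Finset ι) : Matrix s s ℂ :=
  Matrix.of fun a b => ∫ x, (ψ x : ℂ) * (φ a x * conj (φ b x)) ∂μ

/-- **Andréief's identity**. -/
theorem integral_prod_mul_det_truncKernel [SigmaFinite μ] (hφ : IsKernelExpansion μ K φ) {ψ : α → ℝ}
    (hψ : Measurable ψ) {C : ℝ} (hC : ∀ x, |ψ x| ≤ C) (s : Finset ι) (n : ℕ) :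
    ∫ x : Fin n → α, (∏ i, (ψ (x i) : ℂ)) *
        (Matrix.of fun i j => truncKernel φ s (x i) (x j)).det ∂Measure.pi (fun _ => μ) =
      ∑ g : Fin n → s, ((weightMatrix μ φ ψ s).submatrix g g).det := by
  -- Expand the determinant over permutations and each truncated kernel over s. Reindexing by σ
  -- collects at each i all factors depending on x_i, so the integral splits into a product.
  have hpt : ∀ x : Fin n → α, (∏ i, (ψ (x i) : ℂ)) *
      (Matrix.of fun i j => truncKernel φ s (x i) (x j)).det =
      ∑ σ : Equiv.Perm (Fin n), ∑ g : Fin n → s, ((Equiv.Perm.sign σ : ℤ) : ℂ) *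
        ∏ i, (ψ (x i) : ℂ) * (φ (g (σ⁻¹ i)) (x i) * conj (φ (g i) (x i))) := by
    intro x
    rw [Matrix.det_apply', Finset.mul_sum]
    refine Finset.sum_congr rfl fun σ _ => ?_
    simp only [Matrix.of_apply, truncKernel]
    simp_rw [← Finset.sum_coe_sort s]
    rw [Finset.prod_univ_sum, Fintype.piFinset_univ, Finset.mul_sum, Finset.mul_sum]
    refine Finset.sum_congr rfl fun g _ => ?_
    rw [mul_left_comm]
    congr 1
    rw [Finset.prod_mul_distrib, Finset.prod_mul_distrib, Finset.prod_mul_distrib]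
    congr 2
    rw [← Equiv.prod_comp σ (fun i => φ (g (σ⁻¹ i)) (x i))]
    simp
  have hint : ∀ a b : s, Integrable (fun x => (ψ x : ℂ) * (φ a x * conj (φ b x))) μ :=
    fun a b => integrable_weight hψ hC (hφ.memLp a) (hφ.memLp b)
  have hint' : ∀ (σ : Equiv.Perm (Fin n)) (g : Fin n → s),
      Integrable (fun x : Fin n → α => ((Equiv.Perm.sign σ : ℤ) : ℂ) *
        ∏ i, (ψ (x i) : ℂ) * (φ (g (σ⁻¹ i)) (x i) * conj (φ (g i) (x i))))
        (Measure.pi fun _ => μ) := fun σ g =>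
    (Integrable.fintype_prod (f := fun i y => (ψ y : ℂ) * (φ (g (σ⁻¹ i)) y * conj (φ (g i) y)))
      fun i => hint _ _).const_mul _
  have hval : ∀ (σ : Equiv.Perm (Fin n)) (g : Fin n → s),
      ∫ x : Fin n → α, ((Equiv.Perm.sign σ : ℤ) : ℂ) *
        ∏ i, (ψ (x i) : ℂ) * (φ (g (σ⁻¹ i)) (x i) * conj (φ (g i) (x i)))
        ∂(Measure.pi fun _ => μ) =
      ((Equiv.Perm.sign σ : ℤ) : ℂ) * ∏ i, weightMatrix μ φ ψ s (g (σ⁻¹ i)) (g i) := fun σ g => by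
    rw [integral_const_mul, integral_fintype_prod_eq_prod (𝕜 := ℂ)
      (fun i y => (ψ y : ℂ) * (φ (g (σ⁻¹ i)) y * conj (φ (g i) y)))]
    rfl
  calc _ = ∫ x : Fin n → α, ∑ σ : Equiv.Perm (Fin n), ∑ g : Fin n → s,
        ((Equiv.Perm.sign σ : ℤ) : ℂ) *
        ∏ i, (ψ (x i) : ℂ) * (φ (g (σ⁻¹ i)) (x i) * conj (φ (g i) (x i)))
        ∂(Measure.pi fun _ => μ) := integral_congr_ae (ae_of_all _ hpt)
    _ = ∑ σ : Equiv.Perm (Fin n), ∑ g : Fin n → s,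
        ((Equiv.Perm.sign σ : ℤ) : ℂ) * ∏ i, weightMatrix μ φ ψ s (g (σ⁻¹ i)) (g i) := by
      rw [integral_finsetSum _ fun σ _ => integrable_finsetSum _ fun g _ => hint' σ g]
      refine Finset.sum_congr rfl fun σ _ => ?_
      rw [integral_finsetSum _ fun g _ => hint' σ g]
      exact Finset.sum_congr rfl fun g _ => hval σ g
    _ = _ := by
      rw [Finset.sum_comm]
      refine Finset.sum_congr rfl fun g _ => ?_
      rw [Matrix.det_apply', ← Equiv.sum_comp (Equiv.inv (Equiv.Perm (Fin n)))]
      refine Finset.sum_congr rfl fun σ _ => ?_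
      simp

/-- The quadratic form at v is |v|² + ∫ ψ |∑ conj(v_a) φ_a|². As ψ ≥ −1, it is at least |v|² − ∫ |∑
conj(v_a) φ_a|², which Bessel's inequality makes nonnegative. -/
theorem posSemidef_one_add_weightMatrix [DecidableEq ι] (hφ : IsKernelExpansion μ K φ) {ψ : α → ℝ}
    (hψ : Measurable ψ) {C : ℝ} (hC : ∀ x, |ψ x| ≤ C) (h1 : ∀ x, -1 ≤ ψ x) (s : Finset ι) :
    (1 + weightMatrix μ φ ψ s).PosSemidef := by
  have hint : ∀ a b : s, Integrable (fun x => (ψ x : ℂ) * (φ a x * conj (φ b x))) μ :=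
    fun a b => integrable_weight hψ hC (hφ.memLp a) (hφ.memLp b)
  refine Matrix.PosSemidef.of_dotProduct_mulVec_nonneg ?_ fun v => ?_
  · ext a b
    rw [Matrix.conjTranspose_apply, Matrix.add_apply, Matrix.add_apply, star_add]
    congr 1
    · rw [← Matrix.conjTranspose_apply, Matrix.conjTranspose_one]
    · simp only [weightMatrix, Matrix.of_apply]
      rw [← starRingEnd_apply, ← integral_conj]
      refine integral_congr_ae (ae_of_all _ fun x => ?_)
      simp [mul_comm]
  · let c : ι → ℂ := fun a => if h : a ∈ s then conj (v ⟨a, h⟩) else 0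
    have hc : ∀ a : s, c a = conj (v a) := fun a => by simp [c]
    have hsum : ∀ x, ∑ j ∈ s, c j * φ j x = ∑ a : s, conj (v a) * φ a x := fun x => by
      rw [← Finset.sum_coe_sort s]
      exact Finset.sum_congr rfl fun a _ => by rw [hc]
    have hL : MemLp (fun x => ∑ j ∈ s, c j * φ j x) 2 μ :=
      memLp_finsetSum _ fun j _ => (hφ.memLp j).const_mul _
    have hbes := hφ.bessel s c
    have hbes2 : ∑ j ∈ s, ‖c j‖ ^ 2 = ∑ a : s, ‖v a‖ ^ 2 := by
      rw [← Finset.sum_coe_sort s]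
      exact Finset.sum_congr rfl fun a _ => by rw [hc, RCLike.norm_conj]
    have hq : star v ⬝ᵥ ((1 + weightMatrix μ φ ψ s).mulVec v) =
        ((∑ a : s, ‖v a‖ ^ 2 + ∫ x, ψ x * ‖∑ j ∈ s, c j * φ j x‖ ^ 2 ∂μ : ℝ) : ℂ) := by
      rw [Matrix.add_mulVec, Matrix.one_mulVec, dotProduct_add, Complex.ofReal_add]
      congr 1
      · simp only [dotProduct, Pi.star_apply]
        push_cast
        refine Finset.sum_congr rfl fun a _ => ?_
        rw [← starRingEnd_apply, ← Complex.normSq_eq_conj_mul_self, Complex.normSq_eq_norm_sq]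
        push_cast; rfl
      · rw [← integral_complex_ofReal]
        have hpt : ∀ x, ((ψ x * ‖∑ j ∈ s, c j * φ j x‖ ^ 2 : ℝ) : ℂ) =
            ∑ a : s, ∑ b : s, (conj (v a) * v b) * ((ψ x : ℂ) * (φ a x * conj (φ b x))) := by
          intro x
          rw [hsum, Complex.ofReal_mul, ← Complex.normSq_eq_norm_sq, ← Complex.mul_conj, map_sum,
            Finset.sum_mul_sum, Finset.mul_sum]
          refine Finset.sum_congr rfl fun a _ => ?_
          rw [Finset.mul_sum]
          refine Finset.sum_congr rfl fun b _ => ?_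
          simp only [map_mul, Complex.conj_conj]
          ring
        simp_rw [hpt]
        rw [integral_finsetSum _ fun a _ => integrable_finsetSum _ fun b _ =>
          (hint a b).const_mul _]
        simp only [dotProduct, Matrix.mulVec, Pi.star_apply]
        refine Finset.sum_congr rfl fun a _ => ?_
        rw [integral_finsetSum _ fun b _ => (hint a b).const_mul _, Finset.mul_sum]
        refine Finset.sum_congr rfl fun b _ => ?_
        rw [integral_const_mul]
        simp only [weightMatrix, Matrix.of_apply, starRingEnd_apply]
        ring
    rw [hq]
    refine Complex.zero_le_real.2 ?_
    have hi1 : Integrable (fun x => ‖∑ j ∈ s, c j * φ j x‖ ^ 2) μ :=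
      (memLp_two_iff_integrable_sq_norm hL.1).1 hL
    have hi2 : Integrable (fun x => ψ x * ‖∑ j ∈ s, c j * φ j x‖ ^ 2) μ :=
      hi1.bdd_mul (c := C) hψ.aestronglyMeasurable (ae_of_all _ hC)
    have hle : ∫ x, -‖∑ j ∈ s, c j * φ j x‖ ^ 2 ∂μ ≤
        ∫ x, ψ x * ‖∑ j ∈ s, c j * φ j x‖ ^ 2 ∂μ := by
      refine integral_mono hi1.neg hi2 fun x => ?_
      have := mul_le_mul_of_nonneg_right (h1 x) (sq_nonneg ‖∑ j ∈ s, c j * φ j x‖)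
      simpa using this
    rw [integral_neg] at hle
    linarith

theorem measurable_det_kernel (hK : Measurable (Function.uncurry K)) (n : ℕ) :
    Measurable fun x : Fin n → α => (Matrix.of fun i j => K (x i) (x j)).det := by
  simp_rw [Matrix.det_apply', Matrix.of_apply]
  refine Finset.measurable_fun_sum _ fun σ _ => measurable_const.mul
    (Finset.measurable_fun_prod _ fun i _ => ?_)
  exact hK.comp (f := fun x : Fin n → α => (x (σ i), x i)) (by fun_prop)

section

variable [SigmaFinite μ] [Countable ι] (hφ : IsKernelExpansion μ K φ) (hK : Measurable (Function.uncurry K))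
  {ψ : α → ℝ} (hψ : Measurable ψ) (hint : Integrable (fun x => ψ x * ‖K x x‖) μ)

include hφ hK hψ hint

/-- By Hadamard the integrand is dominated by a product of functions of one variable. The resulting
n-th power, divided by n!, makes the Fredholm series absolutely convergent. -/
theorem IsKernelExpansion.integrable_prod_mul_det (n : ℕ) :
    Integrable (fun x : Fin n → α => (∏ i, (ψ (x i) : ℂ)) *
        (Matrix.of fun i j => K (x i) (x j)).det) (Measure.pi fun _ => μ) ∧
    ∫ x : Fin n → α, ‖(∏ i, (ψ (x i) : ℂ)) *
        (Matrix.of fun i j => K (x i) (x j)).det‖ ∂Measure.pi (fun _ => μ) ≤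
      (∫ x, |ψ x| * ‖K x x‖ ∂μ) ^ n := by
  have hint' : Integrable (fun x => |ψ x| * ‖K x x‖) μ := by
    refine hint.norm.congr (ae_of_all _ fun x => ?_)
    simp
  have hb : Integrable (fun x : Fin n → α => ∏ i, (|ψ (x i)| * ‖K (x i) (x i)‖))
      (Measure.pi fun _ => μ) := Integrable.fintype_prod fun _ => hint'
  have hle : ∀ᵐ x : Fin n → α ∂Measure.pi fun _ => μ, ‖(∏ i, (ψ (x i) : ℂ)) *
      (Matrix.of fun i j => K (x i) (x j)).det‖ ≤ ∏ i, (|ψ (x i)| * ‖K (x i) (x i)‖) := by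
    filter_upwards [hφ.ae_pi hK n] with x hx
    rw [norm_mul, norm_prod, Finset.prod_mul_distrib]
    simp only [Complex.norm_real, Real.norm_eq_abs]
    gcongr
    exact norm_det_kernel_le hx
  have hi : Integrable (fun x : Fin n → α => (∏ i, (ψ (x i) : ℂ)) *
      (Matrix.of fun i j => K (x i) (x j)).det) (Measure.pi fun _ => μ) := by
    refine hb.mono' (Measurable.aestronglyMeasurable ?_) hle
    exact Measurable.mul (by fun_prop) (measurable_det_kernel hK n)
  refine ⟨hi, ?_⟩
  have h2 := integral_fintype_prod_eq_pow (ι := Fin n) (𝕜 := ℝ) (μ := μ) (fun x => |ψ x| * ‖K x x‖)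
  rw [Fintype.card_fin] at h2
  rw [← h2]
  exact integral_mono_ae hi.norm hb hle

theorem IsKernelExpansion.tendsto_integral_truncKernel (n : ℕ) :
    Tendsto (fun s : Finset ι => ∫ x : Fin n → α, (∏ i, (ψ (x i) : ℂ)) *
        (Matrix.of fun i j => truncKernel φ s (x i) (x j)).det ∂Measure.pi (fun _ => μ)) atTop
      (𝓝 (∫ x : Fin n → α, (∏ i, (ψ (x i) : ℂ)) *
        (Matrix.of fun i j => K (x i) (x j)).det ∂Measure.pi (fun _ => μ))) ∧
    ∀ s : Finset ι, ‖∫ x : Fin n → α, (∏ i, (ψ (x i) : ℂ)) *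
        (Matrix.of fun i j => truncKernel φ s (x i) (x j)).det ∂Measure.pi (fun _ => μ)‖ ≤
      (∫ x, |ψ x| * ‖K x x‖ ∂μ) ^ n := by
  have hint' : Integrable (fun x => |ψ x| * ‖K x x‖) μ := by
    refine hint.norm.congr (ae_of_all _ fun x => ?_)
    simp
  have hb : Integrable (fun x : Fin n → α => ∏ i, (|ψ (x i)| * ‖K (x i) (x i)‖))
      (Measure.pi fun _ => μ) := Integrable.fintype_prod fun _ => hint'
  have hle : ∀ s : Finset ι, ∀ᵐ x : Fin n → α ∂Measure.pi fun _ => μ, ‖(∏ i, (ψ (x i) : ℂ)) *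
      (Matrix.of fun i j => truncKernel φ s (x i) (x j)).det‖ ≤
        ∏ i, (|ψ (x i)| * ‖K (x i) (x i)‖) := by
    intro s
    filter_upwards [hφ.ae_pi hK n] with x hx
    rw [norm_mul, norm_prod, Finset.prod_mul_distrib]
    simp only [Complex.norm_real, Real.norm_eq_abs]
    gcongr
    exact norm_det_truncKernel_le s hx
  have htm : ∀ s : Finset ι, Measurable (Function.uncurry (truncKernel φ s)) := fun s => by
    have := hφ.measurable
    have h2 : Measurable (conj : ℂ → ℂ) := Complex.continuous_conj.measurable
    unfold truncKernel Function.uncurry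
    fun_prop
  constructor
  -- Dominated convergence along finite subsets is legitimate because ι is countable, which makes
  -- the filter countably generated.
  · refine tendsto_integral_filter_of_dominated_convergence _ (Eventually.of_forall fun s => ?_)
      (Eventually.of_forall hle) hb ?_
    · refine Measurable.aestronglyMeasurable ?_
      exact Measurable.mul (by fun_prop) (measurable_det_kernel (htm s) n)
    · filter_upwards [hφ.ae_pi hK n] with x hx
      exact (tendsto_det_truncKernel hx).const_mul _
  · intro s
    have h2 := integral_fintype_prod_eq_pow (ι := Fin n) (𝕜 := ℝ) (μ := μ) (fun x => |ψ x| * ‖K x x‖)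
    rw [Fintype.card_fin] at h2
    rw [← h2]
    exact norm_integral_le_of_norm_le hb (hle s)

/-- For the truncated kernel, Andréief's identity turns the series into det(1 + A), at most exp(tr
A), and tr A is the integral of ψ against the truncated diagonal. Both sides converge as the
truncation is removed. -/
theorem IsKernelExpansion.re_fredholm_le {C : ℝ} (hC : ∀ x, |ψ x| ≤ C) (h1 : ∀ x, -1 ≤ ψ x) :
    (∑' n : ℕ, ((n.factorial : ℕ) : ℂ)⁻¹ * ∫ x : Fin n → α, (∏ i, (ψ (x i) : ℂ)) *
      (Matrix.of fun i j => K (x i) (x j)).det ∂Measure.pi (fun _ => μ)).re ≤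
    Real.exp (∫ x, ψ x * ‖K x x‖ ∂μ) := by
  classical
  have hlim := tendsto_tsum_of_dominated_convergence (𝓕 := (atTop : Filter (Finset ι)))
    (f := fun s n => ((n.factorial : ℕ) : ℂ)⁻¹ * ∫ x : Fin n → α, (∏ i, (ψ (x i) : ℂ)) *
      (Matrix.of fun i j => truncKernel φ s (x i) (x j)).det ∂Measure.pi (fun _ => μ))
    (Real.summable_pow_div_factorial (∫ x, |ψ x| * ‖K x x‖ ∂μ))
    (fun n => ((hφ.tendsto_integral_truncKernel hK hψ hint n).1).const_mul _)
    (Eventually.of_forall fun s n => by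
      rw [norm_mul, norm_inv, Complex.norm_natCast, div_eq_inv_mul]
      gcongr
      exact (hφ.tendsto_integral_truncKernel hK hψ hint n).2 s)
  have hre := (Complex.continuous_re.tendsto _).comp hlim
  have htr : Tendsto (fun s : Finset ι => Real.exp (∫ x, ψ x * (truncKernel φ s x x).re ∂μ)) atTop
      (𝓝 (Real.exp (∫ x, ψ x * ‖K x x‖ ∂μ))) := by
    refine (Real.continuous_exp.tendsto _).comp ?_
    have hmφ := hφ.measurable
    refine tendsto_integral_filter_of_dominated_convergence (fun x => ‖ψ x * ‖K x x‖‖)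
      (Eventually.of_forall fun s => ?_) (Eventually.of_forall fun s => ?_) hint.norm ?_
    · simp_rw [truncKernel_diag, Complex.ofReal_re]
      refine Measurable.aestronglyMeasurable ?_
      fun_prop
    · filter_upwards [hφ.diag] with x hx
      obtain ⟨h2, h3, -⟩ := truncKernel_diag_le φ s hx
      rw [norm_mul, norm_mul, norm_norm, Real.norm_of_nonneg h2]
      gcongr
    · filter_upwards [hφ.diag] with x hx
      have h2 : K x x = (‖K x x‖ : ℝ) := (truncKernel_diag_le φ ∅ hx).2.2
      have h3 := (Complex.continuous_re.tendsto _).comp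
        (show Tendsto (fun s : Finset ι => truncKernel φ s x x) atTop (𝓝 (K x x)) from hx)
      rw [h2, Complex.ofReal_re] at h3
      exact h3.const_mul _
  refine le_of_tendsto_of_tendsto' hre htr fun s => ?_
  have hA := posSemidef_one_add_weightMatrix hφ hψ hC h1 s
  have hsum := (hasSum_det_submatrix (weightMatrix μ φ ψ s)).tsum_eq
  simp_rw [← integral_prod_mul_det_truncKernel hφ hψ hC s] at hsum
  simp only [Function.comp_apply]
  rw [hsum]
  refine (re_det_le_exp_trace hA).trans (Real.exp_le_exp.2 (le_of_eq ?_))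
  rw [Matrix.trace_add, Matrix.trace_one, Complex.add_re, Complex.natCast_re, add_sub_cancel_left]
  simp only [Matrix.trace, Matrix.diag_apply, weightMatrix, Matrix.of_apply]
  have hi : ∀ a : s, Integrable (fun x => (ψ x : ℂ) * (φ a x * conj (φ a x))) μ :=
    fun a => integrable_weight hψ hC (hφ.memLp a) (hφ.memLp a)
  rw [← integral_finsetSum _ fun a _ => hi a]
  rw [← Complex.ofReal_re (∫ x, ψ x * (truncKernel φ s x x).re ∂μ), ← integral_complex_ofReal]
  congr 1
  refine integral_congr_ae (ae_of_all _ fun x => ?_)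
  simp only
  rw [← Finset.mul_sum, Finset.sum_coe_sort s (fun a => φ a x * conj (φ a x)), Complex.ofReal_mul,
    truncKernel_diag, Complex.ofReal_re, ← truncKernel_diag]
  rfl

end

end

end GiambelliDPP

namespace GiambelliDPP

/-! ### Multiplicative and additive functionals of a determinantal process -/

theorem tsum_iSup_of_monotone {α : Type*} {f : ℕ → α → ℝ≥0∞} (hf : Monotone f) :
    ∑' a, ⨆ n, f n a = ⨆ n, ∑' a, f n a := by
  simp_rw [ENNReal.tsum_eq_iSup_sum]
  rw [iSup_comm]
  congr 1
  ext s
  exact ENNReal.finsetSum_iSup_of_monotone fun a m n hmn => hf hmn a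

section

variable {E : Set ℝ}

/-- The sum of a nonnegative function over the points of a configuration. -/
def posSum (g : E → ℝ≥0∞) (X : Conf E) : ℝ≥0∞ := ∑' x : X.1, g x

/-- The sum of a real function over the points of a configuration. -/
def realSum (g : E → ℝ) (X : Conf E) : ℝ := ∑' x : X.1, g x

/-- The intensity measure `K(x, x) dμ(x)`. -/
def intensity (μ : Measure E) (K : E → E → ℂ) : Measure E := μ.withDensity fun x => ‖K x x‖ₑ

theorem finite_ne_zero_of_hasCompactSupport {β : Type*} [Zero β] {g : E → β}
    (hg : HasCompactSupport g) (X : Conf E) : {x : X.1 | g x ≠ 0}.Finite := by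
  have h := X.2 (tsupport g) hg.isCompact.isBounded
  refine Set.Finite.of_finite_image (h.subset ?_) Subtype.val_injective.injOn
  rintro _ ⟨x, hx, rfl⟩
  exact ⟨x.2, subset_tsupport g hx⟩

/-- Expand e^(∑ g) = ∏ (1 + (e^g − 1)) over finite subsets of X. Compact support leaves only
finitely many factors different from 1. -/
theorem hasSum_distinctSum {g : E → ℝ} (hg : HasCompactSupport g) (X : Conf E) :
    HasSum (fun n : ℕ => ((n.factorial : ℕ) : ℂ)⁻¹ *
      distinctSum (fun x : Fin n → E => ∏ i, ((Real.exp (g (x i)) - 1 : ℝ) : ℂ)) X)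
      (Real.exp (realSum g X) : ℂ) := by
  classical
  have hfin := finite_ne_zero_of_hasCompactSupport hg X
  let Y : Type := {x : X.1 // g x ≠ 0}
  have : Fintype Y := hfin.fintype
  have h1 : realSum g X = ∑ y : Y, g y.1 := by
    rw [realSum, ← tsum_fintype (L := .unconditional _)]
    refine (Function.Injective.tsum_eq (g := (Subtype.val : Y → X.1)) (f := fun x : X.1 => g x)
      Subtype.val_injective fun x hx => ?_).symm
    exact ⟨⟨x, hx⟩, rfl⟩
  have h2 : (Real.exp (realSum g X) : ℂ) = ∏ y : Y, (1 + ((Real.exp (g y.1) - 1 : ℝ) : ℂ)) := by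
    rw [h1, Real.exp_sum]
    push_cast
    exact Finset.prod_congr rfl fun y _ => by ring
  rw [h2]
  convert hasSum_prod_embedding (fun y : Y => ((Real.exp (g y.1) - 1 : ℝ) : ℂ)) using 3 with n
  rw [distinctSum, ← tsum_fintype (L := .unconditional _)]
  let i : (Fin n ↪ Y) → (Fin n ↪ X.1) := fun s => s.trans (Function.Embedding.subtype _)
  have hi : Function.Injective i := fun s t hst => by
    ext k
    exact congrArg (fun x : X.1 => ((x : E) : ℝ)) (DFunLike.congr_fun hst k)
  refine (Function.Injective.tsum_eq hi fun s hs => ?_).symm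
  rw [Function.mem_support, Finset.prod_ne_zero_iff] at hs
  have hs' : ∀ k, g (s k) ≠ 0 := fun k h0 => hs k (Finset.mem_univ k) (by simp [h0])
  exact ⟨⟨fun k => ⟨s k, hs' k⟩, fun k l hkl => s.injective (congrArg Subtype.val hkl)⟩, by
    ext k; rfl⟩

theorem norm_distinctSum_le {n : ℕ} (f : (Fin n → E) → ℂ)
    (X : Conf E) : ‖distinctSum f X‖ ≤ (distinctSum (fun x => ((‖f x‖ : ℝ) : ℂ)) X).re := by
  rw [distinctSum, distinctSum, ← Complex.ofReal_tsum, Complex.ofReal_re]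
  by_cases h : Summable fun s : Fin n ↪ X.1 => ‖f fun i => (s i : E)‖
  · exact norm_tsum_le_tsum_norm h
  · rw [tsum_eq_zero_of_not_summable h,
      tsum_eq_zero_of_not_summable (fun h' => h (summable_norm_iff.2 h')), norm_zero]

theorem hasCompactSupport_prod {n : ℕ} {ψ : E → ℂ} (hψ : HasCompactSupport ψ) :
    HasCompactSupport fun x : Fin n → E => ∏ i, ψ (x i) := by
  refine HasCompactSupport.intro (isCompact_univ_pi fun _ : Fin n => hψ.isCompact) fun x hx => ?_
  rw [Set.mem_univ_pi, not_forall] at hx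
  obtain ⟨i, hi⟩ := hx
  exact Finset.prod_eq_zero (Finset.mem_univ i) (image_eq_zero_of_notMem_tsupport hi)

variable {μ : Measure E} {K : E → E → ℂ} {P : Measure (Conf E)}

theorem IsKernelExpansion.ae_eq_norm {ι : Type} {φ : ι → E → ℂ} (hφ : IsKernelExpansion μ K φ) :
    ∀ᵐ x ∂μ, K x x = (‖K x x‖ : ℝ) := by
  filter_upwards [hφ.diag] with x hx
  exact (truncKernel_diag_le φ ∅ hx).2.2

theorem integrable_and_hasSum_integral {Ω : Type*} [MeasurableSpace Ω] {P : Measure Ω}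
    {F : ℕ → Ω → ℂ} {G : Ω → ℂ} (hF : ∀ n, Integrable (F n) P)
    (hs : Summable fun n => ∫ X, ‖F n X‖ ∂P) (hG : ∀ X, HasSum (fun n => F n X) (G X)) :
    Integrable G P ∧ HasSum (fun n => ∫ X, F n X ∂P) (∫ X, G X ∂P) := by
  constructor
  · refine ⟨aestronglyMeasurable_of_tendsto_ae atTop
      (f := fun (s : Finset ℕ) X => ∑ n ∈ s, F n X)
      (fun s => Finset.aestronglyMeasurable_fun_sum s fun n _ => (hF n).1) (ae_of_all _ hG), ?_⟩
    have hle : ∀ X, ‖G X‖ₑ ≤ ∑' n, ‖F n X‖ₑ := fun X => by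
      rw [← (hG X).tsum_eq]
      exact enorm_tsum_le_tsum_enorm
    refine (lintegral_mono hle).trans_lt ?_
    rw [lintegral_tsum fun n => (hF n).1.enorm]
    simp_rw [← fun n => ofReal_integral_norm_eq_lintegral_enorm (hF n)]
    rw [← ENNReal.ofReal_tsum_of_nonneg (fun n => integral_nonneg fun _ => norm_nonneg _) hs]
    exact ENNReal.ofReal_lt_top
  · have := hasSum_integral_of_summable_integral_norm hF hs
    simp_rw [(hG _).tsum_eq] at this
    exact this

theorem IsDeterminantal.integral_distinctSum_prod [SigmaFinite μ] {ι : Type} [Countable ι]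
    {φ : ι → E → ℂ} (hφ : IsKernelExpansion μ K φ) (hK : Measurable (Function.uncurry K))
    (hP : IsDeterminantal μ K P) {ψ : E → ℝ} (hψm : Measurable ψ) {C : ℝ} (hψC : ∀ x, |ψ x| ≤ C)
    (hψs : HasCompactSupport ψ) (hint : Integrable (fun x => ψ x * ‖K x x‖) μ) (n : ℕ) :
    Integrable (distinctSum fun x : Fin n → E => ∏ i, ((ψ (x i) : ℝ) : ℂ)) P ∧
    ∫ X, distinctSum (fun x : Fin n → E => ∏ i, ((ψ (x i) : ℝ) : ℂ)) X ∂P =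
      ∫ x : Fin n → E, (∏ i, (ψ (x i) : ℂ)) *
        (Matrix.of fun i j => K (x i) (x j)).det ∂Measure.pi (fun _ => μ) ∧
    ∫ X, ‖distinctSum (fun x : Fin n → E => ∏ i, ((ψ (x i) : ℝ) : ℂ)) X‖ ∂P ≤
      (∫ x, |(|ψ x|)| * ‖K x x‖ ∂μ) ^ n := by
  have hint' : Integrable (fun x => |ψ x| * ‖K x x‖) μ := by
    refine hint.norm.congr (ae_of_all _ fun x => ?_)
    simp
  have hcpt : HasCompactSupport fun x : Fin n → E => ∏ i, ((ψ (x i) : ℝ) : ℂ) :=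
    hasCompactSupport_prod (ψ := fun x => ((ψ x : ℝ) : ℂ))
      (hψs.comp_left (g := fun t : ℝ => (t : ℂ)) Complex.ofReal_zero)
  have hbd : ∃ c : ℝ, ∀ x : Fin n → E, ‖∏ i, ((ψ (x i) : ℝ) : ℂ)‖ ≤ c := by
    refine ⟨C ^ n, fun x => ?_⟩
    rw [norm_prod]
    refine (Finset.prod_le_prod (fun i _ => norm_nonneg _) fun i _ =>
      (Complex.norm_real _).le.trans (hψC (x i))).trans ?_
    simp
  have hdet := hP n (fun x : Fin n → E => ∏ i, ((ψ (x i) : ℝ) : ℂ)) (by fun_prop) hbd hcpt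
  -- The correlation identity for the absolute value controls the L¹ norm, which is what termwise
  -- integration requires.
  have hdet' := hP n (fun x : Fin n → E => ((‖∏ i, ((ψ (x i) : ℝ) : ℂ)‖ : ℝ) : ℂ))
    (by fun_prop) (by simpa using hbd)
    (hcpt.comp_left (g := fun t : ℂ => ((‖t‖ : ℝ) : ℂ)) (by simp))
  have habs : ∀ x : Fin n → E, ((‖∏ i, ((ψ (x i) : ℝ) : ℂ)‖ : ℝ) : ℂ) =
      ∏ i, ((|ψ (x i)| : ℝ) : ℂ) := fun x => by
    rw [norm_prod]
    push_cast
    simp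
  refine ⟨hdet.1, hdet.2.2, ?_⟩
  calc ∫ X, ‖distinctSum (fun x : Fin n → E => ∏ i, ((ψ (x i) : ℝ) : ℂ)) X‖ ∂P
      ≤ ∫ X, (distinctSum (fun x : Fin n → E => ((‖∏ i, ((ψ (x i) : ℝ) : ℂ)‖ : ℝ) : ℂ)) X).re ∂P :=
        integral_mono hdet.1.norm hdet'.1.re fun X => norm_distinctSum_le _ X
    _ = (∫ X, distinctSum (fun x : Fin n → E =>
        ((‖∏ i, ((ψ (x i) : ℝ) : ℂ)‖ : ℝ) : ℂ)) X ∂P).re := integral_re hdet'.1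
    _ ≤ _ := by
        rw [hdet'.2.2]
        have h3 := (hφ.integrable_prod_mul_det hK (ψ := fun x => |ψ x|) (by fun_prop) hint' n).2
        refine (Complex.re_le_norm _).trans ((norm_integral_le_integral_norm _).trans ?_)
        simp_rw [habs]
        exact h3

/-- Integrating the expansion of e^(∑ g) term by term gives exactly the Fredholm series with weight
e^g − 1, which is at least −1. -/
theorem IsDeterminantal.lintegral_exp_realSum_le [SigmaFinite μ] {ι : Type} [Countable ι]
    {φ : ι → E → ℂ} (hφ : IsKernelExpansion μ K φ) (hK : Measurable (Function.uncurry K))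
    (hKint : ∀ B : Set E, MeasurableSet B → Bornology.IsBounded B →
      IntegrableOn (fun x => K x x) B μ)
    (hP : IsDeterminantal μ K P) {g : E → ℝ} (hg : Measurable g) {C : ℝ} (hC : ∀ x, |g x| ≤ C)
    (hgs : HasCompactSupport g) :
    AEMeasurable (realSum g) P ∧
    ∫⁻ X, ENNReal.ofReal (Real.exp (realSum g X)) ∂P ≤
      ENNReal.ofReal (Real.exp (∫ x, (Real.exp (g x) - 1) * ‖K x x‖ ∂μ)) := by
  have hψC : ∀ x, |Real.exp (g x) - 1| ≤ Real.exp C + 1 := fun x => by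
    have h1 := Real.exp_le_exp.2 ((abs_le.1 (hC x)).2)
    have h2 := Real.exp_pos (g x)
    rw [abs_le]
    constructor <;> linarith
  have hψ1 : ∀ x, -1 ≤ Real.exp (g x) - 1 := fun x => by
    have h2 := Real.exp_pos (g x)
    linarith
  have hsum := hasSum_distinctSum hgs
  obtain ⟨ψ, hψ⟩ : ∃ ψ : E → ℝ, ψ = fun x => Real.exp (g x) - 1 := ⟨_, rfl⟩
  have hψm : Measurable ψ := by rw [hψ]; fun_prop
  have hψs : HasCompactSupport ψ := by
    rw [hψ]; exact hgs.comp_left (g := fun t => Real.exp t - 1) (by simp)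
  have e : ∀ x, Real.exp (g x) - 1 = ψ x := fun x => by rw [hψ]
  simp only [e] at hψC hψ1 hsum ⊢
  have hint : Integrable (fun x => ψ x * ‖K x x‖) μ := by
    have h1 : IntegrableOn (fun x => ψ x * ‖K x x‖) (tsupport ψ) μ := by
      refine Integrable.bdd_mul (c := Real.exp C + 1) ?_ hψm.aestronglyMeasurable
        (ae_of_all _ hψC)
      exact (hKint _ (isClosed_tsupport ψ).measurableSet hψs.isCompact.isBounded).norm
    refine (integrableOn_iff_integrable_of_support_subset fun x hx => subset_tsupport ψ ?_).1 h1
    exact left_ne_zero_of_mul hx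
  have hD := hP.integral_distinctSum_prod hφ hK hψm hψC hψs hint
  have hFs : Summable fun n : ℕ => ∫ X, ‖((n.factorial : ℕ) : ℂ)⁻¹ *
      distinctSum (fun x : Fin n → E => ∏ i, ((ψ (x i) : ℝ) : ℂ)) X‖ ∂P := by
    refine Summable.of_nonneg_of_le (fun n => integral_nonneg fun _ => norm_nonneg _) (fun n => ?_)
      (Real.summable_pow_div_factorial (∫ x, |(|ψ x|)| * ‖K x x‖ ∂μ))
    simp only [norm_mul, norm_inv, Complex.norm_natCast]
    rw [integral_const_mul, div_eq_inv_mul]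
    gcongr
    exact (hD n).2.2
  obtain ⟨hG1, hG2⟩ := integrable_and_hasSum_integral (fun n => (hD n).1.const_mul _) hFs hsum
  have hGr : Integrable (fun X => Real.exp (realSum g X)) P := by
    simpa only [RCLike.re_eq_complex_re, Complex.ofReal_re] using hG1.re
  constructor
  -- Measurability of the sum is recovered from that of its exponential.
  · have := Real.measurable_log.comp_aemeasurable hGr.aemeasurable
    refine this.congr (ae_of_all _ fun X => ?_)
    simp only [Function.comp_apply, Real.log_exp]
  · rw [← ofReal_integral_eq_lintegral_ofReal hGr (ae_of_all _ fun X => (Real.exp_pos _).le)]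
    refine ENNReal.ofReal_le_ofReal ?_
    have h1 : ∫ X, Real.exp (realSum g X) ∂P = (∫ X, (Real.exp (realSum g X) : ℂ) ∂P).re := by
      rw [integral_complex_ofReal, Complex.ofReal_re]
    rw [h1, ← hG2.tsum_eq]
    refine le_trans (le_of_eq ?_) (hφ.re_fredholm_le hK hψm hint hψC hψ1)
    congr 1
    refine tsum_congr fun n => ?_
    rw [integral_const_mul, (hD n).2.1]

theorem distinctSum_one (f : E → ℂ) (X : Conf E) :
    distinctSum (fun x : Fin 1 → E => f (x 0)) X = ∑' x : X.1, f x := by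
  rw [distinctSum, ← (Equiv.uniqueEmbeddingEquivResult (α := Fin 1) (β := X.1)).tsum_eq]
  rfl

/-! ### First moments of additive functionals -/

theorem IsDeterminantal.lintegral_posSum_of_hasCompactSupport
    (hφ : ∀ᵐ x ∂μ, K x x = (‖K x x‖ : ℝ)) [SigmaFinite μ]
    (hP : IsDeterminantal μ K P) (hK : Measurable (Function.uncurry K)) {g : E → ℝ}
    (hg : Measurable g) (hg0 : ∀ x, 0 ≤ g x) {C : ℝ} (hC : ∀ x, g x ≤ C)
    (hgs : HasCompactSupport g) :
    AEMeasurable (posSum fun x => ENNReal.ofReal (g x)) P ∧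
      ∫⁻ X, posSum (fun x => ENNReal.ofReal (g x)) X ∂P =
        ∫⁻ x, ENNReal.ofReal (g x) ∂intensity μ K := by
  have hc : HasCompactSupport fun x : Fin 1 → E => ((g (x 0) : ℝ) : ℂ) := by
    have := hasCompactSupport_prod (n := 1) (ψ := fun x => ((g x : ℝ) : ℂ))
      (hgs.comp_left (g := fun t : ℝ => (t : ℂ)) Complex.ofReal_zero)
    simpa using this
  obtain ⟨h1, h2, h3⟩ := hP 1 (fun x => ((g (x 0) : ℝ) : ℂ)) (by fun_prop)
    ⟨C, fun x => by
      rw [Complex.norm_real, Real.norm_of_nonneg (hg0 _)]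
      exact hC _⟩ hc
  have hpos : ∀ X : Conf E, posSum (fun x => ENNReal.ofReal (g x)) X =
      ENNReal.ofReal (distinctSum (fun x : Fin 1 → E => ((g (x 0) : ℝ) : ℂ)) X).re := fun X => by
    rw [distinctSum_one (fun x => ((g x : ℝ) : ℂ)), ← Complex.ofReal_tsum, Complex.ofReal_re,
      posSum, ENNReal.ofReal_tsum_of_nonneg fun x => hg0 _]
    exact (summable_of_hasFiniteSupport (finite_ne_zero_of_hasCompactSupport hgs X))
  have hnn : ∀ X, 0 ≤ (distinctSum (fun x : Fin 1 → E => ((g (x 0) : ℝ) : ℂ)) X).re := fun X => by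
    rw [distinctSum_one (fun x => ((g x : ℝ) : ℂ)), ← Complex.ofReal_tsum, Complex.ofReal_re]
    exact tsum_nonneg fun x => hg0 _
  constructor
  · exact (h1.re.aemeasurable.ennreal_ofReal).congr (ae_of_all _ fun X => (hpos X).symm)
  · simp_rw [hpos]
    have h1r : Integrable (fun X =>
        (distinctSum (fun x : Fin 1 → E => ((g (x 0) : ℝ) : ℂ)) X).re) P := h1.re
    rw [← ofReal_integral_eq_lintegral_ofReal h1r (ae_of_all _ hnn)]
    have h4 : ∫ X, (distinctSum (fun x : Fin 1 → E => ((g (x 0) : ℝ) : ℂ)) X).re ∂P =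
        (∫ X, distinctSum (fun x : Fin 1 → E => ((g (x 0) : ℝ) : ℂ)) X ∂P).re := integral_re h1
    have h5 : ∫ x : Fin 1 → E, ((g (x 0) : ℝ) : ℂ) * (Matrix.of fun i j => K (x i) (x j)).det
        ∂(Measure.pi fun _ => μ) = ∫ x, (g x : ℂ) * K x x ∂μ := by
      have hmp := (measurePreserving_funUnique μ (Fin 1))
      rw [← hmp.integral_comp']
      simp [MeasurableEquiv.funUnique]
      rfl
    have h6 : ∫ x, (g x : ℂ) * K x x ∂μ = ((∫ x, g x * ‖K x x‖ ∂μ : ℝ) : ℂ) := by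
      rw [← integral_complex_ofReal]
      refine integral_congr_ae ?_
      filter_upwards [hφ] with x hx
      rw [Complex.ofReal_mul, ← hx]
    have h7 : Integrable (fun x => g x * ‖K x x‖) μ := by
      have hmp := (measurePreserving_funUnique μ (Fin 1))
      have h8 : Integrable (fun x => (g x : ℂ) * K x x) μ := by
        rw [← hmp.integrable_comp_emb (MeasurableEquiv.measurableEmbedding _)]
        refine h2.congr (ae_of_all _ fun x => ?_)
        simp [MeasurableEquiv.funUnique]
      refine h8.norm.congr (ae_of_all _ fun x => ?_)
      simp only [norm_mul, Complex.norm_real, Real.norm_of_nonneg (hg0 x)]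
    rw [h4, h3, h5, h6, Complex.ofReal_re, ofReal_integral_eq_lintegral_ofReal h7
      (ae_of_all _ fun x => mul_nonneg (hg0 x) (norm_nonneg _)), intensity,
      lintegral_withDensity_eq_lintegral_mul]
    · refine lintegral_congr fun x => ?_
      rw [ENNReal.ofReal_mul (hg0 x), ofReal_norm, mul_comm]
      rfl
    · exact (hK.comp (f := fun x => (x, x)) (by fun_prop)).enorm
    · fun_prop

theorem IsDeterminantal.lintegral_posSum [LocallyCompactSpace E] [SigmaFinite μ]
    (hφ : ∀ᵐ x ∂μ, K x x = (‖K x x‖ : ℝ))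
    (hP : IsDeterminantal μ K P) (hK : Measurable (Function.uncurry K)) {g : E → ℝ≥0∞}
    (hg : Measurable g) :
    AEMeasurable (posSum g) P ∧ ∫⁻ X, posSum g X ∂P = ∫⁻ x, g x ∂intensity μ K := by
  classical
  -- Cutting off both the support and the values gives admissible test functions increasing to g, so
  -- monotone convergence applies on both sides.
  let G : ℕ → E → ℝ := fun n => (compactCovering E n).indicator fun x => (min (g x) n).toReal
  have hGm : ∀ n, Measurable (G n) := fun n =>
    ((hg.min measurable_const).ennreal_toReal).indicator
      (isCompact_compactCovering E n).isClosed.measurableSet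
  have hG0 : ∀ n x, 0 ≤ G n x := fun n x =>
    Set.indicator_nonneg (fun _ _ => ENNReal.toReal_nonneg) x
  have hGC : ∀ n x, G n x ≤ n := fun n x => by
    simp only [G, Set.indicator]
    split_ifs
    · exact ENNReal.toReal_le_of_le_ofReal (by positivity) (by simp)
    · positivity
  have hGs : ∀ n, HasCompactSupport (G n) := fun n =>
    HasCompactSupport.intro (isCompact_compactCovering E n) fun x hx =>
      Set.indicator_of_notMem hx _
  have hof : ∀ n x, ENNReal.ofReal (G n x) =
      if x ∈ compactCovering E n then min (g x) n else 0 := fun n x => by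
    simp only [G, Set.indicator]
    split_ifs
    · exact ENNReal.ofReal_toReal (ne_top_of_le_ne_top (ENNReal.natCast_ne_top n)
        (min_le_right _ _))
    · simp
  have hmono : Monotone fun n x => ENNReal.ofReal (G n x) := by
    intro m n hmn x
    simp only [hof]
    split_ifs with h1 h2
    · exact min_le_min le_rfl (by exact_mod_cast hmn)
    · exact absurd (compactCovering_subset E hmn h1) h2
    · exact zero_le
    · exact le_rfl
  have hsup : ∀ x, ⨆ n, ENNReal.ofReal (G n x) = g x := fun x => by
    refine le_antisymm (iSup_le fun n => ?_) ?_
    · rw [hof]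
      split_ifs
      · exact min_le_left _ _
      · exact zero_le
    · obtain ⟨N, hN⟩ := exists_mem_compactCovering x
      refine le_of_forall_lt fun c hc => ?_
      obtain ⟨m, hm⟩ := ENNReal.exists_nat_gt hc.ne_top
      refine lt_of_lt_of_le ?_ (le_iSup _ (max N m))
      rw [hof, if_pos (compactCovering_subset E (le_max_left _ _) hN), lt_min_iff]
      refine ⟨hc, hm.trans_le ?_⟩
      exact_mod_cast le_max_right N m
  have hposm : Monotone fun n X => posSum (fun x : E => ENNReal.ofReal (G n x)) X :=
    fun m n hmn X => ENNReal.tsum_le_tsum fun x => hmono hmn x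
  have hpos : ∀ X : Conf E, posSum g X = ⨆ n, posSum (fun x => ENNReal.ofReal (G n x)) X := by
    intro X
    rw [posSum]
    simp_rw [← hsup]
    exact tsum_iSup_of_monotone fun m n hmn x => hmono hmn x
  have hn := fun n =>
    hP.lintegral_posSum_of_hasCompactSupport hφ hK (hGm n) (hG0 n) (hGC n) (hGs n)
  constructor
  · refine (AEMeasurable.iSup fun n => (hn n).1).congr (ae_of_all _ fun X => ?_)
    rw [hpos]
  · simp_rw [hpos]
    rw [lintegral_iSup' (fun n => (hn n).1) (ae_of_all _ fun X m n hmn => hposm hmn X)]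
    simp_rw [(hn _).2]
    rw [← lintegral_iSup (fun n => (hGm n).ennreal_ofReal) hmono]
    simp_rw [hsup]

/-- The additive functionals of `P` have mean given by `ν` and exponential moments bounded by those
of a Poisson process with intensity `ν`. -/
structure IsSubPoisson (ν : Measure E) (P : Measure (Conf E)) : Prop where
  lintegral_posSum : ∀ g : E → ℝ≥0∞, Measurable g →
    AEMeasurable (posSum g) P ∧ ∫⁻ X, posSum g X ∂P = ∫⁻ x, g x ∂ν
  lintegral_exp : ∀ g : E → ℝ, Measurable g → (∃ C : ℝ, ∀ x, |g x| ≤ C) → HasCompactSupport g →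
    AEMeasurable (realSum g) P ∧ ∫⁻ X, ENNReal.ofReal (Real.exp (realSum g X)) ∂P ≤
      ENNReal.ofReal (Real.exp (∫ x, (Real.exp (g x) - 1) ∂ν))
  measure_lt_top : ∀ B : Set E, MeasurableSet B → Bornology.IsBounded B → ν B < ∞

theorem measurable_enorm_diag (hK : Measurable (Function.uncurry K)) :
    Measurable fun x => ‖K x x‖ₑ :=
  (hK.comp (f := fun x => (x, x)) (by fun_prop)).enorm

theorem integral_intensity (hK : Measurable (Function.uncurry K)) (f : E → ℝ) :
    ∫ x, f x ∂intensity μ K = ∫ x, f x * ‖K x x‖ ∂μ := by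
  rw [intensity, integral_withDensity_eq_integral_toReal_smul
    (measurable_enorm_diag hK) (ae_of_all _ fun x => enorm_lt_top)]
  simp [mul_comm]

theorem integrable_intensity_iff (hK : Measurable (Function.uncurry K)) (f : E → ℝ) :
    Integrable f (intensity μ K) ↔ Integrable (fun x => f x * ‖K x x‖) μ := by
  rw [intensity, integrable_withDensity_iff
    (measurable_enorm_diag hK) (ae_of_all _ fun x => enorm_lt_top)]
  simp

/-- This closes the determinantal part: all later estimates on the process use only this property.
-/
theorem IsDeterminantal.isSubPoisson [LocallyCompactSpace E] [IsLocallyFiniteMeasure μ]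
    (hK : IsProjectionKernel μ K) (hP : IsDeterminantal μ K P) :
    IsSubPoisson (intensity μ K) P := by
  obtain ⟨ι, hι, φ, h1, h2, h3, h4, h5⟩ := hK.exists_expansion
  have hφ : IsKernelExpansion μ K φ := ⟨h1, h2, h3, h4, h5⟩
  have hKint : ∀ B : Set E, MeasurableSet B → Bornology.IsBounded B →
      IntegrableOn (fun x => K x x) B μ := by
    obtain ⟨T, -, -, hT⟩ := hK.exists_projection
    exact fun B hB hb => (hT B hB hb).1
  refine ⟨fun g hg => hP.lintegral_posSum hφ.ae_eq_norm hK.measurable hg,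
    fun g hg ⟨C, hC⟩ hgs => ?_, fun B hB hb => ?_⟩
  · rw [integral_intensity hK.measurable]
    exact hP.lintegral_exp_realSum_le hφ hK.measurable hKint hg hC hgs
  · rw [intensity, withDensity_apply _ hB]
    exact (hKint B hB hb).2

end

end GiambelliDPP

namespace GiambelliDPP

/-! ### Additive functionals of processes with sub-Poissonian exponential moments -/

/-- The right side vanishes at 0, so exponential moments close to 1 force a small second moment. -/
theorem sq_le_exp_add_exp_neg (y : ℝ) : y ^ 2 ≤ 2 * (Real.exp y + Real.exp (-y) - 2) := by
  rcases le_total 0 y with h | h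
  · have h1 := Real.quadratic_le_exp_of_nonneg h
    have h2 := Real.add_one_le_exp (-y)
    nlinarith
  · have h1 := Real.quadratic_le_exp_of_nonneg (neg_nonneg.2 h)
    have h2 := Real.add_one_le_exp y
    nlinarith

theorem abs_exp_sub_one_le (t : ℝ) : |Real.exp t - 1| ≤ |t| * Real.exp |t| := by
  have h := Complex.norm_exp_sub_sum_le_norm_mul_exp (t : ℂ) 1
  simp only [Finset.range_one, Finset.sum_singleton, pow_zero, Nat.factorial_zero, Nat.cast_one,
    div_one, pow_one] at h
  rw [← Complex.ofReal_exp, ← Complex.ofReal_one, ← Complex.ofReal_sub, Complex.norm_real,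
    Complex.norm_real] at h
  exact h

theorem exp_sub_one_sub_le (t : ℝ) : Real.exp t - 1 - t ≤ t ^ 2 * Real.exp |t| := by
  have h := Complex.norm_exp_sub_sum_le_norm_mul_exp (t : ℂ) 2
  simp only [Finset.sum_range_succ, Finset.range_zero, Finset.sum_empty, zero_add, pow_zero,
    Nat.factorial_zero, Nat.cast_one, div_one, pow_one, Nat.factorial_one] at h
  rw [← Complex.ofReal_exp, ← Complex.ofReal_one, ← Complex.ofReal_add, ← Complex.ofReal_sub,
    Complex.norm_real, Complex.norm_real, Real.norm_eq_abs, Real.norm_eq_abs, sq_abs] at h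
  have := le_abs_self (Real.exp t - (1 + t))
  linarith

section

variable {E : Set ℝ} {ν : Measure E} {P : Measure (Conf E)}

/-- The sum of a complex function over the points of a configuration. -/
def linSum (g : E → ℂ) (X : Conf E) : ℂ := ∑' x : X.1, g x

namespace IsSubPoisson

/-- The expected number of points in a ν-null set is zero. -/
theorem ae_forall (hS : IsSubPoisson ν P) {p : E → Prop} (hp : ∀ᵐ x ∂ν, p x) :
    ∀ᵐ X ∂P, ∀ x : X.1, p x := by
  set N := toMeasurable ν {x | ¬ p x}
  have hN : ν N = 0 := by rw [measure_toMeasurable]; exact hp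
  have hNm : MeasurableSet N := measurableSet_toMeasurable _ _
  obtain ⟨h1, h2⟩ := hS.lintegral_posSum (N.indicator fun _ => 1) (measurable_const.indicator hNm)
  rw [lintegral_indicator hNm] at h2
  simp only [lintegral_const, MeasurableSet.univ, Measure.restrict_apply, univ_inter, hN,
    mul_zero] at h2
  have h3 := (lintegral_eq_zero_iff' h1).1 h2
  filter_upwards [h3] with X hX x
  by_contra hx
  have h4 := ENNReal.tsum_eq_zero.1 hX x
  have h5 : (x : E) ∈ N := subset_toMeasurable ν {x | ¬ p x} hx
  simp [h5] at h4

theorem ae_summable (hS : IsSubPoisson ν P) {g : E → ℂ} (hg : Measurable g)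
    (hi : Integrable g ν) : ∀ᵐ X ∂P, Summable fun x : X.1 => ‖g x‖ := by
  obtain ⟨h1, h2⟩ := hS.lintegral_posSum (fun x => ‖g x‖ₑ) hg.enorm
  have h3 := ae_lt_top' h1 (by rw [h2]; exact hi.2.ne)
  filter_upwards [h3] with X hX
  have h4 : ∑' x : X.1, ((‖g x‖₊ : NNReal) : ℝ≥0∞) ≠ ∞ := hX.ne
  have := ENNReal.tsum_coe_ne_top_iff_summable.1 h4
  exact NNReal.summable_coe.2 this

theorem ae_summable_real (hS : IsSubPoisson ν P) {g : E → ℝ} (hg : Measurable g)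
    (hi : Integrable g ν) : ∀ᵐ X ∂P, Summable fun x : X.1 => ‖g x‖ := by
  have := hS.ae_summable (g := fun x => (g x : ℂ)) (by fun_prop) hi.ofReal
  simpa using this

theorem realSum_eq_of_nonneg {g : E → ℝ} (h0 : ∀ x, 0 ≤ g x) {X : Conf E}
    (hs : Summable fun x : X.1 => ‖g x‖) :
    posSum (fun x => ENNReal.ofReal (g x)) X = ENNReal.ofReal (realSum g X) := by
  have hs' : Summable fun x : X.1 => g x := hs.of_norm
  rw [posSum, realSum, ENNReal.ofReal_tsum_of_nonneg (fun x => h0 _) hs']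

theorem integral_realSum_of_nonneg (hS : IsSubPoisson ν P) {g : E → ℝ} (hg : Measurable g)
    (h0 : ∀ x, 0 ≤ g x) (hi : Integrable g ν) :
    Integrable (realSum g) P ∧ ∫ X, realSum g X ∂P = ∫ x, g x ∂ν := by
  obtain ⟨h1, h2⟩ := hS.lintegral_posSum (fun x => ENNReal.ofReal (g x)) (by fun_prop)
  have h3 : ∀ᵐ X ∂P, (posSum (fun x => ENNReal.ofReal (g x)) X).toReal = realSum g X := by
    filter_upwards [hS.ae_summable_real hg hi] with X hX
    have h5 : 0 ≤ realSum g X := tsum_nonneg fun x => h0 _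
    rw [realSum_eq_of_nonneg h0 hX, ENNReal.toReal_ofReal h5]
  have h4 : ∫⁻ X, posSum (fun x => ENNReal.ofReal (g x)) X ∂P ≠ ∞ := by
    rw [h2]
    exact hi.lintegral_lt_top.ne
  refine ⟨(integrable_toReal_of_lintegral_ne_top h1 h4).congr h3, ?_⟩
  rw [← integral_congr_ae h3, integral_toReal h1 (ae_lt_top' h1 h4), h2,
    integral_eq_lintegral_of_nonneg_ae (ae_of_all _ h0) hg.aestronglyMeasurable]

theorem integral_realSum (hS : IsSubPoisson ν P) {g : E → ℝ} (hg : Measurable g)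
    (hi : Integrable g ν) :
    Integrable (realSum g) P ∧ ∫ X, realSum g X ∂P = ∫ x, g x ∂ν := by
  obtain ⟨h1, h2⟩ := hS.integral_realSum_of_nonneg (g := fun x => max (g x) 0) (by fun_prop)
    (fun x => le_max_right _ _) hi.pos_part
  obtain ⟨h3, h4⟩ := hS.integral_realSum_of_nonneg (g := fun x => max (-g x) 0) (by fun_prop)
    (fun x => le_max_right _ _) hi.neg_part
  have h5 : ∀ᵐ X ∂P, realSum (fun x => max (g x) 0) X - realSum (fun x => max (-g x) 0) X =
      realSum g X := by
    filter_upwards [hS.ae_summable_real (g := fun x => max (g x) 0) (by fun_prop) hi.pos_part,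
      hS.ae_summable_real (g := fun x => max (-g x) 0) (by fun_prop) hi.neg_part] with X h6 h7
    rw [realSum, realSum, ← h6.of_norm.tsum_sub h7.of_norm]
    refine tsum_congr fun x => ?_
    rcases le_total 0 (g x) with h | h
    · rw [max_eq_left h, max_eq_right (by linarith), sub_zero]
    · rw [max_eq_right h, max_eq_left (by linarith)]; ring
  refine ⟨(h1.sub h3).congr h5, ?_⟩
  rw [← integral_congr_ae h5, integral_sub h1 h3, h2, h4, ← integral_sub hi.pos_part hi.neg_part]
  refine integral_congr_ae (ae_of_all _ fun x => ?_)
  simp only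
  rcases le_total 0 (g x) with h | h
  · rw [max_eq_left h, max_eq_right (by linarith), sub_zero]
  · rw [max_eq_right h, max_eq_left (by linarith)]; ring

theorem linSum_eq {g : E → ℂ} {X : Conf E} (hX : Summable fun x : X.1 => ‖g x‖) :
    linSum g X = (realSum (fun x => (g x).re) X : ℂ) + realSum (fun x => (g x).im) X * Complex.I := by
  have h := Complex.hasSum_iff _ _ |>.1 hX.of_norm.hasSum
  refine Complex.ext ?_ ?_
  · simp only [Complex.add_re, Complex.ofReal_re, Complex.mul_re, Complex.I_re, Complex.ofReal_im,
      Complex.I_im, mul_zero, zero_mul, sub_zero, add_zero]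
    exact h.1.tsum_eq.symm
  · simp only [Complex.add_im, Complex.ofReal_im, Complex.mul_im, Complex.I_re, Complex.ofReal_re,
      Complex.I_im, mul_zero, mul_one, zero_add, add_zero]
    exact h.2.tsum_eq.symm

theorem integral_linSum (hS : IsSubPoisson ν P) {g : E → ℂ} (hg : Measurable g)
    (hi : Integrable g ν) :
    Integrable (linSum g) P ∧ ∫ X, linSum g X ∂P = ∫ x, g x ∂ν := by
  have hire : Integrable (fun x => (g x).re) ν := hi.re
  have hiim : Integrable (fun x => (g x).im) ν := hi.im
  obtain ⟨h1, h2⟩ := hS.integral_realSum (g := fun x => (g x).re) (by fun_prop) hire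
  obtain ⟨h3, h4⟩ := hS.integral_realSum (g := fun x => (g x).im) (by fun_prop) hiim
  have h5 : ∀ᵐ X ∂P, (realSum (fun x => (g x).re) X : ℂ) +
      realSum (fun x => (g x).im) X * Complex.I = linSum g X := by
    filter_upwards [hS.ae_summable hg hi] with X hX
    exact (linSum_eq hX).symm
  refine ⟨(h1.ofReal.add (h3.ofReal.mul_const _)).congr h5, ?_⟩
  rw [← integral_congr_ae h5, integral_add h1.ofReal (h3.ofReal.mul_const _), integral_mul_const,
    integral_complex_ofReal, integral_complex_ofReal, h2, h4]
  exact integral_re_add_im hi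

theorem integrable_exp_sub_one {g : E → ℝ} (hg : Measurable g) {C : ℝ} (hC : ∀ x, |g x| ≤ C)
    (hi : Integrable g ν) : Integrable (fun x => Real.exp (g x) - 1) ν := by
  refine (hi.norm.const_mul (Real.exp C)).mono' (by fun_prop) (ae_of_all _ fun x => ?_)
  rw [Real.norm_eq_abs, Real.norm_eq_abs, mul_comm]
  refine (abs_exp_sub_one_le _).trans ?_
  gcongr
  exact hC x

/-- Compact support is dropped by Fatou's lemma on the left and dominated convergence on the right,
using |e^g − 1| ≤ e^C |g|. -/
theorem lintegral_exp_realSum_le [LocallyCompactSpace E] (hS : IsSubPoisson ν P) {g : E → ℝ}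
    (hg : Measurable g) {C : ℝ} (hC : ∀ x, |g x| ≤ C) (hi : Integrable g ν) :
    ∫⁻ X, ENNReal.ofReal (Real.exp (realSum g X)) ∂P ≤
      ENNReal.ofReal (Real.exp (∫ x, (Real.exp (g x) - 1) ∂ν)) := by
  let G : ℕ → E → ℝ := fun n => (compactCovering E n).indicator g
  have hGm : ∀ n, Measurable (G n) := fun n =>
    hg.indicator (isCompact_compactCovering E n).isClosed.measurableSet
  have hGg : ∀ n x, |G n x| ≤ |g x| := fun n x => by
    simp only [G, Set.indicator]
    split_ifs <;> simp
  have hGs : ∀ n, HasCompactSupport (G n) := fun n =>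
    HasCompactSupport.intro (isCompact_compactCovering E n) fun x hx =>
      Set.indicator_of_notMem hx _
  have hGt : ∀ x, Tendsto (fun n => G n x) atTop (𝓝 (g x)) := fun x => by
    obtain ⟨N, hN⟩ := exists_mem_compactCovering x
    refine tendsto_const_nhds.congr' ?_
    filter_upwards [eventually_ge_atTop N] with n hn
    exact (Set.indicator_of_mem (compactCovering_subset E hn hN) _).symm
  have hGe := fun n => hS.lintegral_exp (G n) (hGm n) ⟨C, fun x => (hGg n x).trans (hC x)⟩ (hGs n)
  have hb : Tendsto (fun n => ∫ x, (Real.exp (G n x) - 1) ∂ν) atTop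
      (𝓝 (∫ x, (Real.exp (g x) - 1) ∂ν)) := by
    refine tendsto_integral_of_dominated_convergence (fun x => Real.exp C * ‖g x‖)
      (fun n => by have := hGm n; fun_prop) (hi.norm.const_mul _)
      (fun n => ae_of_all _ fun x => ?_) (ae_of_all _ fun x => ?_)
    · rw [Real.norm_eq_abs, Real.norm_eq_abs, mul_comm]
      refine (abs_exp_sub_one_le _).trans ?_
      have := hGg n x
      gcongr
      exact this.trans (hC x)
    · exact ((Real.continuous_exp.tendsto _).comp (hGt x)).sub_const 1
  have hb' : Tendsto (fun n => ENNReal.ofReal (Real.exp (∫ x, (Real.exp (G n x) - 1) ∂ν))) atTop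
      (𝓝 (ENNReal.ofReal (Real.exp (∫ x, (Real.exp (g x) - 1) ∂ν)))) :=
    ENNReal.tendsto_ofReal ((Real.continuous_exp.tendsto _).comp hb)
  have hlim : ∀ᵐ X ∂P, Tendsto (fun n => ENNReal.ofReal (Real.exp (realSum (G n) X))) atTop
      (𝓝 (ENNReal.ofReal (Real.exp (realSum g X)))) := by
    filter_upwards [hS.ae_summable_real hg hi] with X hX
    refine ENNReal.tendsto_ofReal ((Real.continuous_exp.tendsto _).comp ?_)
    exact tendsto_tsum_of_dominated_convergence hX (fun x => hGt x)
      (Eventually.of_forall fun n x => hGg n x)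
  calc ∫⁻ X, ENNReal.ofReal (Real.exp (realSum g X)) ∂P
      = ∫⁻ X, liminf (fun n => ENNReal.ofReal (Real.exp (realSum (G n) X))) atTop ∂P :=
        lintegral_congr_ae (by filter_upwards [hlim] with X hX; exact hX.liminf_eq.symm)
    _ ≤ liminf (fun n => ∫⁻ X, ENNReal.ofReal (Real.exp (realSum (G n) X)) ∂P) atTop :=
        lintegral_liminf_le' fun n =>
          (Real.measurable_exp.comp_aemeasurable (hGe n).1).ennreal_ofReal
    _ ≤ liminf (fun n => ENNReal.ofReal (Real.exp (∫ x, (Real.exp (G n x) - 1) ∂ν))) atTop :=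
        liminf_le_liminf (Eventually.of_forall fun n => (hGe n).2)
    _ = _ := hb'.liminf_eq

/-! ### Centred exponential and second moments -/

theorem integrable_sq {g : E → ℝ} (hg : Measurable g) {C : ℝ} (hC : ∀ x, |g x| ≤ C)
    (hi : Integrable g ν) : Integrable (fun x => g x ^ 2) ν := by
  simp_rw [sq]
  exact hi.bdd_mul (c := C) hg.aestronglyMeasurable (ae_of_all _ hC)

/-- Centring replaces e^g − 1 by e^g − 1 − g ≤ e^C g². The bound sees g only through C and ∫ g² dν,
so it stays uniform when a function that is merely square integrable is truncated. -/
theorem lintegral_exp_centered_le [LocallyCompactSpace E] (hS : IsSubPoisson ν P) {g : E → ℝ}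
    (hg : Measurable g) {C : ℝ} (hC : ∀ x, |g x| ≤ C) (hi : Integrable g ν) :
    ∫⁻ X, ENNReal.ofReal (Real.exp (realSum g X - ∫ x, g x ∂ν)) ∂P ≤
      ENNReal.ofReal (Real.exp (Real.exp C * ∫ x, g x ^ 2 ∂ν)) := by
  simp_rw [sub_eq_add_neg, Real.exp_add, mul_comm (Real.exp (realSum g _)),
    ENNReal.ofReal_mul (Real.exp_pos _).le]
  have hm : AEMeasurable (realSum g) P := (hS.integral_realSum hg hi).1.aemeasurable
  have hm' : AEMeasurable (fun X => ENNReal.ofReal (Real.exp (realSum g X))) P :=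
    (Real.measurable_exp.comp_aemeasurable hm).ennreal_ofReal
  rw [lintegral_const_mul'' _ hm']
  refine (mul_le_mul_right (hS.lintegral_exp_realSum_le hg hC hi) _).trans ?_
  rw [← ENNReal.ofReal_mul (Real.exp_pos _).le, ← Real.exp_add]
  refine ENNReal.ofReal_le_ofReal (Real.exp_le_exp.2 ?_)
  have h1 := integrable_exp_sub_one hg hC hi
  have h2 : ∫ x, (Real.exp (g x) - 1 - g x) ∂ν ≤ ∫ x, Real.exp C * g x ^ 2 ∂ν := by
    refine integral_mono (h1.sub hi) ((integrable_sq hg hC hi).const_mul _) fun x => ?_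
    refine (exp_sub_one_sub_le _).trans ?_
    rw [mul_comm]
    gcongr
    exact hC x
  rw [integral_sub h1 hi, integral_const_mul] at h2
  linarith

theorem realSum_const_mul (c : ℝ) (g : E → ℝ) (X : Conf E) :
    realSum (fun x => c * g x) X = c * realSum g X := tsum_mul_left

theorem lintegral_exp_mul_centered_le [LocallyCompactSpace E] (hS : IsSubPoisson ν P) {g : E → ℝ}
    (hg : Measurable g) {C : ℝ} (hC : ∀ x, |g x| ≤ C) (hi : Integrable g ν) {t c : ℝ}
    (hc : |c| ≤ t) :
    ∫⁻ X, ENNReal.ofReal (Real.exp (c * (realSum g X - ∫ x, g x ∂ν))) ∂P ≤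
      ENNReal.ofReal (Real.exp (Real.exp (t * C) * (t ^ 2 * ∫ x, g x ^ 2 ∂ν))) := by
  have h := hS.lintegral_exp_centered_le (g := fun x => c * g x) (by fun_prop) (C := t * C)
    (fun x => by
      rw [abs_mul]
      have := (abs_nonneg _).trans (hC x)
      have h2 := hC x
      have h3 := (abs_nonneg c).trans hc
      gcongr) (hi.const_mul c)
  simp_rw [realSum_const_mul, integral_const_mul, ← mul_sub, mul_pow, integral_const_mul] at h
  refine h.trans (ENNReal.ofReal_le_ofReal (Real.exp_le_exp.2 ?_))
  have h1 : c ^ 2 ≤ t ^ 2 := by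
    rw [← sq_abs]
    gcongr
  have h2 : 0 ≤ ∫ x, g x ^ 2 ∂ν := integral_nonneg fun x => sq_nonneg _
  gcongr

/-- Since |z| is at most twice the larger of |Re z| and |Im z|, the exponential of t|z| is
controlled by real exponentials with exponents ±2t; this explains the factors 2t below. -/
theorem exp_mul_norm_le (z : ℂ) {t : ℝ} (ht : 0 ≤ t) :
    Real.exp (t * ‖z‖) ≤ Real.exp (2 * t * z.re) + Real.exp (-(2 * t) * z.re) +
      (Real.exp (2 * t * z.im) + Real.exp (-(2 * t) * z.im)) := by
  have habs : ∀ y : ℝ, Real.exp (2 * t * |y|) ≤ Real.exp (2 * t * y) + Real.exp (-(2 * t) * y) := by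
    intro y
    have h1 := Real.exp_pos (2 * t * y)
    have h2 := Real.exp_pos (-(2 * t) * y)
    rcases abs_choice y with h | h <;> rw [h]
    · linarith
    · rw [show 2 * t * -y = -(2 * t) * y by ring]
      linarith
  refine le_trans ?_ (add_le_add (habs z.re) (habs z.im))
  have h0 := Complex.norm_le_abs_re_add_abs_im z
  have h1 := Real.exp_pos (2 * t * |z.re|)
  have h2 := Real.exp_pos (2 * t * |z.im|)
  rcases le_total |z.re| |z.im| with h | h
  · have : Real.exp (t * ‖z‖) ≤ Real.exp (2 * t * |z.im|) := by
      refine Real.exp_le_exp.2 ?_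
      nlinarith
    linarith
  · have : Real.exp (t * ‖z‖) ≤ Real.exp (2 * t * |z.re|) := by
      refine Real.exp_le_exp.2 ?_
      nlinarith
    linarith

theorem integral_re_sq_le {g : E → ℂ} (hg : Measurable g) {C : ℝ} (hC : ∀ x, ‖g x‖ ≤ C)
    (hi : Integrable g ν) :
    ∫ x, (g x).re ^ 2 ∂ν ≤ ∫ x, ‖g x‖ ^ 2 ∂ν ∧ ∫ x, (g x).im ^ 2 ∂ν ≤ ∫ x, ‖g x‖ ^ 2 ∂ν := by
  have hn := integrable_sq (g := fun x => ‖g x‖) (by fun_prop) (by simpa using hC) hi.norm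
  constructor
  · refine integral_mono_of_nonneg (ae_of_all _ fun x => sq_nonneg _) hn (ae_of_all _ fun x => ?_)
    simp only
    rw [← sq_abs]
    gcongr
    exact Complex.abs_re_le_norm _
  · refine integral_mono_of_nonneg (ae_of_all _ fun x => sq_nonneg _) hn (ae_of_all _ fun x => ?_)
    simp only
    rw [← sq_abs]
    gcongr
    exact Complex.abs_im_le_norm _

theorem linSum_sub_integral {g : E → ℂ} (hi : Integrable g ν) {X : Conf E}
    (hX : Summable fun x : X.1 => ‖g x‖) :
    (linSum g X - ∫ x, g x ∂ν).re = realSum (fun x => (g x).re) X - ∫ x, (g x).re ∂ν ∧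
    (linSum g X - ∫ x, g x ∂ν).im = realSum (fun x => (g x).im) X - ∫ x, (g x).im ∂ν := by
  have h1 : ∫ x, (g x).re ∂ν = (∫ x, g x ∂ν).re := integral_re hi
  have h2 : ∫ x, (g x).im ∂ν = (∫ x, g x ∂ν).im := integral_im hi
  rw [h1, h2, linSum_eq hX]
  simp

theorem lintegral_exp_norm_centered_le [LocallyCompactSpace E] (hS : IsSubPoisson ν P)
    {g : E → ℂ} (hg : Measurable g) {C : ℝ} (hC : ∀ x, ‖g x‖ ≤ C) (hi : Integrable g ν) {t : ℝ}
    (ht : 0 ≤ t) :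
    ∫⁻ X, ENNReal.ofReal (Real.exp (t * ‖linSum g X - ∫ x, g x ∂ν‖)) ∂P ≤
      4 * ENNReal.ofReal
        (Real.exp (Real.exp (2 * t * C) * ((2 * t) ^ 2 * ∫ x, ‖g x‖ ^ 2 ∂ν))) := by
  have hire : Integrable (fun x => (g x).re) ν := hi.re
  have hiim : Integrable (fun x => (g x).im) ν := hi.im
  have hCre : ∀ x, |(g x).re| ≤ C := fun x => (Complex.abs_re_le_norm _).trans (hC x)
  have hCim : ∀ x, |(g x).im| ≤ C := fun x => (Complex.abs_im_le_norm _).trans (hC x)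
  obtain ⟨hsre, hsim⟩ := integral_re_sq_le hg hC hi
  set B := ENNReal.ofReal (Real.exp (Real.exp (2 * t * C) * ((2 * t) ^ 2 * ∫ x, ‖g x‖ ^ 2 ∂ν)))
  have hmre : AEMeasurable (realSum fun x => (g x).re) P :=
    (hS.integral_realSum (by fun_prop) hire).1.aemeasurable
  have hmim : AEMeasurable (realSum fun x => (g x).im) P :=
    (hS.integral_realSum (by fun_prop) hiim).1.aemeasurable
  have hb1 : ∀ c : ℝ, |c| ≤ 2 * t →
      ∫⁻ X, ENNReal.ofReal (Real.exp (c * (realSum (fun x => (g x).re) X - ∫ x, (g x).re ∂ν))) ∂P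
        ≤ B := fun c hc => by
    refine (hS.lintegral_exp_mul_centered_le (by fun_prop) hCre hire hc).trans ?_
    refine ENNReal.ofReal_le_ofReal (Real.exp_le_exp.2 ?_)
    gcongr
  have hb2 : ∀ c : ℝ, |c| ≤ 2 * t →
      ∫⁻ X, ENNReal.ofReal (Real.exp (c * (realSum (fun x => (g x).im) X - ∫ x, (g x).im ∂ν))) ∂P
        ≤ B := fun c hc => by
    refine (hS.lintegral_exp_mul_centered_le (by fun_prop) hCim hiim hc).trans ?_
    refine ENNReal.ofReal_le_ofReal (Real.exp_le_exp.2 ?_)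
    gcongr
  have ht1 : |2 * t| ≤ 2 * t := (abs_of_nonneg (by positivity)).le
  have ht2 : |-(2 * t)| ≤ 2 * t := by rw [abs_neg]; exact ht1
  set Yr : Conf E → ℝ := fun X => realSum (fun x => (g x).re) X - ∫ x, (g x).re ∂ν with hYr
  set Yi : Conf E → ℝ := fun X => realSum (fun x => (g x).im) X - ∫ x, (g x).im ∂ν with hYi
  have hm1 : ∀ c : ℝ, AEMeasurable (fun X => ENNReal.ofReal (Real.exp (c * Yr X))) P :=
    fun c => by fun_prop
  have hm2 : ∀ c : ℝ, AEMeasurable (fun X => ENNReal.ofReal (Real.exp (c * Yi X))) P :=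
    fun c => by fun_prop
  have hpt : ∀ᵐ X ∂P, ENNReal.ofReal (Real.exp (t * ‖linSum g X - ∫ x, g x ∂ν‖)) ≤
      (ENNReal.ofReal (Real.exp (2 * t * Yr X)) + ENNReal.ofReal (Real.exp (-(2 * t) * Yr X))) +
      (ENNReal.ofReal (Real.exp (2 * t * Yi X)) + ENNReal.ofReal (Real.exp (-(2 * t) * Yi X))) := by
    filter_upwards [hS.ae_summable hg hi] with X hX
    have h := exp_mul_norm_le (linSum g X - ∫ x, g x ∂ν) ht
    obtain ⟨h1, h2⟩ := linSum_sub_integral hi hX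
    rw [h1, h2] at h
    rw [← ENNReal.ofReal_add (by positivity) (by positivity),
      ← ENNReal.ofReal_add (by positivity) (by positivity),
      ← ENNReal.ofReal_add (by positivity) (by positivity)]
    exact ENNReal.ofReal_le_ofReal h
  refine (lintegral_mono_ae hpt).trans ?_
  have hm12 : AEMeasurable (fun X => ENNReal.ofReal (Real.exp (2 * t * Yr X)) +
      ENNReal.ofReal (Real.exp (-(2 * t) * Yr X))) P := (hm1 _).add (hm1 _)
  rw [lintegral_add_left' hm12, lintegral_add_left' (hm1 _),
    lintegral_add_left' (hm2 _)]
  calc _ ≤ (B + B) + (B + B) :=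
        add_le_add (add_le_add (hb1 _ ht1) (hb1 _ ht2)) (add_le_add (hb2 _ ht1) (hb2 _ ht2))
    _ = 4 * B := by ring

/-- The exponential bounds at c = ±1 are combined in `sq_le_exp_add_exp_neg`. That the bound tends
to 0 with ∫ g² dν is what makes the truncated sums Cauchy. -/
theorem lintegral_sq_centered_le [LocallyCompactSpace E] [IsProbabilityMeasure P]
    (hS : IsSubPoisson ν P) {g : E → ℝ} (hg : Measurable g) {C : ℝ} (hC : ∀ x, |g x| ≤ C)
    (hi : Integrable g ν) :
    ∫⁻ X, ENNReal.ofReal ((realSum g X - ∫ x, g x ∂ν) ^ 2) ∂P ≤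
      ENNReal.ofReal (4 * (Real.exp (Real.exp C * ∫ x, g x ^ 2 ∂ν) - 1)) := by
  have hm : AEMeasurable (realSum g) P := (hS.integral_realSum hg hi).1.aemeasurable
  set Y : Conf E → ℝ := fun X => realSum g X - ∫ x, g x ∂ν with hY
  set b := Real.exp (Real.exp C * ∫ x, g x ^ 2 ∂ν)
  have hint : ∀ c : ℝ, |c| ≤ 1 → Integrable (fun X => Real.exp (c * Y X)) P ∧
      ∫ X, Real.exp (c * Y X) ∂P ≤ b := fun c hc => by
    have h1 := hS.lintegral_exp_mul_centered_le hg hC hi hc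
    simp only [one_mul, one_pow] at h1
    have hme : AEMeasurable (fun X => Real.exp (c * Y X)) P := by fun_prop
    have h2 : Integrable (fun X => Real.exp (c * Y X)) P := by
      refine (lintegral_ofReal_ne_top_iff_integrable hme.aestronglyMeasurable
        (ae_of_all _ fun X => (Real.exp_pos _).le)).1 ?_
      exact (h1.trans_lt ENNReal.ofReal_lt_top).ne
    refine ⟨h2, ?_⟩
    rw [integral_eq_lintegral_of_nonneg_ae (ae_of_all _ fun X => (Real.exp_pos _).le) h2.1]
    exact ENNReal.toReal_le_of_le_ofReal (Real.exp_pos _).le h1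
  obtain ⟨i1, l1⟩ := hint 1 (by simp)
  obtain ⟨i2, l2⟩ := hint (-1) (by simp)
  have hii : Integrable (fun X => 2 * (Real.exp (1 * Y X) + Real.exp (-1 * Y X) - 2)) P :=
    ((i1.add i2).sub (integrable_const 2)).const_mul 2
  have hle : ∀ X, Y X ^ 2 ≤ 2 * (Real.exp (1 * Y X) + Real.exp (-1 * Y X) - 2) := fun X => by
    simpa using sq_le_exp_add_exp_neg (Y X)
  refine (lintegral_mono fun X => ENNReal.ofReal_le_ofReal (hle X)).trans ?_
  rw [← ofReal_integral_eq_lintegral_ofReal hii (ae_of_all _ fun X => (sq_nonneg _).trans (hle X))]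
  refine ENNReal.ofReal_le_ofReal ?_
  have i12 : Integrable (fun X => Real.exp (1 * Y X) + Real.exp (-1 * Y X)) P := i1.add i2
  rw [integral_const_mul, integral_sub i12 (integrable_const 2), integral_add i1 i2]
  simp only [integral_const, probReal_univ, smul_eq_mul, one_mul]
  simp only [one_mul] at l1
  linarith

theorem eLpNorm_centered_le [LocallyCompactSpace E] [IsProbabilityMeasure P]
    (hS : IsSubPoisson ν P) {g : E → ℂ} (hg : Measurable g) {C : ℝ} (hC : ∀ x, ‖g x‖ ≤ C)
    (hi : Integrable g ν) :
    eLpNorm (fun X => linSum g X - ∫ x, g x ∂ν) 2 P ^ 2 ≤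
      2 * ENNReal.ofReal (4 * (Real.exp (Real.exp C * ∫ x, ‖g x‖ ^ 2 ∂ν) - 1)) := by
  have hire : Integrable (fun x => (g x).re) ν := hi.re
  have hiim : Integrable (fun x => (g x).im) ν := hi.im
  have hCre : ∀ x, |(g x).re| ≤ C := fun x => (Complex.abs_re_le_norm _).trans (hC x)
  have hCim : ∀ x, |(g x).im| ≤ C := fun x => (Complex.abs_im_le_norm _).trans (hC x)
  obtain ⟨hsre, hsim⟩ := integral_re_sq_le hg hC hi
  have hmre : AEMeasurable (realSum fun x => (g x).re) P :=
    (hS.integral_realSum (by fun_prop) hire).1.aemeasurable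
  have h0 := eLpNorm_nnreal_pow_eq_lintegral (f := fun X => linSum g X - ∫ x, g x ∂ν) (μ := P)
    (p := 2) (by norm_num)
  have h1 : eLpNorm (fun X => linSum g X - ∫ x, g x ∂ν) 2 P ^ 2 =
      ∫⁻ X, ‖linSum g X - ∫ x, g x ∂ν‖ₑ ^ 2 ∂P := by simpa using h0
  have h2 : ∀ᵐ X ∂P, ‖linSum g X - ∫ x, g x ∂ν‖ₑ ^ 2 =
      ENNReal.ofReal ((realSum (fun x => (g x).re) X - ∫ x, (g x).re ∂ν) ^ 2) +
      ENNReal.ofReal ((realSum (fun x => (g x).im) X - ∫ x, (g x).im ∂ν) ^ 2) := by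
    filter_upwards [hS.ae_summable hg hi] with X hX
    obtain ⟨h3, h4⟩ := linSum_sub_integral hi hX
    rw [← h3, ← h4, ← ENNReal.ofReal_add (sq_nonneg _) (sq_nonneg _), ← ofReal_norm,
      ← ENNReal.ofReal_pow (norm_nonneg _), ← Complex.normSq_eq_norm_sq, Complex.normSq_apply, sq, sq]
  rw [h1, lintegral_congr_ae h2, lintegral_add_left' (by fun_prop), two_mul]
  refine add_le_add ((hS.lintegral_sq_centered_le (by fun_prop) hCre hire).trans ?_)
    ((hS.lintegral_sq_centered_le (by fun_prop) hCim hiim).trans ?_)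
  · refine ENNReal.ofReal_le_ofReal ?_
    gcongr
  · refine ENNReal.ofReal_le_ofReal ?_
    gcongr

end IsSubPoisson

end

end GiambelliDPP

namespace GiambelliDPP

/-! ### Regularized sums -/

section

variable {E : Set ℝ} {ν : Measure E} {P : Measure (Conf E)}

/-- The restriction of a function to the points `x` with `|x| ≤ T`, extended by zero. -/
def trunc (f : E → ℂ) (T : ℝ) : E → ℂ := {x : E | |(x : ℝ)| ≤ T}.indicator f

theorem truncSum_eq_linSum (f : E → ℂ) (T : ℝ) : truncSum f T = linSum (trunc f T) := by
  funext X
  simp only [truncSum, linSum, trunc, indicator_apply, mem_ofPred_eq]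

theorem measurableSet_abs_coe_le (T : ℝ) : MeasurableSet {x : E | |(x : ℝ)| ≤ T} :=
  measurableSet_le (by fun_prop) measurable_const

theorem isBounded_abs_coe_le (T : ℝ) : Bornology.IsBounded {x : E | |(x : ℝ)| ≤ T} := by
  rw [Metric.isBounded_iff]
  refine ⟨2 * T, fun a ha b hb => ?_⟩
  rw [mem_ofPred_eq, abs_le] at ha hb
  rw [Subtype.dist_eq, Real.dist_eq, abs_le]
  constructor <;> linarith [ha.1, ha.2, hb.1, hb.2]

theorem measurable_trunc {f : E → ℂ} (hf : Measurable f) (T : ℝ) : Measurable (trunc f T) :=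
  hf.indicator (measurableSet_abs_coe_le T)

theorem norm_trunc_le {f : E → ℂ} (T : ℝ) (x : E) : ‖trunc f T x‖ ≤ ‖f x‖ :=
  norm_indicator_le_norm_self _ _

theorem linSum_sub {f g : E → ℂ} {X : Conf E} (hf : Summable fun x : X.1 => ‖f x‖)
    (hg : Summable fun x : X.1 => ‖g x‖) :
    linSum (fun x => f x - g x) X = linSum f X - linSum g X :=
  hf.of_norm.tsum_sub hg.of_norm

namespace IsSubPoisson

theorem integrable_trunc (hS : IsSubPoisson ν P) {f : E → ℂ} (hf : Measurable f) {C : ℝ}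
    (hC : ∀ x, ‖f x‖ ≤ C) (T : ℝ) : Integrable (trunc f T) ν := by
  have hB := hS.measure_lt_top _ (measurableSet_abs_coe_le T) (isBounded_abs_coe_le T)
  refine (integrable_indicator_iff (measurableSet_abs_coe_le T)).2 ?_
  exact Measure.integrableOn_of_bounded hB.ne hf.aestronglyMeasurable (ae_of_all _ hC)

theorem exists_tail_lt {f : E → ℂ} (hf2 : Integrable (fun x => ‖f x‖ ^ 2) ν) {δ : ℝ}
    (hδ : 0 < δ) :
    ∃ N : ℝ, ∫ x in {x : E | N < |(x : ℝ)|}, ‖f x‖ ^ 2 ∂ν < δ := by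
  have hm : ∀ n : ℕ, MeasurableSet {x : E | (n : ℝ) < |(x : ℝ)|} := fun n =>
    measurableSet_lt measurable_const (by fun_prop)
  have hanti : Antitone fun n : ℕ => {x : E | (n : ℝ) < |(x : ℝ)|} := fun a b hab x hx => by
    simp only [mem_ofPred_eq] at hx ⊢
    exact lt_of_le_of_lt (by exact_mod_cast hab) hx
  have h := hanti.tendsto_setIntegral hm (hf2.integrableOn (s := _))
  have hempty : ⋂ n : ℕ, {x : E | (n : ℝ) < |(x : ℝ)|} = ∅ := by
    refine eq_empty_of_forall_notMem fun x hx => ?_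
    obtain ⟨n, hn⟩ := exists_nat_ge |(x : ℝ)|
    exact (mem_iInter.1 hx n).not_ge hn
  rw [hempty, setIntegral_empty] at h
  obtain ⟨n, hn⟩ := (h.eventually (gt_mem_nhds hδ)).exists
  exact ⟨n, hn⟩

/-- The difference is the centred sum of f over N < |x| ≤ T, and the bound is uniform in T. -/
theorem eLpNorm_trunc_sub_le [LocallyCompactSpace E] [IsProbabilityMeasure P]
    (hS : IsSubPoisson ν P) {f : E → ℂ} (hf : Measurable f) {C : ℝ} (hC : ∀ x, ‖f x‖ ≤ C)
    (hf2 : Integrable (fun x => ‖f x‖ ^ 2) ν) {N T : ℝ} (hNT : N ≤ T) :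
    eLpNorm ((fun X => linSum (trunc f T) X - ∫ x, trunc f T x ∂ν) -
      fun X => linSum (trunc f N) X - ∫ x, trunc f N x ∂ν) 2 P ^ 2 ≤
      2 * ENNReal.ofReal (4 * (Real.exp (Real.exp C *
        ∫ x in {x : E | N < |(x : ℝ)|}, ‖f x‖ ^ 2 ∂ν) - 1)) := by
  have hiT := hS.integrable_trunc hf hC T
  have hiN := hS.integrable_trunc hf hC N
  set g : E → ℂ := fun x => trunc f T x - trunc f N x with hg
  have hgle : ∀ x, ‖g x‖ ≤ {x : E | N < |(x : ℝ)|}.indicator (fun x => ‖f x‖) x := fun x => by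
    simp only [hg, trunc, indicator_apply, mem_ofPred_eq]
    split_ifs <;> first | (exfalso; linarith) | simp
  have hgC : ∀ x, ‖g x‖ ≤ C := fun x =>
    (hgle x).trans ((indicator_le_self' (fun _ _ => norm_nonneg _) x).trans (hC x))
  have hgm : Measurable g := (measurable_trunc hf T).sub (measurable_trunc hf N)
  have h := hS.eLpNorm_centered_le hgm hgC (hiT.sub hiN)
  have hae : ((fun X => linSum (trunc f T) X - ∫ x, trunc f T x ∂ν) -
      fun X => linSum (trunc f N) X - ∫ x, trunc f N x ∂ν) =ᵐ[P]
      fun X => linSum g X - ∫ x, g x ∂ν := by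
    filter_upwards [hS.ae_summable (measurable_trunc hf T) hiT,
      hS.ae_summable (measurable_trunc hf N) hiN] with X h1 h2
    have h3 : linSum g X = linSum (trunc f T) X - linSum (trunc f N) X := linSum_sub h1 h2
    have h4 : ∫ x, g x ∂ν = ∫ x, trunc f T x ∂ν - ∫ x, trunc f N x ∂ν := integral_sub hiT hiN
    rw [Pi.sub_apply, h3, h4]
    ring
  rw [eLpNorm_congr_ae hae]
  refine h.trans ?_
  have hm : MeasurableSet {x : E | N < |(x : ℝ)|} := measurableSet_lt measurable_const (by fun_prop)
  have hle : ∫ x, ‖g x‖ ^ 2 ∂ν ≤ ∫ x in {x : E | N < |(x : ℝ)|}, ‖f x‖ ^ 2 ∂ν := by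
    rw [← integral_indicator hm]
    refine integral_mono_of_nonneg (ae_of_all _ fun x => by positivity) (hf2.indicator hm)
      (ae_of_all _ fun x => ?_)
    have := hgle x
    simp only [indicator_apply] at this ⊢
    split_ifs at this ⊢
    · gcongr
    · have h0 : ‖g x‖ = 0 := le_antisymm this (norm_nonneg _)
      simp [h0]
  gcongr

theorem exists_isRegularizedSum [LocallyCompactSpace E] [IsProbabilityMeasure P]
    (hS : IsSubPoisson ν P) {f : E → ℂ} (hf : Measurable f) {C : ℝ} (hC : ∀ x, ‖f x‖ ≤ C)
    (hf2 : Integrable (fun x => ‖f x‖ ^ 2) ν) :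
    ∃ Φ : Conf E → ℂ, Measurable Φ ∧ IsRegularizedSum P f Φ := by
  have hi := hS.integrable_trunc hf hC
  have hL := fun T => hS.integral_linSum (measurable_trunc hf T) (hi T)
  set Z : ℝ → Conf E → ℂ := fun T X => linSum (trunc f T) X - ∫ x, trunc f T x ∂ν with hZ
  have hZm : ∀ T, AEStronglyMeasurable (Z T) P := fun T =>
    (hL T).1.1.sub aestronglyMeasurable_const
  have hZL : ∀ T, MemLp (Z T) 2 P := fun T => by
    refine ⟨hZm T, ?_⟩
    have h := hS.eLpNorm_centered_le (measurable_trunc hf T)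
      (fun x => (norm_trunc_le T x).trans (hC x)) (hi T)
    have h' := h.trans_lt (ENNReal.mul_lt_top (by simp) ENNReal.ofReal_lt_top)
    exact (ENNReal.pow_lt_top_iff.1 h').resolve_right (by simp)
  have hcau : CauchySeq fun T => (hZL T).toLp (Z T) := by
    rw [EMetric.cauchySeq_iff']
    intro ε hε
    have hcont : Tendsto (fun s : ℝ => 2 * ENNReal.ofReal (4 * (Real.exp (Real.exp C * s) - 1)))
        (𝓝 0) (𝓝 0) := by
      have h1 : Tendsto (fun s : ℝ => 4 * (Real.exp (Real.exp C * s) - 1)) (𝓝 0) (𝓝 0) := by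
        have : Continuous fun s : ℝ => 4 * (Real.exp (Real.exp C * s) - 1) := by fun_prop
        simpa using this.tendsto 0
      have h2 := ENNReal.Tendsto.const_mul (a := 2) (ENNReal.tendsto_ofReal h1) (by simp)
      simpa using h2
    obtain ⟨δ, hδ, hδ'⟩ := Metric.eventually_nhds_iff.1
      (hcont.eventually (gt_mem_nhds (ENNReal.pow_pos hε 2)))
    obtain ⟨N, hN⟩ := exists_tail_lt hf2 hδ
    refine ⟨N, fun T hT => ?_⟩
    rw [Lp.edist_toLp_toLp]
    have h := (hS.eLpNorm_trunc_sub_le hf hC hf2 hT).trans_lt (hδ' (by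
      rw [Real.dist_0_eq_abs, abs_of_nonneg (integral_nonneg fun x => by positivity)]
      exact hN))
    exact lt_of_pow_lt_pow_left' 2 h
  obtain ⟨Φ, hΦ⟩ := cauchySeq_tendsto_of_complete hcau
  rw [Lp.tendsto_Lp_iff_tendsto_eLpNorm'] at hΦ
  refine ⟨Φ, (Lp.stronglyMeasurable Φ).measurable, fun T => ?_, ?_⟩
  · rw [truncSum_eq_linSum]
    exact (hL T).1
  refine tendsto_of_tendsto_of_tendsto_of_le_of_le tendsto_const_nhds hΦ (fun T => zero_le)
    fun T => ?_
  have h1 : (fun X => truncSum f T X - (∫ Y, truncSum f T Y ∂P) - Φ X) = Z T - ⇑Φ := by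
    funext X
    rw [truncSum_eq_linSum, (hL T).2]
    rfl
  rw [h1]
  have h2 : eLpNorm (⇑((hZL T).toLp (Z T)) - ⇑Φ) 2 P = eLpNorm (Z T - ⇑Φ) 2 P :=
    eLpNorm_congr_ae ((hZL T).coeFn_toLp.sub (ae_eq_refl _))
  simp only [h2]
  -- The limit was built in L²; on a probability space it is also the limit in L¹.
  exact eLpNorm_le_eLpNorm_of_exponent_le (by norm_num) ((hZm T).sub (Lp.aestronglyMeasurable Φ))

/-- The truncated sums have exponential moments bounded uniformly in T, and Fatou's lemma along an
almost surely convergent sequence passes the bound to the limit. This covers every version of the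
regularized sum, not only the constructed one. -/
theorem lintegral_exp_isRegularizedSum_lt_top [LocallyCompactSpace E] (hS : IsSubPoisson ν P)
    {f : E → ℂ} (hf : Measurable f) {C : ℝ} (hC : ∀ x, ‖f x‖ ≤ C)
    (hf2 : Integrable (fun x => ‖f x‖ ^ 2) ν) {Φ : Conf E → ℂ} (hΦm : Measurable Φ)
    (hΦ : IsRegularizedSum P f Φ) {t : ℝ} (ht : 0 ≤ t) :
    ∫⁻ X, ENNReal.ofReal (Real.exp (t * ‖Φ X‖)) ∂P < ∞ := by
  have hi := hS.integrable_trunc hf hC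
  have hL := fun T => hS.integral_linSum (measurable_trunc hf T) (hi T)
  set Z : ℝ → Conf E → ℂ := fun T X => linSum (trunc f T) X - ∫ x, trunc f T x ∂ν with hZ
  have hZm : ∀ T, AEStronglyMeasurable (Z T) P := fun T =>
    (hL T).1.1.sub aestronglyMeasurable_const
  have hlim : Tendsto (fun T => eLpNorm (Z T - Φ) 1 P) atTop (𝓝 0) := by
    have h := hΦ.2
    simp only [truncSum_eq_linSum, (hL _).2] at h
    exact h
  obtain ⟨ns, -, hns⟩ := (tendstoInMeasure_of_tendsto_eLpNorm one_ne_zero hZm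
    hΦm.aestronglyMeasurable hlim).exists_seq_tendsto_ae'
  set B := 4 * ENNReal.ofReal
    (Real.exp (Real.exp (2 * t * C) * ((2 * t) ^ 2 * ∫ x, ‖f x‖ ^ 2 ∂ν)))
  have hB : ∀ T, ∫⁻ X, ENNReal.ofReal (Real.exp (t * ‖Z T X‖)) ∂P ≤ B := fun T => by
    refine (hS.lintegral_exp_norm_centered_le (measurable_trunc hf T)
      (fun x => (norm_trunc_le T x).trans (hC x)) (hi T) ht).trans ?_
    have hle : ∫ x, ‖trunc f T x‖ ^ 2 ∂ν ≤ ∫ x, ‖f x‖ ^ 2 ∂ν := by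
      refine integral_mono_of_nonneg (ae_of_all _ fun x => by positivity) hf2
        (ae_of_all _ fun x => ?_)
      have := norm_trunc_le (f := f) T x
      dsimp only
      gcongr
    have hexp := (Real.exp_pos (2 * t * C)).le
    refine mul_le_mul_right (ENNReal.ofReal_le_ofReal (Real.exp_le_exp.2 ?_)) 4
    gcongr
  calc ∫⁻ X, ENNReal.ofReal (Real.exp (t * ‖Φ X‖)) ∂P
      = ∫⁻ X, liminf (fun n => ENNReal.ofReal (Real.exp (t * ‖Z (ns n) X‖))) atTop ∂P := by
        refine lintegral_congr_ae ?_
        filter_upwards [hns] with X hX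
        have hc : Continuous fun z : ℂ => ENNReal.ofReal (Real.exp (t * ‖z‖)) :=
          ENNReal.continuous_ofReal.comp (by fun_prop)
        exact ((hc.tendsto _).comp hX).liminf_eq.symm
    _ ≤ liminf (fun n => ∫⁻ X, ENNReal.ofReal (Real.exp (t * ‖Z (ns n) X‖)) ∂P) atTop := by
        refine lintegral_liminf_le' fun n => ?_
        have := (hZm (ns n)).aemeasurable
        fun_prop
    _ ≤ B := by
        refine liminf_le_of_le (by isBoundedDefault) fun b hb => ?_
        obtain ⟨n, hn⟩ := hb.exists
        exact hn.trans (hB _)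
    _ < ∞ := ENNReal.mul_lt_top (by simp) ENNReal.ofReal_lt_top

theorem lintegral_exp_mul_realSum_lt_top [LocallyCompactSpace E] (hS : IsSubPoisson ν P)
    {g : E → ℝ} (hg : Measurable g) {C : ℝ} (hC : ∀ x, |g x| ≤ C) (hi : Integrable g ν) (t : ℝ) :
    ∫⁻ X, ENNReal.ofReal (Real.exp (t * realSum g X)) ∂P < ∞ := by
  have h := hS.lintegral_exp_realSum_le (g := fun x => t * g x) (C := |t| * C) (hg.const_mul t)
    (fun x => by rw [abs_mul]; gcongr; exact hC x) (hi.const_mul t)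
  simp only [realSum_const_mul] at h
  exact h.trans_lt ENNReal.ofReal_lt_top

end IsSubPoisson

end

end GiambelliDPP

namespace GiambelliDPP

/-! ### Exponential moments -/

/-- All exponential moments of `‖Φ‖` are finite. -/
structure HasExpMoments {Ω F : Type*} [MeasurableSpace Ω] [NormedAddCommGroup F] (P : Measure Ω)
    (Φ : Ω → F) : Prop where
  aestronglyMeasurable : AEStronglyMeasurable Φ P
  integrable_exp_norm : ∀ t : ℝ, 0 ≤ t → Integrable (fun X => Real.exp (t * ‖Φ X‖)) P

namespace HasExpMoments

variable {Ω F G : Type*} [MeasurableSpace Ω] [NormedAddCommGroup F] [NormedAddCommGroup G]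
  {P : Measure Ω}

theorem of_lintegral {Φ : Ω → F} (hΦ : AEStronglyMeasurable Φ P)
    (h : ∀ t : ℝ, 0 ≤ t → ∫⁻ X, ENNReal.ofReal (Real.exp (t * ‖Φ X‖)) ∂P < ∞) :
    HasExpMoments P Φ := by
  refine ⟨hΦ, fun t ht => ?_⟩
  have hm : AEStronglyMeasurable (fun X => Real.exp (t * ‖Φ X‖)) P :=
    (Real.continuous_exp.comp (continuous_const.mul continuous_norm)).comp_aestronglyMeasurable hΦ
  exact (lintegral_ofReal_ne_top_iff_integrable hm (ae_of_all _ fun X => (Real.exp_pos _).le)).1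
    (h t ht).ne

theorem mono {Φ : Ω → F} {Ψ : Ω → G} (hΦ : HasExpMoments P Φ) (hΨ : AEStronglyMeasurable Ψ P)
    (h : ∀ᵐ X ∂P, ‖Ψ X‖ ≤ ‖Φ X‖) : HasExpMoments P Ψ := by
  refine ⟨hΨ, fun t ht => (hΦ.integrable_exp_norm t ht).mono' ?_ ?_⟩
  · exact (Real.continuous_exp.comp (continuous_const.mul continuous_norm)).comp_aestronglyMeasurable
      hΨ
  · filter_upwards [h] with X hX
    rw [Real.norm_of_nonneg (Real.exp_pos _).le]
    gcongr

theorem norm {Φ : Ω → F} (hΦ : HasExpMoments P Φ) : HasExpMoments P fun X => ‖Φ X‖ :=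
  hΦ.mono hΦ.aestronglyMeasurable.norm (ae_of_all _ fun X => by simp)

theorem const [IsFiniteMeasure P] (c : F) : HasExpMoments P fun _ => c :=
  ⟨aestronglyMeasurable_const, fun _ _ => integrable_const _⟩

/-- Here t|a + b| ≤ max(2t|a|, 2t|b|), so it matters that moments of all orders t are assumed. -/
theorem add {Φ Ψ : Ω → F} (hΦ : HasExpMoments P Φ) (hΨ : HasExpMoments P Ψ) :
    HasExpMoments P fun X => Φ X + Ψ X := by
  have hm := hΦ.aestronglyMeasurable.add hΨ.aestronglyMeasurable
  refine ⟨hm, fun t ht => ((hΦ.integrable_exp_norm (2 * t) (by positivity)).add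
    (hΨ.integrable_exp_norm (2 * t) (by positivity))).mono' ?_ (ae_of_all _ fun X => ?_)⟩
  · exact (Real.continuous_exp.comp (continuous_const.mul continuous_norm)).comp_aestronglyMeasurable
      hm
  · rw [Real.norm_of_nonneg (Real.exp_pos _).le, Pi.add_apply]
    have h1 : t * ‖Φ X + Ψ X‖ ≤ max (2 * t * ‖Φ X‖) (2 * t * ‖Ψ X‖) := by
      have h2 := mul_le_mul_of_nonneg_left (norm_add_le (Φ X) (Ψ X)) ht
      rcases le_total (2 * t * ‖Φ X‖) (2 * t * ‖Ψ X‖) with h | h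
      · rw [max_eq_right h]; linarith
      · rw [max_eq_left h]; linarith
    have h3 := (Real.exp_pos (2 * t * ‖Φ X‖)).le
    have h4 := (Real.exp_pos (2 * t * ‖Ψ X‖)).le
    rcases le_max_iff.1 h1 with h | h
    · linarith [Real.exp_le_exp.2 h]
    · linarith [Real.exp_le_exp.2 h]

theorem const_mul {Φ : Ω → ℝ} (hΦ : HasExpMoments P Φ) (c : ℝ) :
    HasExpMoments P fun X => c * Φ X := by
  refine ⟨hΦ.aestronglyMeasurable.const_mul c, fun t ht => ?_⟩
  have h := hΦ.integrable_exp_norm (t * ‖c‖) (by positivity)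
  simpa only [norm_mul, mul_assoc] using h

theorem sub {Φ Ψ : Ω → F} (hΦ : HasExpMoments P Φ) (hΨ : HasExpMoments P Ψ) :
    HasExpMoments P fun X => Φ X - Ψ X := by
  have hneg : HasExpMoments P fun X => -Ψ X :=
    hΨ.mono hΨ.aestronglyMeasurable.neg (ae_of_all _ fun X => by rw [norm_neg])
  simpa only [sub_eq_add_neg] using hΦ.add hneg

theorem sum [IsFiniteMeasure P] {ι : Type*} (s : Finset ι) {Φ : ι → Ω → F}
    (h : ∀ i, HasExpMoments P (Φ i)) : HasExpMoments P fun X => ∑ i ∈ s, Φ i X := by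
  classical
  induction s using Finset.induction_on with
  | empty => simpa using HasExpMoments.const (P := P) (0 : F)
  | insert i s hi ih => simpa only [Finset.sum_insert hi] using (h i).add ih

theorem memLp [IsFiniteMeasure P] {Φ : Ω → F} (hΦ : HasExpMoments P Φ) {p : ℝ≥0∞} (hp : p ≠ ∞) :
    MemLp Φ p P := by
  lift p to NNReal using hp
  refine (memLp_norm_iff hΦ.aestronglyMeasurable).1
    (ProbabilityTheory.memLp_of_mem_interior_integrableExpSet ?_ p)
  have huniv : ProbabilityTheory.integrableExpSet (fun X => ‖Φ X‖) P = univ := by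
    refine eq_univ_of_forall fun t => ?_
    change Integrable (fun X => Real.exp (t * ‖Φ X‖)) P
    refine (hΦ.integrable_exp_norm |t| (abs_nonneg t)).mono' ?_ (ae_of_all _ fun X => ?_)
    · exact (Real.continuous_exp.comp
        (continuous_const.mul continuous_norm)).comp_aestronglyMeasurable hΦ.aestronglyMeasurable
    · rw [Real.norm_of_nonneg (Real.exp_pos _).le]
      gcongr
      exact le_abs_self t
  rw [huniv, interior_univ]
  trivial

theorem integrable_cexp {Φ : Ω → ℂ} (hΦ : HasExpMoments P Φ) :
    Integrable (fun X => Complex.exp (Φ X)) P := by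
  refine (hΦ.integrable_exp_norm 1 zero_le_one).mono'
    (Complex.continuous_exp.comp_aestronglyMeasurable hΦ.aestronglyMeasurable)
    (ae_of_all _ fun X => ?_)
  rw [Complex.norm_exp, one_mul]
  exact Real.exp_le_exp.2 (Complex.re_le_norm _)

end HasExpMoments

/-! ### A criterion for uniform `L¹`-specializations -/

section

variable {E : Set ℝ} {P : Measure (Conf E)}

theorem measurable_app (ρ : SymmSpecialization E) (F : symmFun) : Measurable (ρ.app F) :=
  (ρ F).2

/-- Integrability alone is not stable under products, but membership in every L^p with p finite is,
by Hölder with exponents (2p, 2p). It therefore propagates from the generators to all of Λ. -/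
theorem memLp_app [IsFiniteMeasure P] (ρ : SymmSpecialization E)
    (h : ∀ k, 1 ≤ k → ∀ p : ℝ≥0∞, p ≠ ∞ → MemLp (ρ.app (powerSum k)) p P) (F : symmFun) :
    ∀ p : ℝ≥0∞, p ≠ ∞ → MemLp (ρ.app F) p P := by
  have hF : F ∈ Algebra.adjoin ℂ (range fun k : ℕ => powerSum (k + 1)) := by
    rw [adjoin_powerSum_eq_top]
    trivial
  induction hF using Algebra.adjoin_induction with
  | mem F hF =>
    obtain ⟨k, rfl⟩ := hF
    exact h (k + 1) (by omega)
  | algebraMap c =>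
    intro p _
    have : ρ.app (algebraMap ℂ symmFun c) = fun _ => c := by
      funext X
      rw [SymmSpecialization.app, AlgHom.commutes]
      rfl
    rw [this]
    exact memLp_const c
  | add F G _ _ hF hG =>
    intro p hp
    have : ρ.app (F + G) = ρ.app F + ρ.app G := by
      funext X
      simp only [SymmSpecialization.app, map_add]
      rfl
    rw [this]
    exact (hF p hp).add (hG p hp)
  | mul F G _ _ hF hG =>
    intro p hp
    have : ρ.app (F * G) = ρ.app F * ρ.app G := by
      funext X
      simp only [SymmSpecialization.app, map_mul]
      rfl
    rw [this]
    have h2 : 2 * p ≠ ∞ := ENNReal.mul_ne_top (by simp) hp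
    have : ENNReal.HolderTriple (2 * p) (2 * p) p := by
      constructor
      rw [ENNReal.mul_inv (by simp) (by simp), ← add_mul, ENNReal.inv_two_add_inv_two, one_mul]
    exact (hG _ h2).mul (hF _ h2)

theorem norm_logCoeff_mul_pow (ρ : SymmSpecialization E) (X : Conf E) (k : ℕ) (u : ℂ) :
    ‖logCoeff ρ X (k + 2) * u ^ (k + 2)‖ =
      ‖ρ.app (powerSum (k + 2)) X‖ / ((k + 2 : ℕ) : ℝ) * ‖u‖ ^ (k + 2) := by
  rw [logCoeff, if_neg (by omega), norm_mul, norm_div, norm_pow, Complex.norm_natCast]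

theorem norm_logSeries_le (ρ : SymmSpecialization E) {X : Conf E} {u : ℂ} {C : ℝ}
    (hC : ∀ n, ∑ k ∈ Finset.range n,
      ‖ρ.app (powerSum (k + 2)) X‖ / ((k + 2 : ℕ) : ℝ) * ‖u‖ ^ (k + 2) ≤ C) :
    Summable (fun k => logCoeff ρ X k * u ^ k) ∧
      ‖logSeries ρ X u‖ ≤ ‖u‖ * ‖ρ.app (powerSum 1) X‖ + C := by
  simp only [← norm_logCoeff_mul_pow] at hC
  have h1 : Summable fun k => ‖logCoeff ρ X (k + 2) * u ^ (k + 2)‖ :=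
    summable_of_sum_range_le (fun _ => norm_nonneg _) hC
  have h2 : ∑' k, ‖logCoeff ρ X (k + 2) * u ^ (k + 2)‖ ≤ C :=
    Real.tsum_le_of_sum_range_le (fun _ => norm_nonneg _) hC
  have h3 : Summable (fun k => logCoeff ρ X k * u ^ k) :=
    (summable_nat_add_iff (f := fun k => logCoeff ρ X k * u ^ k) 2).1 h1.of_norm
  refine ⟨h3, ?_⟩
  rw [logSeries, ← h3.sum_add_tsum_nat_add 2]
  refine (norm_add_le _ _).trans (add_le_add ?_ ((norm_tsum_le_tsum_norm h1).trans h2))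
  simp [Finset.sum_range_succ, logCoeff, mul_comm]

/-- One majorant per radius serves all conditions: a single term bounds each p_k, boundedness gives
convergence, and the total bounds S_X(u). The index starts at 2 because p_1 is treated separately.
-/
theorem isUniformL1Specialization_of_hasExpMoments [IsFiniteMeasure P] {ρ : SymmSpecialization E}
    {R : ℝ} (hR : 0 < R) (h1 : HasExpMoments P (ρ.app (powerSum 1)))
    (h2 : ∀ r : ℝ, 0 ≤ r → r < R → ∃ Ψ : Conf E → ℝ, HasExpMoments P Ψ ∧
      ∀ᵐ X ∂P, ∀ n, ∑ k ∈ Finset.range n,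
        ‖ρ.app (powerSum (k + 2)) X‖ / ((k + 2 : ℕ) : ℝ) * r ^ (k + 2) ≤ Ψ X) :
    IsUniformL1Specialization P R ρ := by
  have hnn : ∀ {r : ℝ} (X : Conf E) (k : ℕ), 0 ≤ r →
      0 ≤ ‖ρ.app (powerSum (k + 2)) X‖ / ((k + 2 : ℕ) : ℝ) * r ^ (k + 2) :=
    fun X k hr => by positivity
  have hsingle : ∀ {r C : ℝ} {X : Conf E}, 0 ≤ r → (∀ n, ∑ k ∈ Finset.range n,
      ‖ρ.app (powerSum (k + 2)) X‖ / ((k + 2 : ℕ) : ℝ) * r ^ (k + 2) ≤ C) → ∀ k,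
      ‖ρ.app (powerSum (k + 2)) X‖ / ((k + 2 : ℕ) : ℝ) * r ^ (k + 2) ≤ C := fun hr hC k =>
    (Finset.single_le_sum (f := fun k => ‖ρ.app (powerSum (k + 2)) _‖ / ((k + 2 : ℕ) : ℝ) *
      _ ^ (k + 2)) (fun i _ => hnn _ i hr) (Finset.self_mem_range_succ k)).trans (hC (k + 1))
  refine ⟨fun F => ?_, ?_, fun n z w hz hw => ?_⟩
  · refine memLp_one_iff_integrable.1 (memLp_app ρ (fun k hk p hp => ?_) F 1 (by simp))
    obtain rfl | ⟨k, rfl⟩ : k = 1 ∨ ∃ j, k = j + 2 := by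
      rcases hk.eq_or_lt with h | h
      · exact Or.inl h.symm
      · exact Or.inr ⟨k - 2, by omega⟩
    · exact h1.memLp hp
    -- Any radius in (0, R) would do here.
    · obtain ⟨Ψ, hΨ, hle⟩ := h2 (R / 2) (by positivity) (by linarith)
      have hc : 0 < (R / 2) ^ (k + 2) / ((k + 2 : ℕ) : ℝ) := by positivity
      refine (HasExpMoments.mono (hΨ.const_mul ((R / 2) ^ (k + 2) / ((k + 2 : ℕ) : ℝ))⁻¹)
        (measurable_app ρ _).aestronglyMeasurable ?_).memLp hp
      filter_upwards [hle] with X hX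
      refine le_trans ?_ (le_abs_self _)
      rw [inv_mul_eq_div, le_div_iff₀ hc]
      refine le_trans (le_of_eq ?_) (hsingle (by positivity) hX k)
      ring
  -- A sequence of radii tending to R keeps the number of exceptional null sets countable.
  · obtain ⟨r, -, hr, hlim⟩ := exists_seq_strictMono_tendsto' hR
    choose Ψ hΨ hle using fun n => h2 (r n) (hr n).1.le (hr n).2
    filter_upwards [ae_all_iff.2 hle] with X hX
    refine le_of_tendsto' (ENNReal.tendsto_ofReal hlim) fun n => ?_
    have h0 : 0 ≤ r n := (hr n).1.le
    refine FormalMultilinearSeries.le_radius_of_bound _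
      (max (‖logCoeff ρ X 1‖ * r n) (max 0 (Ψ n X))) fun k => ?_
    rw [FormalMultilinearSeries.ofScalars_norm, Real.coe_toNNReal _ h0]
    match k with
    | 0 => simp [logCoeff]
    | 1 => simp
    | k + 2 =>
      have h3 := norm_logCoeff_mul_pow ρ X k (r n : ℂ)
      rw [norm_mul, norm_pow, Complex.norm_real, Real.norm_of_nonneg h0] at h3
      rw [h3]
      exact (hsingle h0 (hX n) k).trans ((le_max_right _ _).trans (le_max_right _ _))
  · have key : ∀ u : ℂ, ‖u‖ < R → HasExpMoments P fun X => logSeries ρ X u := fun u hu => by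
      obtain ⟨Ψ, hΨ, hle⟩ := h2 ‖u‖ (norm_nonneg u) hu
      have hm : AEStronglyMeasurable (fun X => logSeries ρ X u) P := by
        refine aestronglyMeasurable_of_tendsto_ae atTop
          (f := fun n X => ∑ k ∈ Finset.range n, logCoeff ρ X k * u ^ k) (fun n => ?_) ?_
        · refine (Finset.measurable_fun_sum _ fun k _ => ?_).aestronglyMeasurable
          have := measurable_app ρ (powerSum k)
          unfold logCoeff
          split_ifs <;> fun_prop
        · filter_upwards [hle] with X hX
          exact (norm_logSeries_le ρ hX).1.hasSum.tendsto_sum_nat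
      refine ((h1.norm.const_mul ‖u‖).add hΨ).mono hm ?_
      filter_upwards [hle] with X hX
      exact (norm_logSeries_le ρ hX).2.trans (le_abs_self _)
    exact (HasExpMoments.sum _ fun i => (key _ (hw i)).sub (key _ (hz i))).integrable_cexp

end

end GiambelliDPP

namespace GiambelliDPP

/-! ### Cauchy estimates and the tail of the generating function -/

/-- Cauchy's estimate on the circle |u| = s. The bound by c serves only to make the series analytic
beyond that circle and leaves no trace in the conclusion. -/
theorem norm_coeff_mul_pow_le {a : ℕ → ℂ} {s R c B : ℝ} (hs : 0 < s) (hsR : s < R)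
    (ha : ∀ k, ‖a k‖ * R ^ k ≤ c) (hB : ∀ u : ℂ, ‖u‖ ≤ s → ‖∑' k, a k * u ^ k‖ ≤ B) (k : ℕ) :
    ‖a k‖ * s ^ k ≤ B := by
  have hR : 0 < R := hs.trans hsR
  set p := FormalMultilinearSeries.ofScalars ℂ a with hp
  have hrad : ENNReal.ofReal R ≤ p.radius := by
    refine FormalMultilinearSeries.le_radius_of_bound _ c fun n => ?_
    rw [hp, FormalMultilinearSeries.ofScalars_norm, Real.coe_toNNReal _ hR.le]
    exact ha n
  have hps : HasFPowerSeriesOnBall p.sum p 0 p.radius :=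
    p.hasFPowerSeriesOnBall (lt_of_lt_of_le (ENNReal.ofReal_pos.2 hR) hrad)
  have hsum : ∀ u, p.sum u = ∑' k, a k * u ^ k := fun u => by
    simp only [FormalMultilinearSeries.sum, hp, FormalMultilinearSeries.ofScalars_apply_eq,
      smul_eq_mul]
  have hdiff : DifferentiableOn ℂ p.sum (Metric.ball 0 R) := by
    refine hps.differentiableOn.mono fun u hu => ?_
    refine Metric.eball_subset_eball hrad ?_
    rwa [Metric.eball_ofReal]
  have hcl : DiffContOnCl ℂ p.sum (Metric.ball 0 s) :=
    (hdiff.mono (by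
      rw [closure_ball _ hs.ne']
      exact Metric.closedBall_subset_ball hsR)).diffContOnCl
  have h1 := Complex.norm_iteratedDeriv_le_of_forall_mem_sphere_norm_le (C := B) k hs hcl
    fun z hz => by
      rw [hsum]
      exact hB z (by simpa using (mem_sphere_zero_iff_norm.1 hz).le)
  have h2 := hps.hasFPowerSeriesAt.eq_formalMultilinearSeries
    hps.hasFPowerSeriesAt.analyticAt.hasFPowerSeriesAt
  have h3 : a k = iteratedDeriv k p.sum 0 / (k.factorial : ℂ) := by
    have := congrArg (fun q => FormalMultilinearSeries.coeff q k) h2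
    simpa only [hp, FormalMultilinearSeries.coeff_ofScalars] using this
  have hk : (0 : ℝ) < (k.factorial : ℝ) := by exact_mod_cast k.factorial_pos
  rw [h3, norm_div, Complex.norm_natCast]
  calc _ ≤ (k.factorial * B / s ^ k) / k.factorial * s ^ k := by gcongr
    _ = B := by field_simp

section

variable {E : Set ℝ} {f : ℕ → E → ℂ} {R c : ℝ}

theorem genFun_sub_eq_tsum {x : E} (hR : 0 < R) (hx : ∀ k, 1 ≤ k → ‖f k x‖ * R ^ k ≤ c) {u : ℂ}
    (hu : ‖u‖ < R) :
    genFun f u x - u * f 1 x = ∑' k, (if k < 2 then 0 else f k x / k) * u ^ k := by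
  have hgeo : Summable fun k : ℕ => c * (‖u‖ / R) ^ k :=
    (summable_geometric_of_lt_one (by positivity) ((div_lt_one hR).2 hu)).mul_left c
  have hle : ∀ k, 1 ≤ k → ‖f k x / (k : ℂ) * u ^ k‖ ≤ c * (‖u‖ / R) ^ k := fun k hk => by
    have hk' : (1 : ℝ) ≤ k := by exact_mod_cast hk
    have hRk : 0 < R ^ k := by positivity
    rw [norm_mul, norm_div, norm_pow, Complex.norm_natCast, div_pow, mul_div_assoc', le_div_iff₀ hRk]
    calc ‖f k x‖ / k * ‖u‖ ^ k * R ^ k ≤ ‖f k x‖ * ‖u‖ ^ k * R ^ k := by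
          gcongr
          exact div_le_self (norm_nonneg _) hk'
      _ = (‖f k x‖ * R ^ k) * ‖u‖ ^ k := by ring
      _ ≤ c * ‖u‖ ^ k := by
          gcongr
          exact hx k hk
  have h1 : Summable fun k : ℕ => f (k + 1) x / ((k : ℂ) + 1) * u ^ (k + 1) := by
    refine Summable.of_norm_bounded ((summable_nat_add_iff 1).2 hgeo) fun k => ?_
    have := hle (k + 1) (by omega)
    push_cast at this
    exact this
  have h2 : Summable fun k : ℕ => (if k < 2 then 0 else f k x / k) * u ^ k := by
    refine (summable_nat_add_iff 2).1
      (Summable.of_norm_bounded ((summable_nat_add_iff 2).2 hgeo) fun k => ?_)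
    simpa using hle (k + 2) (by omega)
  rw [genFun, ← h1.sum_add_tsum_nat_add 1, ← h2.sum_add_tsum_nat_add 2]
  have h3 : ∀ k : ℕ, ((k : ℂ) + 1 + 1) = k + 2 := fun k => by ring
  simp [Finset.sum_range_succ, h3, mul_comm]

theorem norm_tail_coeff_le {x : E} {s B : ℝ} (hs : 0 < s) (hsR : s < R)
    (hx : ∀ k, 1 ≤ k → ‖f k x‖ * R ^ k ≤ c)
    (hB : ∀ u : ℂ, ‖u‖ ≤ s → ‖genFun f u x - u * f 1 x‖ ≤ B) (k : ℕ) :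
    ‖f (k + 2) x‖ / ((k + 2 : ℕ) : ℝ) * s ^ (k + 2) ≤ B := by
  have hR : 0 < R := hs.trans hsR
  have hc : 0 ≤ c := (by positivity : 0 ≤ ‖f 1 x‖ * R ^ 1).trans (hx 1 le_rfl)
  have h := norm_coeff_mul_pow_le (a := fun k => if k < 2 then 0 else f k x / k) (c := c) hs hsR
    (fun k => ?_) (fun u hu => ?_) (k + 2) (B := B)
  · rwa [if_neg (by omega), norm_div, Complex.norm_natCast] at h
  · split_ifs with hk
    · simpa using hc
    · have hk' : (1 : ℝ) ≤ k := by exact_mod_cast (by omega : 1 ≤ k)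
      rw [norm_div, Complex.norm_natCast]
      refine le_trans ?_ (hx k (by omega))
      gcongr
      exact div_le_self (norm_nonneg _) hk'
  · rw [← genFun_sub_eq_tsum hR hx (hu.trans_lt hsR)]
    exact hB u hu

/-- The growth bound compares the tail with a geometric series of ratio r/R and makes it bounded.
Far out, Cauchy's estimate at radius s gives ratio r/s and a multiple of |h|, hence integrability;
the remaining bounded region has finite measure. -/
theorem exists_integrable_majorant {ν : Measure E}
    (hν : ∀ B : Set E, MeasurableSet B → Bornology.IsBounded B → ν B < ∞)
    (hf : ∀ k, 1 ≤ k → Measurable (f k)) (hR : 0 < R)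
    (hb : ∀ᵐ x ∂ν, ∀ k, 1 ≤ k → ‖f k x‖ * R ^ k ≤ c) {h : E → ℝ} (hi : Integrable h ν)
    (h_dom : ∀ C : Set ℂ, IsCompact C → C ⊆ Metric.ball 0 R →
      ∃ M A : ℝ, ∀ᵐ x : E ∂ν, M ≤ |(x : ℝ)| →
        ∀ u ∈ C, ‖genFun f u x - u * f 1 x‖ ≤ A * h x) {r : ℝ} (hr : 0 ≤ r) (hrR : r < R) :
    ∃ G : E → ℝ, Measurable G ∧ (∀ x, 0 ≤ G x) ∧ (∃ C, ∀ x, |G x| ≤ C) ∧ Integrable G ν ∧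
      ∀ᵐ x ∂ν, ∀ n, ∑ k ∈ Finset.range n,
        ‖f (k + 2) x‖ / ((k + 2 : ℕ) : ℝ) * r ^ (k + 2) ≤ G x := by
  obtain ⟨s, hrs, hsR⟩ := exists_between hrR
  have hs : 0 < s := hr.trans_lt hrs
  obtain ⟨M, A, hMA⟩ := h_dom (Metric.closedBall 0 s) (isCompact_closedBall _ _)
    (Metric.closedBall_subset_ball hsR)
  set t : ℕ → E → ℝ := fun k x => ‖f (k + 2) x‖ / ((k + 2 : ℕ) : ℝ) * r ^ (k + 2) with ht
  have ht0 : ∀ k x, 0 ≤ t k x := fun k x => by positivity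
  have htm : ∀ k, Measurable (t k) := fun k => by
    have := hf (k + 2) (by omega)
    fun_prop
  have hgR : Summable fun k : ℕ => (r / R) ^ k :=
    summable_geometric_of_lt_one (by positivity) ((div_lt_one hR).2 hrR)
  have hgs : Summable fun k : ℕ => (r / s) ^ k :=
    summable_geometric_of_lt_one (by positivity) ((div_lt_one hs).2 hrs)
  set D := ∑' k : ℕ, (r / R) ^ k
  set D' := ∑' k : ℕ, (r / s) ^ k
  have hD : 0 ≤ D := tsum_nonneg fun k => by positivity
  have hD' : 0 ≤ D' := tsum_nonneg fun k => by positivity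
  have hpart : ∀ {q b : ℝ} {x : E}, 0 < q → r < q → (∀ k, t k x * q ^ (k + 2) ≤
      b * r ^ (k + 2)) → 0 ≤ b → Summable (fun k => t k x) ∧
      ∑' k, t k x ≤ b * ∑' k : ℕ, (r / q) ^ k := fun {q b x} hq hrq hle hb0 => by
    have hg : Summable fun k : ℕ => (r / q) ^ k :=
      summable_geometric_of_lt_one (by positivity) ((div_lt_one hq).2 hrq)
    have hle' : ∀ k, t k x ≤ b * (r / q) ^ k := fun k => by
      have h1 : t k x ≤ b * (r / q) ^ (k + 2) := by
        rw [div_pow, mul_div_assoc', le_div_iff₀ (by positivity)]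
        exact hle k
      refine h1.trans (mul_le_mul_of_nonneg_left ?_ hb0)
      exact pow_le_pow_of_le_one (by positivity) ((div_lt_one hq).2 hrq).le (by omega)
    have hsum := Summable.of_nonneg_of_le (fun k => ht0 k x) hle' (hg.mul_left b)
    exact ⟨hsum, (hsum.tsum_le_tsum hle' (hg.mul_left b)).trans_eq tsum_mul_left⟩
  have hbx : ∀ᵐ x ∂ν, Summable (fun k => t k x) ∧ ∑' k, t k x ≤ |c| * D := by
    filter_upwards [hb] with x hx
    refine hpart hR hrR (fun k => ?_) (abs_nonneg c)
    have h1 := (hx (k + 2) (by omega)).trans (le_abs_self c)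
    have hk' : (1 : ℝ) ≤ ((k + 2 : ℕ) : ℝ) := by exact_mod_cast (by omega : 1 ≤ k + 2)
    calc t k x * R ^ (k + 2) ≤ ‖f (k + 2) x‖ * r ^ (k + 2) * R ^ (k + 2) := by
          simp only [ht]
          gcongr
          exact div_le_self (norm_nonneg _) hk'
      _ = (‖f (k + 2) x‖ * R ^ (k + 2)) * r ^ (k + 2) := by ring
      _ ≤ |c| * r ^ (k + 2) := by gcongr
  have hfar : ∀ᵐ x : E ∂ν, M ≤ |(x : ℝ)| → ∑' k, t k x ≤ |A * h x| * D' := by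
    filter_upwards [hb, hMA] with x hx hxA hxM
    refine (hpart hs hrs (fun k => ?_) (abs_nonneg _)).2
    have h1 := norm_tail_coeff_le hs hsR hx
      (fun u hu => (hxA hxM u (by simpa using hu)).trans (le_abs_self _)) k
    calc t k x * s ^ (k + 2)
        = (‖f (k + 2) x‖ / ((k + 2 : ℕ) : ℝ) * s ^ (k + 2)) * r ^ (k + 2) := by
          simp only [ht]; ring
      _ ≤ |A * h x| * r ^ (k + 2) := by gcongr
  -- G is the sum of the tail for almost every x; the minimum makes it bounded everywhere.
  set G : E → ℝ := fun x => min (|c| * D) (∑' k, ENNReal.ofReal (t k x)).toReal with hG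
  have hGm : Measurable G := measurable_const.min
    (Measurable.tsum fun k => (htm k).ennreal_ofReal).ennreal_toReal
  have hG0 : ∀ x, 0 ≤ G x := fun x => le_min (by positivity) ENNReal.toReal_nonneg
  have hGC : ∀ x, |G x| ≤ |c| * D := fun x => by
    rw [abs_of_nonneg (hG0 x)]
    exact min_le_left _ _
  have hGe : ∀ᵐ x ∂ν, G x = ∑' k, t k x := by
    filter_upwards [hbx] with x hx
    simp only [hG]
    rw [← ENNReal.ofReal_tsum_of_nonneg (fun k => ht0 k x) hx.1,
      ENNReal.toReal_ofReal (tsum_nonneg fun k => ht0 k x), min_eq_right hx.2]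
  refine ⟨G, hGm, hG0, ⟨_, hGC⟩, ?_, ?_⟩
  · have hi1 : Integrable ({x : E | |(x : ℝ)| ≤ M}.indicator fun _ => |c| * D) ν := by
      refine (integrable_indicator_iff (measurableSet_abs_coe_le M)).2 ?_
      exact integrableOn_const (hν _ (measurableSet_abs_coe_le M) (isBounded_abs_coe_le M)).ne
    have hi2 : Integrable (fun x => |A * h x| * D') ν := ((hi.const_mul A).abs).mul_const D'
    refine (hi1.add hi2).mono' hGm.aestronglyMeasurable ?_
    filter_upwards [hGe, hfar] with x h1 h2
    rw [Real.norm_eq_abs, Pi.add_apply]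
    by_cases hx : |(x : ℝ)| ≤ M
    · rw [indicator_of_mem (by exact hx)]
      have : 0 ≤ |A * h x| * D' := by positivity
      linarith [hGC x]
    · rw [indicator_of_notMem (by exact hx), zero_add, abs_of_nonneg (hG0 x), h1]
      exact h2 (not_le.1 hx).le
  · filter_upwards [hGe, hbx] with x h1 h2 n
    rw [h1]
    exact h2.1.sum_le_tsum _ fun k _ => ht0 k x

end

end GiambelliDPP

namespace GiambelliDPP

/-! ### Specializations given by additive functionals -/

section

variable {E : Set ℝ} {ν : Measure E} {P : Measure (Conf E)} {f : ℕ → E → ℂ} {R : ℝ}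

theorem IsSum.ae_eq_linSum {g : E → ℂ} {Φ : Conf E → ℂ} (h : IsSum P g Φ) :
    ∀ᵐ X ∂P, Φ X = linSum g X := by
  filter_upwards [h] with X hX
  exact hX.tsum_eq.symm

namespace IsSubPoisson

theorem isSum_linSum (hS : IsSubPoisson ν P) {g : E → ℂ} (hg : Measurable g)
    (hi : Integrable g ν) : IsSum P g (linSum g) := by
  filter_upwards [hS.ae_summable hg hi] with X hX
  exact hX.of_norm.hasSum

theorem ae_eq_of_isCenteredSum (hS : IsSubPoisson ν P) {g : E → ℂ} (hg : Measurable g)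
    (hi : Integrable g ν) {Φ : Conf E → ℂ} (h : IsCenteredSum P g Φ) :
    ∀ᵐ X ∂P, Φ X = linSum g X - ∫ x, g x ∂ν := by
  obtain ⟨S, -, hSum, hΦ⟩ := h
  rw [integral_congr_ae hSum.ae_eq_linSum, (hS.integral_linSum hg hi).2] at hΦ
  filter_upwards [hΦ, hSum.ae_eq_linSum] with X h1 h2
  rw [h1, h2]

/-- An integrable majorant of the tails `∑_{k ≥ 2} ‖f_k‖ r^k / k` bounds the same tails of the
additive functionals. -/
theorem exists_hasExpMoments_tail [LocallyCompactSpace E] [IsProbabilityMeasure P]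
    (hS : IsSubPoisson ν P) (hf : ∀ k, 1 ≤ k → Measurable (f k))
    (hi : ∀ k, 2 ≤ k → Integrable (f k) ν) {m : ℕ → ℂ} (hm : ∀ k, ‖m k‖ ≤ ∫ x, ‖f k x‖ ∂ν)
    {Φ : ℕ → Conf E → ℂ} (hΦ : ∀ k, 2 ≤ k → ∀ᵐ X ∂P, Φ k X = linSum (f k) X - m k) {r : ℝ}
    (hr : 0 ≤ r) {G : E → ℝ} (hG : Measurable G) (hG0 : ∀ x, 0 ≤ G x) (hGC : ∃ C, ∀ x, |G x| ≤ C)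
    (hGi : Integrable G ν) (hle : ∀ᵐ x ∂ν, ∀ n, ∑ k ∈ Finset.range n,
        ‖f (k + 2) x‖ / ((k + 2 : ℕ) : ℝ) * r ^ (k + 2) ≤ G x) :
    ∃ Ψ : Conf E → ℝ, HasExpMoments P Ψ ∧ ∀ᵐ X ∂P, ∀ n, ∑ k ∈ Finset.range n,
        ‖Φ (k + 2) X‖ / ((k + 2 : ℕ) : ℝ) * r ^ (k + 2) ≤ Ψ X := by
  obtain ⟨C, hGC⟩ := hGC
  have hGm : AEStronglyMeasurable (realSum G) P := (hS.integral_realSum hG hGi).1.1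
  have hG1 : HasExpMoments P (realSum G) := by
    refine .of_lintegral hGm fun t _ => ?_
    have hn : ∀ X, ‖realSum G X‖ = realSum G X := fun X =>
      Real.norm_of_nonneg (tsum_nonneg fun x => hG0 x)
    simp only [hn]
    exact hS.lintegral_exp_mul_realSum_lt_top hG hGC hGi t
  -- The sum of G absorbs the sums of the f_k, and the integral absorbs the centring constants m_k.
  refine ⟨fun X => realSum G X + ∫ x, G x ∂ν, hG1.add (.const _), ?_⟩
  have hΦ' := ae_all_iff.2 fun k => hΦ (k + 2) (by omega)
  have hs := ae_all_iff.2 fun k => hS.ae_summable (hf (k + 2) (by omega)) (hi (k + 2) (by omega))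
  filter_upwards [hΦ', hs, hS.ae_summable_real hG hGi, hS.ae_forall hle] with X h1 h2 h3 h4 n
  set w : ℕ → ℝ := fun k => r ^ (k + 2) / ((k + 2 : ℕ) : ℝ) with hw
  have hw0 : ∀ k, 0 ≤ w k := fun k => by positivity
  have hcomm : ∀ (k : ℕ) (y : ℝ), y / ((k + 2 : ℕ) : ℝ) * r ^ (k + 2) = w k * y :=
    fun k y => by simp only [hw]; ring
  simp only [hcomm] at h4 hle ⊢
  have hsum : ∀ k, Summable fun x : X.1 => w k * ‖f (k + 2) x‖ := fun k => (h2 k).mul_left _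
  have hA : ∑ k ∈ Finset.range n, w k * ∑' x : X.1, ‖f (k + 2) x‖ ≤ realSum G X := by
    simp only [← tsum_mul_left]
    rw [← Summable.tsum_finsetSum fun k _ => hsum k]
    exact (summable_sum fun k _ => hsum k).tsum_le_tsum (fun x => h4 x n) h3.of_norm
  have hB : ∑ k ∈ Finset.range n, w k * ∫ x, ‖f (k + 2) x‖ ∂ν ≤ ∫ x, G x ∂ν := by
    have hint : ∀ k, Integrable (fun x => w k * ‖f (k + 2) x‖) ν := fun k =>
      (hi (k + 2) (by omega)).norm.const_mul _
    simp only [← integral_const_mul]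
    rw [← integral_finsetSum _ fun k _ => hint k]
    refine integral_mono_ae (integrable_finsetSum _ fun k _ => hint k) hGi ?_
    filter_upwards [hle] with x hx
    exact hx n
  refine le_trans ?_ (add_le_add hA hB)
  rw [← Finset.sum_add_distrib]
  refine Finset.sum_le_sum fun k _ => ?_
  rw [← mul_add, h1 k]
  refine mul_le_mul_of_nonneg_left ((norm_sub_le _ _).trans (add_le_add ?_ (hm _))) (hw0 k)
  exact norm_tsum_le_tsum_norm (h2 k)

/-- The sequence m treats both kinds of specialization at once: the means of the sums for the
centred one, 0 for the partly centred one. -/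
theorem exists_specialization [LocallyCompactSpace E] [IsProbabilityMeasure P]
    (hS : IsSubPoisson ν P) (hf : ∀ k, 1 ≤ k → Measurable (f k)) {C : ℝ} (hC : ∀ x, ‖f 1 x‖ ≤ C)
    (hf2 : Integrable (fun x => ‖f 1 x‖ ^ 2) ν) (hi : ∀ k, 2 ≤ k → Integrable (f k) ν)
    (m : ℕ → ℂ) :
    ∃ ρ : SymmSpecialization E, IsRegularizedSum P (f 1) (ρ.app (powerSum 1)) ∧
      ∀ k, 2 ≤ k → ∀ᵐ X ∂P, ρ.app (powerSum k) X = linSum (f k) X - m k := by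
  obtain ⟨Φ, hΦm, hΦ⟩ := hS.exists_isRegularizedSum (hf 1 le_rfl) hC hf2
  have hL : ∀ k, 2 ≤ k → ∃ a : measFun (Conf E), ∀ᵐ X ∂P, (a : Conf E → ℂ) X =
      linSum (f k) X - m k := fun k hk => by
    have h := (hS.integral_linSum (hf k (by omega)) (hi k hk)).1.1.sub
      (aestronglyMeasurable_const (b := m k))
    -- A specialization takes values in genuinely measurable functions, so a measurable version of
    -- the sum is chosen.
    exact ⟨⟨h.mk _, h.stronglyMeasurable_mk.measurable⟩, h.ae_eq_mk.symm⟩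
  choose! a ha using hL
  obtain ⟨(ρ : SymmSpecialization E), hρ⟩ := exists_algHom_powerSum
    fun k => if k = 1 then (⟨Φ, hΦm⟩ : measFun (Conf E)) else a k
  refine ⟨ρ, ?_, fun k hk => ?_⟩
  · have h1 : ρ.app (powerSum 1) = Φ := by
      funext X
      rw [SymmSpecialization.app, hρ 1 le_rfl, if_pos rfl]
    rwa [h1]
  · have h1 : ∀ X, ρ.app (powerSum k) X = (a k : Conf E → ℂ) X := fun X => by
      rw [SymmSpecialization.app, hρ k (by omega), if_neg (by omega)]
    simpa only [h1] using ha k hk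

theorem isUniformL1Specialization [LocallyCompactSpace E] [IsProbabilityMeasure P]
    (hS : IsSubPoisson ν P) (hf : ∀ k, 1 ≤ k → Measurable (f k)) {C : ℝ} (hC : ∀ x, ‖f 1 x‖ ≤ C)
    (hf2 : Integrable (fun x => ‖f 1 x‖ ^ 2) ν) (hi : ∀ k, 2 ≤ k → Integrable (f k) ν)
    (hR : 0 < R)
    (hG : ∀ r : ℝ, 0 ≤ r → r < R → ∃ G : E → ℝ, Measurable G ∧ (∀ x, 0 ≤ G x) ∧
      (∃ C, ∀ x, |G x| ≤ C) ∧ Integrable G ν ∧ ∀ᵐ x ∂ν, ∀ n, ∑ k ∈ Finset.range n,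
        ‖f (k + 2) x‖ / ((k + 2 : ℕ) : ℝ) * r ^ (k + 2) ≤ G x)
    {m : ℕ → ℂ} (hm : ∀ k, ‖m k‖ ≤ ∫ x, ‖f k x‖ ∂ν) {ρ : SymmSpecialization E}
    (hρ : IsRegularizedSum P (f 1) (ρ.app (powerSum 1)))
    (hρm : ∀ k, 2 ≤ k → ∀ᵐ X ∂P, ρ.app (powerSum k) X = linSum (f k) X - m k) :
    IsUniformL1Specialization P R ρ := by
  have h1 := measurable_app ρ (powerSum 1)
  refine isUniformL1Specialization_of_hasExpMoments hR
    (.of_lintegral h1.aestronglyMeasurable fun t ht =>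
      hS.lintegral_exp_isRegularizedSum_lt_top (hf 1 le_rfl) hC hf2 h1 hρ ht) fun r hr hrR => ?_
  obtain ⟨G, hGm, hG0, hGC, hGi, hle⟩ := hG r hr hrR
  exact hS.exists_hasExpMoments_tail hf hi hm (Φ := fun k => ρ.app (powerSum k)) hρm hr hGm hG0 hGC
    hGi hle

end IsSubPoisson

theorem integrable_intensity {μ : Measure E} {K : E → E → ℂ} (hK : IsProjectionKernel μ K)
    {g : E → ℝ} (hg0 : ∀ x, 0 ≤ g x) (hg : Integrable (fun x => ((g x : ℝ) : ℂ) * K x x) μ) :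
    Integrable g (intensity μ K) := by
  refine (integrable_intensity_iff hK.measurable g).2 (hg.norm.congr (ae_of_all _ fun x => ?_))
  simp only [norm_mul, Complex.norm_real, Real.norm_of_nonneg (hg0 x)]

theorem ae_norm_mul_pow_le {μ : Measure E}
    (h : (⨆ (k : ℕ) (_ : 1 ≤ k), ENNReal.ofReal (R ^ k) * eLpNorm (f k) ∞ μ) < ∞) :
    ∃ c : ℝ, ∀ᵐ x ∂μ, ∀ k, 1 ≤ k → ‖f k x‖ * R ^ k ≤ c := by
  set s := ⨆ (k : ℕ) (_ : 1 ≤ k), ENNReal.ofReal (R ^ k) * eLpNorm (f k) ∞ μ with hs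
  refine ⟨s.toReal, ?_⟩
  have h1 : ∀ᵐ x ∂μ, ∀ k, ‖f k x‖ₑ ≤ eLpNormEssSup (f k) μ :=
    ae_all_iff.2 fun k => enorm_ae_le_eLpNormEssSup (f k) μ
  filter_upwards [h1] with x hx k hk
  refine (ENNReal.ofReal_le_iff_le_toReal h.ne).1 ?_
  rw [ENNReal.ofReal_mul (norm_nonneg _), ofReal_norm, mul_comm]
  refine le_trans ?_ (le_iSup₂ (f := fun (k : ℕ) (_ : 1 ≤ k) =>
    ENNReal.ofReal (R ^ k) * eLpNorm (f k) ∞ μ) k hk)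
  rw [eLpNorm_exponent_top]
  exact mul_le_mul_right (hx k) _

theorem locallyCompactSpace_of_forall_not_accPt {E : Set ℝ} (h : ∀ x : ℝ, ¬ AccPt x (𝓟 E)) :
    LocallyCompactSpace E :=
  ((isClosed_iff_accPt (s := E)).2 fun x hx => absurd hx (h x)).locallyCompactSpace

end

end GiambelliDPP

end

open GiambelliDPP in
theorem mainTheorem7 (E : Set ℝ) (μ : Measure E) [IsLocallyFiniteMeasure μ]
    (hE : (IsOpen E ∧ ∀ x : E, μ {x} = 0) ∨
      (E.Countable ∧ (∀ x : ℝ, ¬ AccPt x (𝓟 E)) ∧ μ = Measure.count))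
    (K : E → E → ℂ) (hK : IsProjectionKernel μ K)
    (P : Measure (Conf E)) [IsProbabilityMeasure P] (hP : IsDeterminantal μ K P)
    (f : ℕ → E → ℂ) (hf_meas : ∀ k, 1 ≤ k → Measurable (f k))
    (hf_bdd : ∀ k, 1 ≤ k → ∃ C : ℝ, ∀ x, ‖f k x‖ ≤ C)
    (R : ℝ) (hR : 0 < R)
    (hf_growth : (⨆ (k : ℕ) (_ : 1 ≤ k), ENNReal.ofReal (R ^ k) * eLpNorm (f k) ∞ μ) < ∞)
    (hf_one : Integrable (fun x => ((‖f 1 x‖ ^ 2 : ℝ) : ℂ) * K x x) μ)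
    (hf_two : ∀ k, 2 ≤ k → Integrable (fun x => ((‖f k x‖ : ℝ) : ℂ) * K x x) μ)
    (h : E → ℝ) (h_meas : AEMeasurable h μ) (h_nonneg : ∀ x, 0 ≤ h x)
    (h_int : Integrable (fun x => ((h x : ℝ) : ℂ) * K x x) μ)
    (h_dom : ∀ C : Set ℂ, IsCompact C → C ⊆ Metric.ball 0 R →
      ∃ M A : ℝ, ∀ᵐ x : E ∂μ, M ≤ |(x : ℝ)| →
        ∀ u ∈ C, ‖genFun f u x - u * f 1 x‖ ≤ A * h x)
    (hf_exp : ∀ (l l' : ℕ) (w : Fin l → ℂ) (z : Fin l' → ℂ),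
      (∀ j, ‖w j‖ < R) → (∀ j, ‖z j‖ < R) →
      Integrable (fun x =>
        ((‖Complex.exp (∑ j, genFun f (w j) x - ∑ j, genFun f (z j) x) - 1‖ ^ 2 : ℝ) : ℂ)
          * K x x) μ) :
    ((∃ ρ : SymmSpecialization E, IsCenteredSpecialization P f ρ) ∧
      ∀ ρ : SymmSpecialization E, IsCenteredSpecialization P f ρ →
        IsUniformL1Specialization P R ρ) ∧
    ((∃ ρ : SymmSpecialization E, IsPartlyCenteredSpecialization P f ρ) ∧
      ∀ ρ : SymmSpecialization E, IsPartlyCenteredSpecialization P f ρ →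
        IsUniformL1Specialization P R ρ) := by
  -- Open subsets of ℝ and subsets without accumulation points, which are closed, are locally
  -- compact; this provides the exhaustion by compact sets.
  have : LocallyCompactSpace E := by
    rcases hE with ⟨h, -⟩ | ⟨-, h, -⟩
    · exact h.locallyCompactSpace
    · exact locallyCompactSpace_of_forall_not_accPt h
  have hS := hP.isSubPoisson hK
  have hac : intensity μ K ≪ μ := withDensity_absolutelyContinuous _ _
  obtain ⟨C, hC⟩ := hf_bdd 1 le_rfl
  have hf2 : Integrable (fun x => ‖f 1 x‖ ^ 2) (intensity μ K) :=
    integrable_intensity hK (fun x => by positivity) hf_one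
  have hi : ∀ k, 2 ≤ k → Integrable (f k) (intensity μ K) := fun k hk =>
    (integrable_norm_iff (hf_meas k (by omega)).aestronglyMeasurable).1
      (integrable_intensity hK (fun x => norm_nonneg _) (hf_two k hk))
  obtain ⟨c, hc⟩ := ae_norm_mul_pow_le hf_growth
  -- The bounds assumed μ-almost everywhere carry over to the intensity measure by absolute
  -- continuity.
  have hG := fun r hr hrR => exists_integrable_majorant (r := r) hS.measure_lt_top hf_meas hR
    (hac.ae_le hc) (integrable_intensity hK h_nonneg h_int)
    (fun D hD hDR => by
      obtain ⟨M, A, hMA⟩ := h_dom D hD hDR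
      exact ⟨M, A, hac.ae_le hMA⟩) hr hrR
  refine ⟨⟨?_, fun ρ hρ => ?_⟩, ?_, fun ρ hρ => ?_⟩
  · obtain ⟨ρ, h1, h2⟩ := hS.exists_specialization hf_meas hC hf2 hi
      fun k => ∫ x, f k x ∂intensity μ K
    refine ⟨ρ, h1, fun k hk => ?_⟩
    have hL := hS.integral_linSum (hf_meas k (by omega)) (hi k hk)
    refine ⟨linSum (f k), hL.1, hS.isSum_linSum (hf_meas k (by omega)) (hi k hk), ?_⟩
    rw [hL.2]
    exact h2 k hk
  · exact hS.isUniformL1Specialization hf_meas hC hf2 hi hR hG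
      (fun k => norm_integral_le_integral_norm _) hρ.1
      fun k hk => hS.ae_eq_of_isCenteredSum (hf_meas k (by omega)) (hi k hk) (hρ.2 k hk)
  · obtain ⟨ρ, h1, h2⟩ := hS.exists_specialization hf_meas hC hf2 hi fun _ => 0
    refine ⟨ρ, h1, fun k hk => ?_⟩
    filter_upwards [h2 k hk, hS.isSum_linSum (hf_meas k (by omega)) (hi k hk)] with X h3 h4
    rwa [h3, sub_zero]
  · refine hS.isUniformL1Specialization hf_meas hC hf2 hi hR hG (m := fun _ => 0)
      (fun k => ?_) hρ.1 fun k hk => ?_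
    · rw [norm_zero]
      exact integral_nonneg fun x => norm_nonneg _
    · simpa only [sub_zero] using (hρ.2 k hk).ae_eq_linSum
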